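/- **Conventions.** A (generalised) simplicial or square complex may have non-embedded cells, and different cells may have the same boundary; onto each face of each cell there is precisely one attaching map. The *link* of a vertex $v$ of a simplicial complex has one simplex for each simplex $\tau$ of positive dimension and each corner of $\tau$ attached to $v$, namely the face of $\tau$ opposite to that corner. The *link* of a vertex $v$ of a square complex is the graph whose vertices are the ends of edges at $v$ and whose edges are the corners of squares at $v$. A simplicial complex is *simple* if no edge joins a vertex to itself and no two distinct simplices of positive dimension have the same boundary. It is *flag* if it is simple and every finite set of pairwise adjacent vertices spans a simplex. It is *locally $6$-large* if each vertex link is flag and contains no embedded cycle of length $4$ or $5$ without diagonals (edges between nonconsecutive vertices). It is *systolic* if it is connected, simply connected and locally $6$-large. A square complex is *nonpositively curved* if no vertex link contains an embedded combinatorial cycle of length less than $4$, and *CAT(0)* if it is moreover connected and simply connected. A *VH complex* is a square complex whose edges are partitioned into vertical and horizontal ones, such that consecutive sides of each square belong to different classes. Let $X$ be a VH complex. Its *simplexification* $X^*$ is the following simplicial complex. Its vertices are $v^*$, $e^*$, $s^*$ for the vertices $v$, the vertical edges $e$ and the squares $s$ of $X$. Divide each vertical edge $e$ in two at $e^*$ and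 cone off the boundary of each square $s$ (then a hexagon) from $s^*$, dividing $s$ into six triangles. To this triangulation of $X$ attach, for each vertical edge $e$ and each of its two endpoints $v$, the simplex spanned by $v^*$, $e^*$ and all $s_j^*$, where $(s_j)$ are the squares adjacent to $e$, counted with multiplicity; the two simplices of $e$ share the face spanned by $e^*$ and the $s_j^*$. (If there are infinitely many $s_j$, attach all the simplices spanned by finite subsets.) An action of a group on a complex by combinatorial automorphisms is *geometric* if it is proper (all stabilisers of cells are finite) and cocompact (there are finitely many orbits of cells). A group is *systolic* if it acts geometrically on a systolic complex. **Corollary.** If $X$ is a CAT(0) VH complex, then its simplexification $X^*$ is systolic. If moreover a group $G$ acts geometrically on $X$ by combinatorial automorphisms that preserve the set of vertical edges and the set of horizontal edges, then $G$ is systolic. -/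

import Mathlib

open Set Topology

open scoped unitInterval

universe u

/-! ### Generalised simplicial complexes -/

/-- A generalised simplicial complex (simplices need not be embedded, and different simplices may
have the same vertices), presented through its *ordered* simplices: an element of `simplex n` is an
`n`-simplex together with a total ordering of its `n + 1` corners.  For an injection `θ`, `face θ x`
is the face of `x` with corners `θ 0, …, θ m`, in this order; for bijective `θ` it is the same
simplex with its corners reordered.  Hence the simplices themselves are the orbits of the
reorderings.  The law `face_free` says that a simplex is never attached to itself by a nontrivial
permutation of its corners; so onto each face of a simplex there is precisely one attaching map. -/
structure GenSimplicialComplex where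
  simplex : ℕ → Type u
  face : ∀ {m n : ℕ}, (Fin (m + 1) ↪ Fin (n + 1)) → simplex n → simplex m
  face_id : ∀ {n : ℕ} (x : simplex n), face (Function.Embedding.refl _) x = x
  face_comp : ∀ {l m n : ℕ} (η : Fin (l + 1) ↪ Fin (m + 1)) (θ : Fin (m + 1) ↪ Fin (n + 1))
    (x : simplex n), face η (face θ x) = face (η.trans θ) x
  face_free : ∀ {n : ℕ} (θ : Fin (n + 1) ↪ Fin (n + 1)) (x : simplex n),
    face θ x = x → θ = Function.Embedding.refl _

/-- The injection `Fin 1 ↪ Fin (n + 1)` with value `j`. -/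
def pointEmb {n : ℕ} (j : Fin (n + 1)) : Fin (0 + 1) ↪ Fin (n + 1) :=
  ⟨fun _ => j, fun _ _ _ => Subsingleton.elim (α := Fin 1) _ _⟩

/-- The extension of `θ` to an injection that fixes `0` and is `θ` on the successors. -/
def consEmb {m n : ℕ} (θ : Fin (m + 1) ↪ Fin (n + 1)) : Fin (m + 1 + 1) ↪ Fin (n + 1 + 1) :=
  ⟨Fin.cases 0 (fun j => (θ j).succ), by
    intro a b
    refine Fin.cases ?_ (fun a => ?_) a <;> refine Fin.cases ?_ (fun b => ?_) b
    · simp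
    · intro h
      exact absurd h.symm (Fin.succ_ne_zero _)
    · intro h
      exact absurd h (Fin.succ_ne_zero _)
    · intro h
      exact congrArg Fin.succ (θ.injective (Fin.succ_injective _ h))⟩

theorem pointEmb_apply {n : ℕ} (j : Fin (n + 1)) (a) : pointEmb j a = j := rfl

theorem consEmb_zero {m n : ℕ} (θ : Fin (m + 1) ↪ Fin (n + 1)) : consEmb θ 0 = 0 := rfl

theorem consEmb_succ {m n : ℕ} (θ : Fin (m + 1) ↪ Fin (n + 1)) (a : Fin (m + 1)) :
    consEmb θ a.succ = (θ a).succ := rfl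

namespace GenSimplicialComplex

variable (K : GenSimplicialComplex.{u})

/-- The `j`-th corner of an ordered simplex, as a vertex of the complex. -/
def vertex {n : ℕ} (x : K.simplex n) (j : Fin (n + 1)) : K.simplex 0 :=
  K.face (pointEmb j) x

/-- The link of a vertex `v`.  For each simplex of positive dimension and each of its corners
attached to `v` it has one simplex, the face opposite to that corner.  In terms of ordered
simplices: an `n`-simplex of the link is an `(n + 1)`-simplex of `K` whose corner `0` is at `v`. -/
def link (v : K.simplex 0) : GenSimplicialComplex.{u} where
  simplex n := {x : K.simplex (n + 1) // K.vertex x 0 = v}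
  face θ x := ⟨K.face (consEmb θ) x.1, by
    have h : (pointEmb 0).trans (consEmb θ) = pointEmb 0 := by
      ext; rfl
    rw [vertex, K.face_comp, h]
    exact x.2⟩
  face_id x := by
    apply Subtype.ext
    have h : ∀ n, consEmb (Function.Embedding.refl (Fin (n + 1))) = Function.Embedding.refl _ := by
      intro n; ext a; refine Fin.cases ?_ (fun a => ?_) a <;> rfl
    simp [h, K.face_id]
  face_comp η θ x := by
    apply Subtype.ext
    have h : (consEmb η).trans (consEmb θ) = consEmb (η.trans θ) := by
      ext a; refine Fin.cases ?_ (fun a => ?_) a <;> rfl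
    simp [K.face_comp, h]
  face_free θ x hx := by
    have h := K.face_free _ _ (congrArg Subtype.val hx)
    ext1 a
    exact Fin.succ_injective _ (DFunLike.congr_fun h a.succ)

/-- Two vertices are joined by an edge of the complex. -/
def Adj (p q : K.simplex 0) : Prop :=
  ∃ x : K.simplex 1, K.vertex x 0 = p ∧ K.vertex x 1 = q

/-- Two ordered simplices of the same dimension are orderings of the same simplex. -/
def SameSimplex {n : ℕ} (x y : K.simplex n) : Prop :=
  ∃ θ : Fin (n + 1) ↪ Fin (n + 1), K.face θ x = y

/-- Two simplices of the same dimension have the same proper faces. -/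
def SameBoundary {n : ℕ} (x y : K.simplex n) : Prop :=
  ∀ m, m < n → ∀ z : K.simplex m,
    (∃ θ : Fin (m + 1) ↪ Fin (n + 1), K.face θ x = z) ↔
      (∃ θ : Fin (m + 1) ↪ Fin (n + 1), K.face θ y = z)

/-- No edge joins a vertex to itself, and no two simplices of positive dimension have the same
boundary. -/
def IsSimple : Prop :=
  (∀ x : K.simplex 1, K.vertex x 0 ≠ K.vertex x 1) ∧
    ∀ n, 1 ≤ n → ∀ x y : K.simplex n, K.SameBoundary x y → K.SameSimplex x y

/-- The complex is simple and the vertices of each (finite) clique of the `1`-skeleton span a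
simplex. -/
def IsFlag : Prop :=
  K.IsSimple ∧ ∀ (n : ℕ) (p : Fin (n + 1) → K.simplex 0), Function.Injective p →
    (∀ i j, i ≠ j → K.Adj (p i) (p j)) → ∃ x : K.simplex n, ∀ i, K.vertex x i = p i

/-- There is a cycle of length `k` without diagonals: an embedded loop of `k` vertices, such that
no edge connects two of its nonconsecutive vertices. -/
def HasCycleWithoutDiagonals (k : ℕ) : Prop :=
  ∃ p : ZMod k → K.simplex 0, Function.Injective p ∧ (∀ i, K.Adj (p i) (p (i + 1))) ∧
    ∀ i j, i ≠ j → K.Adj (p i) (p j) → j = i + 1 ∨ i = j + 1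

/-- All vertex links are flag and contain no cycles of length `4` or `5` without diagonals. -/
def IsLocallySixLarge : Prop :=
  ∀ v : K.simplex 0, (K.link v).IsFlag ∧ ¬ (K.link v).HasCycleWithoutDiagonals 4 ∧
    ¬ (K.link v).HasCycleWithoutDiagonals 5

/-- The disjoint union of one affine simplex for each ordered simplex. -/
abbrev Cells : Type u := Σ p : (Σ n, K.simplex n), stdSimplex ℝ (Fin (p.1 + 1))

/-- The gluing of each affine simplex to each of its faces (and to its reorderings). -/
inductive Glue : K.Cells → K.Cells → Prop
  | face {m n : ℕ} (θ : Fin (m + 1) ↪ Fin (n + 1)) (x : K.simplex n)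
      (t : stdSimplex ℝ (Fin (m + 1))) :
      Glue ⟨⟨m, K.face θ x⟩, t⟩ ⟨⟨n, x⟩, stdSimplex.map θ t⟩

/-- The geometric realisation, with the quotient topology. -/
def Realization : Type u := Quot K.Glue

instance : TopologicalSpace K.Realization := inferInstanceAs (TopologicalSpace (Quot K.Glue))

/-- A systolic complex: connected, simply connected and locally `6`-large.  (`SimplyConnectedSpace`
contains that the space is nonempty and path connected.) -/
def IsSystolic : Prop := SimplyConnectedSpace K.Realization ∧ K.IsLocallySixLarge

/-- An action of a group by automorphisms of a generalised simplicial complex: compatible actions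
on the sets of ordered simplices. -/
structure Action (G : Type*) [Group G] where
  act : ∀ n, G →* Equiv.Perm (K.simplex n)
  act_face : ∀ (g : G) {m n : ℕ} (θ : Fin (m + 1) ↪ Fin (n + 1)) (x : K.simplex n),
    act m g (K.face θ x) = K.face θ (act n g x)

/-- The action is proper (the stabiliser of each simplex, as a set, is finite) and cocompact
(there are finitely many orbits of simplices). -/
def Action.IsGeometric {K : GenSimplicialComplex.{u}} {G : Type*} [Group G] (ρ : K.Action G) :
    Prop :=
  (∀ n (x : K.simplex n), {g : G | K.SameSimplex x (ρ.act n g x)}.Finite) ∧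
    ∃ F : Set (Σ n, K.simplex n), F.Finite ∧
      ∀ n (x : K.simplex n), ∃ (g : G) (y : K.simplex n), ⟨n, y⟩ ∈ F ∧ ρ.act n g y = x

end GenSimplicialComplex

/-- A systolic group: one that acts geometrically on a systolic complex. -/
def IsSystolicGroup (G : Type u) [Group G] : Prop :=
  ∃ K : GenSimplicialComplex.{u}, K.IsSystolic ∧ ∃ ρ : K.Action G, ρ.IsGeometric

/-! ### Square complexes -/

/-- A generalised square complex, given by its vertices, edges and squares, each edge being
identified with `[0,1]` and each square with `[0,1]²`.  The two coordinates of the square, and its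
two directions, are indexed by `Bool`; so are the two values `0` (`false`) and `1` (`true`).

* `ends e b` is the vertex to which the endpoint `b` of `e` is attached.
* `side s i t` is the edge attached to the side of `s` that is parallel to the `i`-th axis and on
  which the other coordinate is `t`; the attaching map is `x ↦ x` if `reversed s i t = false`, and
  `x ↦ 1 - x` if it is `true`.
* `corner_eq` says that both attaching maps at a corner `c` of `s` give the same vertex.

Cells need not be embedded. -/
structure SquareComplex where
  V : Type u
  E : Type u
  S : Type u
  ends : E → Bool → V
  side : S → Bool → Bool → E
  reversed : S → Bool → Bool → Bool
  corner_eq : ∀ (s : S) (c : Bool → Bool),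
    ends (side s false (c true)) (c false ^^ reversed s false (c true)) =
      ends (side s true (c false)) (c true ^^ reversed s true (c false))

namespace SquareComplex

variable (X : SquareComplex.{u})

/-- `(e, b)` is the oriented edge that starts at the endpoint `b` of `e`. -/
abbrev OrientedEdge : Type u := X.E × Bool

/-- The vertex at which an oriented edge starts. -/
def origin (d : X.OrientedEdge) : X.V := X.ends d.1 d.2

/-- The same edge with the opposite orientation. -/
def rev (d : X.OrientedEdge) : X.OrientedEdge := (d.1, !d.2)

/-- The corners of squares; `(s, c)` is the corner of `s` with coordinates `c`. -/
abbrev Corner : Type u := X.S × (Bool → Bool)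

/-- The side of the square that leaves the corner `q` in the direction `i`, as an oriented edge. -/
def cornerEdge (q : X.Corner) (i : Bool) : X.OrientedEdge :=
  (X.side q.1 i (q.2 (!i)), q.2 i ^^ X.reversed q.1 i (q.2 (!i)))

/-- The next corner of the same square in the direction `i`. -/
def nextCorner (q : X.Corner) (i : Bool) : X.Corner := (q.1, Function.update q.2 i (!q.2 i))

/-- The link of a vertex `v` is the graph whose vertices are the oriented edges that start at `v`
and whose edges are the corners of squares at `v`; the corner `q` connects the two sides of the
square that leave it.  `Joins q d d'`: the edge `q` of a link connects `d` and `d'`. -/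
def Joins (q : X.Corner) (d d' : X.OrientedEdge) : Prop :=
  (X.cornerEdge q false = d ∧ X.cornerEdge q true = d') ∨
    (X.cornerEdge q false = d' ∧ X.cornerEdge q true = d)

/-- The link of `v` contains an embedded combinatorial cycle of length `k`, that is, a cyclic
sequence of `k` distinct vertices and `k` distinct edges of the link (a loop if `k = 1`, a double
edge if `k = 2`). -/
def LinkHasCycle (v : X.V) (k : ℕ) : Prop :=
  ∃ (d : ZMod k → X.OrientedEdge) (q : ZMod k → X.Corner),
    (∀ i, X.origin (d i) = v) ∧ Function.Injective d ∧ Function.Injective q ∧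
      ∀ i, X.Joins (q i) (d i) (d (i + 1))

/-- No vertex link contains an embedded cycle of length less than `4`. -/
def IsNonpositivelyCurved : Prop :=
  ∀ (v : X.V) (k : ℕ), 1 ≤ k → k < 4 → ¬ X.LinkHasCycle v k

/-- The disjoint union of the cells: points, unit intervals and unit squares. -/
abbrev Cells : Type u := (Σ _ : X.V, Unit) ⊕ (Σ _ : X.E, I) ⊕ (Σ _ : X.S, (Bool → I))

/-- The point of an edge. -/
def edgePt (e : X.E) (x : I) : X.Cells := Sum.inr (Sum.inl ⟨e, x⟩)

/-- The point of a square. -/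
def squarePt (s : X.S) (x : Bool → I) : X.Cells := Sum.inr (Sum.inr ⟨s, x⟩)

/-- The endpoint `0` or `1` of the unit interval. -/
def endPt (b : Bool) : I := if b then 1 else 0

/-- The attaching maps of the endpoints of edges and of the sides of squares. -/
inductive Glue : X.Cells → X.Cells → Prop
  | ends (e : X.E) (b : Bool) :
      Glue (X.edgePt e (endPt b)) (Sum.inl ⟨X.ends e b, ()⟩)
  | side (s : X.S) (i t : Bool) (x : I) :
      Glue (X.squarePt s (fun j => if j = i then x else endPt t))
        (X.edgePt (X.side s i t) (if X.reversed s i t then unitInterval.symm x else x))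

/-- The geometric realisation, with the quotient topology. -/
def Realization : Type u := Quot X.Glue

instance : TopologicalSpace X.Realization := inferInstanceAs (TopologicalSpace (Quot X.Glue))

/-- A `CAT(0)` square complex: connected, simply connected and nonpositively curved. -/
def IsCAT0 : Prop := SimplyConnectedSpace X.Realization ∧ X.IsNonpositivelyCurved

/-- An action of a group on a square complex by combinatorial automorphisms, given by its effect on
vertices, oriented edges and corners of squares (so that the way in which a cell is mapped to a
cell is part of the data).  It is compatible with the reversal and the origins of edges, and maps
the two sides of a square at a corner, with the corners at their other ends, to the two sides at
the image corner, with the corners at their other ends. -/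
structure Action (G : Type*) [Group G] where
  onVertex : G →* Equiv.Perm X.V
  onEdge : G →* Equiv.Perm X.OrientedEdge
  onCorner : G →* Equiv.Perm X.Corner
  rev_eq : ∀ g d, onEdge g (X.rev d) = X.rev (onEdge g d)
  origin_eq : ∀ g d, X.origin (onEdge g d) = onVertex g (X.origin d)
  corner_eq : ∀ g q, ∃ π : Equiv.Perm Bool, ∀ i,
    onEdge g (X.cornerEdge q i) = X.cornerEdge (onCorner g q) (π i) ∧
      onCorner g (X.nextCorner q i) = X.nextCorner (onCorner g q) (π i)

namespace Action

variable {X : SquareComplex.{u}} {G : Type*} [Group G] (ρ : X.Action G)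

/-- The induced map on (unoriented) edges. -/
def edgeMap (g : G) (e : X.E) : X.E := (ρ.onEdge g (e, false)).1

/-- The induced map on squares. -/
def squareMap (g : G) (s : X.S) : X.S := (ρ.onCorner g (s, fun _ => false)).1

/-- The action is proper (all stabilisers of cells are finite) and cocompact (there are finitely
many orbits of cells). -/
def IsGeometric : Prop :=
  ((∀ v, {g : G | ρ.onVertex g v = v}.Finite) ∧ (∀ e, {g : G | ρ.edgeMap g e = e}.Finite) ∧
    ∀ s, {g : G | ρ.squareMap g s = s}.Finite) ∧
  (∃ F : Set X.V, F.Finite ∧ ∀ v, ∃ g, ∃ w ∈ F, ρ.onVertex g w = v) ∧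
  (∃ F : Set X.E, F.Finite ∧ ∀ e, ∃ g, ∃ f ∈ F, ρ.edgeMap g f = e) ∧
  ∃ F : Set X.S, F.Finite ∧ ∀ s, ∃ g, ∃ r ∈ F, ρ.squareMap g r = s

end Action

end SquareComplex

/-! ### `VH`-complexes and their simplexification -/

/-- A square complex with a partition of its edges into vertical ones (those in `vertical`) and
horizontal ones (the others), such that any two consecutive sides of a square belong to different
classes. -/
structure VHComplex extends SquareComplex.{u} where
  vertical : Set E
  alternates : ∀ (s : S) (i t t' : Bool), side s i t ∈ vertical ↔ side s (!i) t' ∉ vertical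

namespace VHComplex

variable (X : VHComplex.{u})

/-- The action preserves the sets of vertical and of horizontal edges. -/
def PreservesVH {X : VHComplex.{u}} {G : Type*} [Group G] (ρ : X.toSquareComplex.Action G) :
    Prop :=
  ∀ g e, ρ.edgeMap g e ∈ X.vertical ↔ e ∈ X.vertical

/-- The corners of the star of `e*` in the simplexification, for a vertical edge `e`: one for each
endpoint of `e`, one for `e*` and one for each square adjacent to `e`, counted with
multiplicity. -/
inductive StarCorner (e : X.E) : Type u
  | apex (b : Bool)
  | center
  | square (s : X.S) (i t : Bool) (h : X.side s i t = e)

/-- Distinct corners of the star of `e*` span a simplex if the two endpoints of `e` are not both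
among them: the star is the suspension of the simplex spanned by `e*` and the adjacent squares. -/
def Spans {X : VHComplex.{u}} {e : X.E} {n : ℕ} (f : Fin (n + 1) ↪ X.StarCorner e) : Prop :=
  ∀ j k, f j = .apex false → f k ≠ .apex true

/-- The ordered simplices of the simplexification.

* `vert v`, `edge e`, `square s` are the vertices `v*`, `e*` (for vertical `e`) and `s*`.
* `hor e b` is a horizontal edge, starting at its end `b`.
* `tri s i t f` is the triangle spanned by `s*` and a horizontal side of `s`, with an ordering `f`
  of its corners: `none` is `s*`, and `some a` is the corner of `s` with `i`-th coordinate `a` on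
  that side.
* `star e f` are the simplices of positive dimension in the star of `e*` for vertical `e`. They
  comprise the halves of `e`, the segments that join `s*` to `e*` and to the corners of `s`, the
  triangles of the subdivided squares that have `e*` as a vertex, and all faces of the attached
  simplices spanned by `e*`, one endpoint of `e` and the squares adjacent to `e`. -/
inductive OrderedSimplex : ℕ → Type u
  | vert (v : X.V) : OrderedSimplex 0
  | edge (e : X.E) (he : e ∈ X.vertical) : OrderedSimplex 0
  | square (s : X.S) : OrderedSimplex 0
  | hor (e : X.E) (he : e ∉ X.vertical) (b : Bool) : OrderedSimplex 1
  | tri (s : X.S) (i t : Bool) (h : X.side s i t ∉ X.vertical) (f : Fin 3 ↪ Option Bool) :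
      OrderedSimplex 2
  | star {n : ℕ} (e : X.E) (he : e ∈ X.vertical) (f : Fin (n + 2) ↪ X.StarCorner e)
      (hf : Spans f) : OrderedSimplex (n + 1)

variable {X}

/-- The vertex of the simplexification at a corner of the star of `e*`. -/
def starVertex {e : X.E} (he : e ∈ X.vertical) : X.StarCorner e → X.OrderedSimplex 0
  | .apex b => .vert (X.ends e b)
  | .center => .edge e he
  | .square s _ _ _ => .square s

/-- The ordered simplex spanned by some corners of the star of `e*`. -/
def ofStar {e : X.E} (he : e ∈ X.vertical) : ∀ {m : ℕ} (f : Fin (m + 1) ↪ X.StarCorner e),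
    Spans f → X.OrderedSimplex m
  | 0, f, _ => starVertex he (f 0)
  | _ + 1, f, hf => .star e he f hf

/-- The ordered simplex spanned by some ends of a horizontal edge. -/
def ofHor (e : X.E) (he : e ∉ X.vertical) : ∀ {m : ℕ}, (Fin (m + 1) ↪ Bool) → X.OrderedSimplex m
  | 0, f => .vert (X.ends e (f 0))
  | 1, f => .hor e he (f 0)
  | m + 2, f => absurd (Fintype.card_le_of_embedding f) (by simp)

/-- The ordered pair of two distinct elements. -/
def pairEmb {α : Type*} (x y : α) (h : x ≠ y) : Fin (1 + 1) ↪ α :=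
  ⟨fun j => if j = 0 then x else y, by
    intro a b
    fin_cases a <;> fin_cases b <;> simp [h, h.symm]⟩

theorem pairEmb_zero {α : Type*} (x y : α) (h : x ≠ y) : pairEmb x y h 0 = x := rfl

theorem pairEmb_one {α : Type*} (x y : α) (h : x ≠ y) : pairEmb x y h 1 = y := rfl

/-- The segment that joins `s*` to a corner of `s`, starting at `s*` if `b = true` and at the
corner if `b = false`.  The corner is the one with `i`-th coordinate `a` on the horizontal side
`side s i t`; so it lies on the vertical side `side s (!i) a`. -/
def cornerSegment (s : X.S) (i t : Bool) (h : X.side s i t ∉ X.vertical) (a b : Bool) :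
    X.OrderedSimplex 1 :=
  have he : X.side s (!i) a ∈ X.vertical := by
    by_contra h'
    exact h ((X.alternates s i t a).2 h')
  if b then
    .star (X.side s (!i) a) he
      (pairEmb (.square s (!i) a rfl) (.apex (t ^^ X.reversed s (!i) a)) (by simp))
      (by simp [Spans, Fin.forall_fin_two, pairEmb_zero, pairEmb_one])
  else
    .star (X.side s (!i) a) he
      (pairEmb (.apex (t ^^ X.reversed s (!i) a)) (.square s (!i) a rfl) (by simp))
      (by simp +contextual [Spans, Fin.forall_fin_two, pairEmb_zero, pairEmb_one])

/-- The vertices of the triangle with corner `s*` and opposite side `side s i t`. -/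
def triVertex (s : X.S) (i t : Bool) : Option Bool → X.OrderedSimplex 0
  | none => .square s
  | some a => .vert (X.ends (X.side s i t) (a ^^ X.reversed s i t))

/-- The edges of the triangle with corner `s*` and opposite side `side s i t`, from one corner to
another one (the two corners are always distinct). -/
def triEdge (s : X.S) (i t : Bool) (h : X.side s i t ∉ X.vertical) :
    Option Bool → Option Bool → X.OrderedSimplex 1
  | none, some a => cornerSegment s i t h a true
  | some a, none => cornerSegment s i t h a false
  | some a, some _ => .hor (X.side s i t) h (a ^^ X.reversed s i t)
  | none, none => .hor (X.side s i t) h false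

/-- The ordered simplex spanned by some corners of the triangle with corner `s*` and opposite side
`side s i t`. -/
def ofTri (s : X.S) (i t : Bool) (h : X.side s i t ∉ X.vertical) :
    ∀ {m : ℕ}, (Fin (m + 1) ↪ Option Bool) → X.OrderedSimplex m
  | 0, f => triVertex s i t (f 0)
  | 1, f => triEdge s i t h (f 0) (f 1)
  | 2, f => .tri s i t h f
  | m + 3, f => absurd (Fintype.card_le_of_embedding f) (by simp)

/-- The only face of a vertex is the vertex. -/
def ofPoint (x : X.OrderedSimplex 0) : ∀ {m : ℕ}, (Fin (m + 1) ↪ Fin 1) → X.OrderedSimplex m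
  | 0, _ => x
  | m + 1, f => absurd (Fintype.card_le_of_embedding f) (by simp)

theorem Spans.trans {e : X.E} {m n : ℕ} {f : Fin (n + 1) ↪ X.StarCorner e} (hf : Spans f)
    (θ : Fin (m + 1) ↪ Fin (n + 1)) : Spans (θ.trans f) :=
  fun j k => hf (θ j) (θ k)

/-- The face of an ordered simplex of the simplexification with corners `θ 0, …, θ m`. -/
def simplexFace : ∀ {m n : ℕ}, (Fin (m + 1) ↪ Fin (n + 1)) → X.OrderedSimplex n →
    X.OrderedSimplex m
  | _, _, θ, .vert v => ofPoint (.vert v) θ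
  | _, _, θ, .edge e he => ofPoint (.edge e he) θ
  | _, _, θ, .square s => ofPoint (.square s) θ
  | _, _, θ, .hor e he b => ofHor e he (θ.trans (pairEmb b (!b) (by simp)))
  | _, _, θ, .tri s i t h f => ofTri s i t h (θ.trans f)
  | _, _, θ, .star _ he f hf => ofStar he (θ.trans f) (hf.trans θ)

theorem emb_fin_one {m : ℕ} (θ : Fin (m + 1) ↪ Fin (0 + 1)) : m = 0 := by
  have := Fintype.card_le_of_embedding θ
  simp at this
  exact this

theorem emb_one (θ : Fin (0 + 1) ↪ Fin (0 + 1)) : θ = Function.Embedding.refl _ := by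
  ext1 a
  exact Subsingleton.elim (α := Fin 1) _ _

theorem simplexFace_id {n : ℕ} (x : X.OrderedSimplex n) :
    simplexFace (Function.Embedding.refl _) x = x := by
  cases x <;> rfl

theorem simplexFace_zero {m : ℕ} (θ : Fin (m + 1) ↪ Fin (0 + 1)) (x : X.OrderedSimplex 0) :
    simplexFace θ x = ofPoint x θ := by
  cases x <;> rfl

theorem simplexFace_ofPoint {l m : ℕ} (η : Fin (l + 1) ↪ Fin (m + 1))
    (θ : Fin (m + 1) ↪ Fin 1) (x : X.OrderedSimplex 0) :
    simplexFace η (ofPoint x θ) = ofPoint x (η.trans θ) := by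
  obtain rfl := emb_fin_one θ
  obtain rfl := emb_fin_one η
  exact simplexFace_zero _ _

theorem simplexFace_ofStar {e : X.E} (he : e ∈ X.vertical) {l m : ℕ}
    (η : Fin (l + 1) ↪ Fin (m + 1)) (f : Fin (m + 1) ↪ X.StarCorner e) (hf : Spans f) :
    simplexFace η (ofStar he f hf) = ofStar he (η.trans f) (hf.trans η) := by
  cases m with
  | succ m => rfl
  | zero =>
    obtain rfl := emb_fin_one η
    obtain rfl := emb_one η
    exact simplexFace_zero _ _

theorem simplexFace_ofHor (e : X.E) (he : e ∉ X.vertical) {l m : ℕ}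
    (η : Fin (l + 1) ↪ Fin (m + 1)) (f : Fin (m + 1) ↪ Bool) :
    simplexFace η (ofHor e he f) = ofHor e he (η.trans f) := by
  match m, f with
  | 0, f =>
    obtain rfl := emb_fin_one η
    obtain rfl := emb_one η
    exact simplexFace_zero _ _
  | 1, f =>
    have h : f 0 ≠ f 1 := fun h => by simpa using f.injective h
    have h' : f 1 = !f 0 := by
      cases h0 : f 0 <;> cases h1 : f 1 <;> simp_all
    have h2 : pairEmb (f 0) (!f 0) (by simp) = f := by
      ext1 a
      fin_cases a
      · rfl
      · exact h'.symm
    change ofHor e he (η.trans (pairEmb (f 0) (!f 0) _)) = _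
    rw [h2]
  | m + 2, f => exact absurd (Fintype.card_le_of_embedding f) (by simp)

theorem emb_fin_two (η : Fin (1 + 1) ↪ Fin (1 + 1)) :
    (η 0 = 0 ∧ η 1 = 1) ∨ (η 0 = 1 ∧ η 1 = 0) := by
  have h : η 0 ≠ η 1 := fun h => by simpa using η.injective h
  revert h
  generalize η 0 = a
  generalize η 1 = b
  revert a b
  decide

/-- The two descriptions of the vertex at a corner of a square agree. -/
theorem corner_vertex (s : X.S) (i t a : Bool) :
    X.ends (X.side s (!i) a) (t ^^ X.reversed s (!i) a) =
      X.ends (X.side s i t) (a ^^ X.reversed s i t) := by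
  cases i
  · exact (X.corner_eq s (fun j => if j then t else a)).symm
  · exact X.corner_eq s (fun j => if j then a else t)

theorem triEdge_vertex (s : X.S) (i t : Bool) (h : X.side s i t ∉ X.vertical) (x y : Option Bool)
    (hxy : x ≠ y) (η : Fin (0 + 1) ↪ Fin (1 + 1)) :
    simplexFace η (triEdge s i t h x y) = triVertex s i t (if η 0 = 0 then x else y) := by
  have hη : η 0 = 0 ∨ η 0 = 1 := by
    generalize η 0 = a
    revert a
    decide
  rcases x with _ | a <;> rcases y with _ | b
  · exact absurd rfl hxy
  · rcases hη with h0 | h0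
    · simp [triEdge, cornerSegment, simplexFace, ofStar, h0, pairEmb_zero, starVertex, triVertex]
    · simp [triEdge, cornerSegment, simplexFace, ofStar, h0, pairEmb_one, starVertex, triVertex,
        corner_vertex]
  · rcases hη with h0 | h0
    · simp [triEdge, cornerSegment, simplexFace, ofStar, h0, pairEmb_zero, starVertex, triVertex,
        corner_vertex]
    · simp [triEdge, cornerSegment, simplexFace, ofStar, h0, pairEmb_one, starVertex, triVertex]
  · have hb : b = !a := by
      cases a <;> cases b <;> simp_all
    rcases hη with h0 | h0
    · simp [triEdge, simplexFace, ofHor, h0, pairEmb_zero, triVertex]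
    · simp [triEdge, simplexFace, ofHor, h0, pairEmb_one, triVertex, hb]

theorem triEdge_swap (s : X.S) (i t : Bool) (h : X.side s i t ∉ X.vertical) (x y : Option Bool)
    (hxy : x ≠ y) (η : Fin (1 + 1) ↪ Fin (1 + 1)) (h0 : η 0 = 1) (h1 : η 1 = 0) :
    simplexFace η (triEdge s i t h x y) = triEdge s i t h y x := by
  have hη : ∀ {α : Type u} (p q : α) (hpq : p ≠ q), η.trans (pairEmb p q hpq) =
      pairEmb q p hpq.symm := by
    intro α p q hpq
    ext1 a
    fin_cases a
    · exact congrArg (pairEmb p q hpq) h0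
    · exact congrArg (pairEmb p q hpq) h1
  rcases x with _ | a <;> rcases y with _ | b
  · exact absurd rfl hxy
  · simp [triEdge, cornerSegment, simplexFace, ofStar, hη]
  · simp [triEdge, cornerSegment, simplexFace, ofStar, hη]
  · have hb : b = !a := by
      cases a <;> cases b <;> simp_all
    simp [triEdge, simplexFace, ofHor, h0, pairEmb_one, hb]

theorem simplexFace_ofTri (s : X.S) (i t : Bool) (h : X.side s i t ∉ X.vertical) {l m : ℕ}
    (η : Fin (l + 1) ↪ Fin (m + 1)) (f : Fin (m + 1) ↪ Option Bool) :
    simplexFace η (ofTri s i t h f) = ofTri s i t h (η.trans f) := by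
  match m, f with
  | 0, f =>
    obtain rfl := emb_fin_one η
    obtain rfl := emb_one η
    exact simplexFace_zero _ _
  | 1, f =>
    have hf : f 0 ≠ f 1 := fun h => by simpa using f.injective h
    match l, η with
    | 0, η =>
      refine (triEdge_vertex s i t h _ _ hf η).trans ?_
      have hη : η 0 = 0 ∨ η 0 = 1 := by
        generalize η 0 = a
        revert a
        decide
      change _ = triVertex s i t (f (η 0))
      rcases hη with h0 | h0 <;> simp [h0]
    | 1, η =>
      change _ = triEdge s i t h (f (η 0)) (f (η 1))
      rcases emb_fin_two η with ⟨h0, h1⟩ | ⟨h0, h1⟩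
      · have hr : η = Function.Embedding.refl _ := by
          ext1 a
          fin_cases a
          · exact h0
          · exact h1
        rw [h0, h1, hr]
        exact simplexFace_id _
      · rw [h0, h1]
        exact triEdge_swap s i t h _ _ hf η h0 h1
    | l + 2, η => exact absurd (Fintype.card_le_of_embedding η) (by simp)
  | 2, f => rfl
  | m + 3, f => exact absurd (Fintype.card_le_of_embedding f) (by simp)

theorem simplexFace_comp {l m n : ℕ} (η : Fin (l + 1) ↪ Fin (m + 1))
    (θ : Fin (m + 1) ↪ Fin (n + 1)) (x : X.OrderedSimplex n) :
    simplexFace η (simplexFace θ x) = simplexFace (η.trans θ) x := by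
  cases x with
  | vert v => exact simplexFace_ofPoint _ _ _
  | edge e he => exact simplexFace_ofPoint _ _ _
  | square s => exact simplexFace_ofPoint _ _ _
  | hor e he b => exact simplexFace_ofHor _ _ _ _
  | tri s i t h f => exact simplexFace_ofTri _ _ _ _ _ _
  | star e he f hf => exact simplexFace_ofStar _ _ _ _

theorem simplexFace_free {n : ℕ} (θ : Fin (n + 1) ↪ Fin (n + 1)) (x : X.OrderedSimplex n)
    (hx : simplexFace θ x = x) : θ = Function.Embedding.refl _ := by
  cases x with
  | vert v => exact emb_one θ
  | edge e he => exact emb_one θ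
  | square s => exact emb_one θ
  | hor e he b =>
    have h : pairEmb b (!b) (by simp) (θ 0) = b := by
      injection hx
    rcases emb_fin_two θ with ⟨h0, h1⟩ | ⟨h0, h1⟩
    · ext1 a
      fin_cases a
      · exact h0
      · exact h1
    · rw [h0] at h
      rw [pairEmb_one] at h
      simp at h
  | tri s i t h f =>
    have h : θ.trans f = f := by injection hx
    ext1 a
    exact f.injective (DFunLike.congr_fun h a)
  | star e he f hf =>
    have h : θ.trans f = f := by injection hx
    ext1 a
    exact f.injective (DFunLike.congr_fun h a)

/-- The simplexification of a `VH`-complex. -/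
def simplexification (X : VHComplex.{u}) : GenSimplicialComplex.{u} where
  simplex := X.OrderedSimplex
  face := simplexFace
  face_id := simplexFace_id
  face_comp := simplexFace_comp
  face_free := simplexFace_free

end VHComplex

/-! Systolicity has a global half, simple connectedness, and a local half, the shape of the links.
The two are independent of each other, and the group action is transported by functoriality.

Global half. `subdivide` maps X to X* by the given triangulation. In the other direction each star
of e* is collapsed onto the triangles in it that come from squares: at most one square can carry
more than half of the total weight of the squares at e. Its excess over the other squares is kept,
the remaining weight of the squares goes to e*, and the weights of the endpoints stay as they are.
Straight segments in the stars give a homotopy from the identity of X* to this retraction followed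
by `subdivide`; it is stationary on horizontal edges and on the triangles over them. So X* is
dominated by X up to homotopy, and `SimplyConnectedSpace.of_homotopy_comp` applies. Points are
handled through barycentric coordinates (`Weight`), which a `Chart` sends to the realisation, and
`ChartMaps` glues continuous maps out of X*. As the realisation carries the quotient topology,
continuity is always proved with supports confined to a finite set.

Local half. The vertices of a link are the edges that leave a vertex of X*. Those that lie in one
star and leave the same corner of it form a cluster: a simplex if the corner is an endpoint of e,
and otherwise the suspension of a simplex, whose poles are the edges to the two endpoints of e.
Outside the clusters there are only horizontal edges. The triangles over horizontal edges add few
adjacencies: at s* two edges between the poles of two clusters, and at v* an edge from a horizontal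
edge into a cluster for each corner of a square. A vertex of a cluster has at most one such further
edge, and a horizontal edge has at most one into each cluster, as otherwise the link of v in X would
contain a bigon. Hence no cycle of length 3, 4 or 5 uses a further edge, and within a suspension of
a simplex every cycle of length 4 or 5 has a diagonal. The argument is carried out for an abstract
`ClusterGraph`; `clusterGraph` verifies its axioms, and `isFlag_link` and
`isLocallySixLarge_simplexification` draw the conclusions.

Action. Every simplex of X* is carried by a cell of X, so its stabiliser lies in the stabiliser of
that cell. A geometric action leaves only finitely many squares at each vertical edge, so each cell
carries finitely many simplices and cocompactness is inherited. -/

/-! ### Homotopy domination -/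

/-- A space that is dominated up to homotopy by a simply connected space is simply connected. -/
theorem SimplyConnectedSpace.of_homotopy_comp {A B : Type*} [TopologicalSpace A]
    [TopologicalSpace B] [SimplyConnectedSpace A] (i : C(A, B)) (r : C(B, A))
    (H : (ContinuousMap.id B).Homotopy (i.comp r)) : SimplyConnectedSpace B := by
  rw [simply_connected_iff_paths_homotopic']
  -- Up to homotopy, the tracks `T` of the homotopy conjugate a path into its image under `i ∘ r`.
  -- That image is unique up to homotopy because it factors through `A`, and the track at the
  -- endpoint can be cancelled.
  obtain ⟨T, hT⟩ : ∃ T : ∀ x : B, Path x (i (r x)), ∀ (x y : B) (p : Path x y),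
      (p.trans (T y)).Homotopic ((T x).trans ((p.map r.continuous).map i.continuous)) :=
    ⟨fun x => H.evalAt x, fun x y p => Path.Homotopic.map_trans_evalAt H p⟩
  constructor
  · have hA : PathConnectedSpace A := inferInstance
    obtain ⟨a⟩ := hA.nonempty
    refine ⟨⟨i a⟩, fun x y => ?_⟩
    exact Joined.trans ⟨T x⟩ (Joined.trans ((hA.joined (r x) (r y)).map i.continuous) ⟨(T y).symm⟩)
  · intro x y p q
    have h : ((p.map r.continuous).map i.continuous).Homotopic
        ((q.map r.continuous).map i.continuous) :=
      (SimplyConnectedSpace.paths_homotopic (p.map r.continuous) (q.map r.continuous)).map i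
    have hpq : (p.trans (T y)).Homotopic (q.trans (T y)) :=
      (hT x y p).trans (((Path.Homotopic.refl _).hcomp h).trans (hT x y q).symm)
    rw [← Path.Homotopic.Quotient.eq] at hpq ⊢
    rw [Path.Homotopic.Quotient.mk_trans, Path.Homotopic.Quotient.mk_trans] at hpq
    have := congrArg (fun z => z.trans (Path.Homotopic.Quotient.mk (T y)).symm) hpq
    simpa using this

/-! ### Weights and charts -/

/-- Finitely supported barycentric coordinates on a set, such that any two elements of the support
are related by `c`. -/
structure Weight {α : Type*} (c : α → α → Prop) where
  val : α → ℝ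
  nonneg : ∀ a, 0 ≤ val a
  exists_finset : ∃ s : Finset α, (∀ a ∉ s, val a = 0) ∧ ∑ a ∈ s, val a = 1
  compat : ∀ a b, val a ≠ 0 → val b ≠ 0 → c a b

namespace Weight

variable {α : Type*} {c : α → α → Prop}

@[ext] theorem ext {v w : Weight c} (h : ∀ a, v.val a = w.val a) : v = w := by
  cases v; cases w
  congr
  exact funext h

theorem finite_support (w : Weight c) : {a | w.val a ≠ 0}.Finite := by
  obtain ⟨s, hs, -⟩ := w.exists_finset
  refine s.finite_toSet.subset fun a ha => ?_
  by_contra h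
  exact ha (hs a h)

theorem sum_eq (w : Weight c) (s : Finset α) (hs : ∀ a ∉ s, w.val a = 0) :
    ∑ a ∈ s, w.val a = 1 := by
  classical
  obtain ⟨s', hs', h⟩ := w.exists_finset
  rw [← h]
  have h1 : ∑ a ∈ s, w.val a = ∑ a ∈ s ∪ s', w.val a :=
    Finset.sum_subset Finset.subset_union_left fun a _ ha => hs a ha
  have h2 : ∑ a ∈ s', w.val a = ∑ a ∈ s ∪ s', w.val a :=
    Finset.sum_subset Finset.subset_union_right fun a _ ha => hs' a ha
  rw [h1, h2]

theorem le_one (w : Weight c) (a : α) : w.val a ≤ 1 := by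
  obtain ⟨s, hs, h⟩ := w.exists_finset
  by_cases ha : a ∈ s
  · rw [← h]
    exact Finset.single_le_sum (fun b _ => w.nonneg b) ha
  · rw [hs a ha]; norm_num

theorem exists_ne_zero (w : Weight c) : ∃ a, w.val a ≠ 0 := by
  by_contra! h
  obtain ⟨s, hs, h1⟩ := w.exists_finset
  simp [h] at h1

/-- The barycentric coordinates of a point of a simplex whose corners are labelled by `f`. -/
noncomputable def push {m : ℕ} (f : Fin (m + 1) ↪ α) (hf : ∀ j k, c (f j) (f k))
    (t : stdSimplex ℝ (Fin (m + 1))) : Weight c where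
  val a := by
    classical exact ∑ j, if f j = a then t j else 0
  nonneg a := by
    classical
    exact Finset.sum_nonneg fun j _ => by split_ifs; exacts [t.2.1 j, le_rfl]
  exists_finset := by
    classical
    refine ⟨Finset.univ.map f, fun a ha => Finset.sum_eq_zero fun j _ => ?_, ?_⟩
    · rw [if_neg]
      rintro rfl
      exact ha (by simp)
    · rw [Finset.sum_map, ← t.2.2]
      exact Finset.sum_congr rfl fun k _ => by simp; rfl
  compat a b ha hb := by
    classical
    obtain ⟨j, -, hj⟩ := Finset.exists_ne_zero_of_sum_ne_zero ha
    obtain ⟨k, -, hk⟩ := Finset.exists_ne_zero_of_sum_ne_zero hb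
    have hj' : f j = a := by by_contra h; simp [h] at hj
    have hk' : f k = b := by by_contra h; simp [h] at hk
    rw [← hj', ← hk']
    exact hf j k

theorem push_apply {m : ℕ} (f : Fin (m + 1) ↪ α) (hf : ∀ j k, c (f j) (f k))
    (t : stdSimplex ℝ (Fin (m + 1))) (j : Fin (m + 1)) : (push f hf t).val (f j) = t j := by
  classical
  simp [push]

theorem push_of_notMem {m : ℕ} (f : Fin (m + 1) ↪ α) (hf : ∀ j k, c (f j) (f k))
    (t : stdSimplex ℝ (Fin (m + 1))) {a : α} (ha : ∀ j, f j ≠ a) : (push f hf t).val a = 0 := by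
  classical
  simp [push, ha]

/-- Corners that the face omits have coordinate zero on both sides. This lets a map given in
barycentric coordinates descend through the gluing of faces. -/
theorem push_map {m n : ℕ} (θ : Fin (m + 1) ↪ Fin (n + 1)) (f : Fin (n + 1) ↪ α)
    (hf : ∀ j k, c (f j) (f k)) (hf' : ∀ j k, c (θ.trans f j) (θ.trans f k))
    (t : stdSimplex ℝ (Fin (m + 1))) :
    push f hf (stdSimplex.map θ t) = push (θ.trans f) hf' t := by
  classical
  ext a
  by_cases ha : ∃ j, f j = a
  · obtain ⟨j, rfl⟩ := ha
    rw [push_apply]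
    simp [push, stdSimplex.map_coe, FunOnFinite.linearMap_apply_apply, Finset.sum_filter]
  · push Not at ha
    exact (push_of_notMem _ _ _ ha).trans (push_of_notMem _ _ _ fun j => ha (θ j)).symm

theorem continuous_push {m : ℕ} (f : Fin (m + 1) ↪ α) (hf : ∀ j k, c (f j) (f k)) (a : α) :
    Continuous fun t : stdSimplex ℝ (Fin (m + 1)) => (push f hf t).val a := by
  classical
  change Continuous fun t : stdSimplex ℝ (Fin (m + 1)) => ∑ j, if f j = a then t j else 0
  refine continuous_finsetSum _ fun j _ => ?_
  split_ifs
  · exact (continuous_apply j).comp continuous_subtype_val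
  · exact continuous_const

/-- The coordinates of a weight on the corners of a simplex that contains its support. -/
noncomputable def pull (w : Weight c) {m : ℕ} (f : Fin (m + 1) ↪ α)
    (h : ∀ a, w.val a ≠ 0 → ∃ j, f j = a) : stdSimplex ℝ (Fin (m + 1)) :=
  ⟨fun j => w.val (f j), fun j => w.nonneg _, by
    have := w.sum_eq (Finset.univ.map f) fun a ha => by
      by_contra hne
      obtain ⟨j, rfl⟩ := h a hne
      exact ha (by simp)
    rwa [Finset.sum_map] at this⟩

theorem push_pull (w : Weight c) {m : ℕ} (f : Fin (m + 1) ↪ α) (hf : ∀ j k, c (f j) (f k))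
    (h : ∀ a, w.val a ≠ 0 → ∃ j, f j = a) : push f hf (w.pull f h) = w := by
  ext a
  by_cases ha : ∃ j, f j = a
  · obtain ⟨j, rfl⟩ := ha
    rw [push_apply]
    rfl
  · push Not at ha
    rw [push_of_notMem _ _ _ ha]
    by_contra hne
    obtain ⟨j, hj⟩ := h a (Ne.symm hne)
    exact ha j hj

theorem pull_push {m : ℕ} (f : Fin (m + 1) ↪ α) (hf : ∀ j k, c (f j) (f k))
    (t : stdSimplex ℝ (Fin (m + 1))) (h) : (push f hf t).pull f h = t := by
  apply Subtype.ext
  funext j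
  exact push_apply f hf t j

/-- Every weight is supported on the corners of a simplex. -/
theorem exists_emb (w : Weight c) : ∃ (m : ℕ) (f : Fin (m + 1) ↪ α),
    (∀ j k, c (f j) (f k)) ∧ ∀ a, w.val a ≠ 0 ↔ ∃ j, f j = a := by
  classical
  have hne : w.finite_support.toFinset.card ≠ 0 := by
    obtain ⟨a, ha⟩ := w.exists_ne_zero
    exact Finset.card_ne_zero.2 ⟨a, by simpa using ha⟩
  obtain ⟨m, hm⟩ := Nat.exists_eq_succ_of_ne_zero hne
  let e := (w.finite_support.toFinset.equivFinOfCardEq hm).symm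
  have he : ∀ j, w.val (e j) ≠ 0 := fun j => w.finite_support.mem_toFinset.1 (e j).2
  refine ⟨m, e.toEmbedding.trans (Function.Embedding.subtype _), fun j k => ?_, fun a => ⟨?_, ?_⟩⟩
  · exact w.compat _ _ (he j) (he k)
  · intro ha
    exact ⟨e.symm ⟨a, by simpa using ha⟩, by simp⟩
  · rintro ⟨j, rfl⟩
    exact he j

end Weight

/-- Compatible simplices of a complex, spanned by the finite subsets of a set that consist of
pairwise related elements. -/
structure Chart (K : GenSimplicialComplex.{u}) (α : Type*) (c : α → α → Prop) where
  simplex : ∀ {m : ℕ} (f : Fin (m + 1) ↪ α), (∀ j k, c (f j) (f k)) → K.simplex m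
  face : ∀ {m n : ℕ} (θ : Fin (m + 1) ↪ Fin (n + 1)) (f : Fin (n + 1) ↪ α) (hf)
    (hf' : ∀ j k, c (θ.trans f j) (θ.trans f k)),
    K.face θ (simplex f hf) = simplex (θ.trans f) hf'

namespace GenSimplicialComplex

variable {K : GenSimplicialComplex.{u}}

/-- A point of a simplex, in the realisation. -/
def point {n : ℕ} (x : K.simplex n) (t : stdSimplex ℝ (Fin (n + 1))) : K.Realization :=
  Quot.mk _ ⟨⟨n, x⟩, t⟩

theorem point_face {m n : ℕ} (θ : Fin (m + 1) ↪ Fin (n + 1)) (x : K.simplex n)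
    (t : stdSimplex ℝ (Fin (m + 1))) : point (K.face θ x) t = point x (stdSimplex.map θ t) :=
  Quot.sound (.face θ x t)

theorem continuous_point {n : ℕ} (x : K.simplex n) : Continuous (point x) :=
  continuous_quot_mk.comp continuous_sigmaMk

end GenSimplicialComplex

namespace Chart

open GenSimplicialComplex

variable {K : GenSimplicialComplex.{u}} {α : Type*} {c : α → α → Prop} (C : Chart K α c)

/-- The point of the realisation with given barycentric coordinates. -/
noncomputable def pt (w : Weight c) : K.Realization :=
  point (C.simplex w.exists_emb.choose_spec.choose w.exists_emb.choose_spec.choose_spec.1)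
    (w.pull _ fun a => (w.exists_emb.choose_spec.choose_spec.2 a).1)

/-- The support is contained in the labels of `f`, so `g` is `f` restricted along an injection `Θ`.
The simplex of `g` is then a face of the simplex of `f`, and the gluing identifies the two points.
Hence the choice of an ordering in `pt` is harmless. -/
theorem point_eq_of_support {m n : ℕ} (g : Fin (m + 1) ↪ α) (hg) (f : Fin (n + 1) ↪ α) (hf)
    (w : Weight c) (h : ∀ a, w.val a ≠ 0 ↔ ∃ j, g j = a) (h' : ∀ a, w.val a ≠ 0 → ∃ j, f j = a) :
    point (C.simplex g hg) (w.pull g fun a => (h a).1) = point (C.simplex f hf) (w.pull f h') := by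
  choose θ hθ using fun j => h' (g j) ((h _).2 ⟨j, rfl⟩)
  obtain ⟨Θ, rfl⟩ : ∃ Θ : Fin (m + 1) ↪ Fin (n + 1), g = Θ.trans f :=
    ⟨⟨θ, fun j k hjk => g.injective (by rw [← hθ, hjk, hθ])⟩, by ext1 j; exact (hθ j).symm⟩
  rw [← C.face Θ f hf hg, point_face]
  congr 1
  rw [← Weight.pull_push f hf (stdSimplex.map Θ _) (fun a ha => by
    by_contra hne
    exact ha (Weight.push_of_notMem f hf _ (by simpa using hne)))]
  congr 1
  rw [Weight.push_map Θ f hf hg, Weight.push_pull]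

theorem point_pull {n : ℕ} (f : Fin (n + 1) ↪ α) (hf) (w : Weight c)
    (h : ∀ a, w.val a ≠ 0 → ∃ j, f j = a) : point (C.simplex f hf) (w.pull f h) = C.pt w :=
  (C.point_eq_of_support _ _ f hf w w.exists_emb.choose_spec.choose_spec.2 h).symm

theorem point_eq {n : ℕ} (f : Fin (n + 1) ↪ α) (hf) (t : stdSimplex ℝ (Fin (n + 1))) :
    point (C.simplex f hf) t = C.pt (Weight.push f hf t) := by
  rw [← C.point_pull f hf _ (fun a ha => by
    by_contra hne
    exact ha (Weight.push_of_notMem f hf _ (by simpa using hne))), Weight.pull_push]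

/-- A finite closed cover lemma: a map is continuous if it is continuous on finitely many closed
sets that cover. -/
theorem _root_.continuous_of_finite_closed_cover {ι P Z : Type*} [Finite ι] [TopologicalSpace P]
    [TopologicalSpace Z] {F : P → Z} (A : ι → Set P) (hA : ∀ i, IsClosed (A i))
    (hc : ∀ p, ∃ i, p ∈ A i) (hF : ∀ i, ContinuousOn F (A i)) : Continuous F :=
  (locallyFinite_of_finite A).continuous (eq_univ_of_forall fun p => mem_iUnion.2 (hc p)) hA hF

/-- The point with given barycentric coordinates depends continuously on them, as long as the
supports remain in a fixed finite set. -/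
theorem continuous_pt {P : Type*} [TopologicalSpace P] (F : P → Weight c) (s : Finset α)
    (hs : ∀ p, ∀ a ∉ s, (F p).val a = 0) (hF : ∀ a ∈ s, Continuous fun p => (F p).val a) :
    Continuous fun p => C.pt (F p) := by
  classical
  -- On the closed set of those `p` whose support lies in a compatible `s'`, one fixed ordering of
  -- `s'` represents all the points, with continuous coordinates. The constant second factor makes
  -- the piece of an incompatible `s'` empty.
  refine continuous_of_finite_closed_cover (ι := {s' : Finset α // s' ⊆ s})
    (fun s' => {p | ∀ a ∈ s, a ∉ s'.1 → (F p).val a = 0} ∩ {_p | ∀ a ∈ s'.1, ∀ b ∈ s'.1, c a b})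
    (fun s' => ?_) (fun p => ?_) (fun s' => ?_)
  · refine IsClosed.inter ?_ isClosed_const
    simp only [Set.ofPred_forall]
    exact isClosed_biInter fun a ha => isClosed_iInter fun _ => isClosed_eq (hF a ha)
      continuous_const
  · refine ⟨⟨s.filter fun a => (F p).val a ≠ 0, Finset.filter_subset _ _⟩, ?_, ?_⟩
    · intro a ha ha'
      by_contra h
      exact ha' (by simp [ha, h])
    · intro a ha b hb
      exact (F p).compat a b (Finset.mem_filter.1 ha).2 (Finset.mem_filter.1 hb).2
  · obtain ⟨s', hs'⟩ := s'
    rw [continuousOn_iff_continuous_domRestrict]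
    by_cases hne : s'.card = 0
    · refine continuous_iff_continuousAt.2 fun p => ?_
      exfalso
      obtain ⟨a, ha⟩ := (F p).exists_ne_zero
      have has : a ∈ s := by by_contra h; exact ha (hs p a h)
      refine ha (p.2.1 a has ?_)
      simp [Finset.card_eq_zero.1 hne]
    · obtain ⟨m, hm⟩ := Nat.exists_eq_succ_of_ne_zero hne
      let e := (s'.equivFinOfCardEq hm).symm
      let f : Fin (m + 1) ↪ α := e.toEmbedding.trans (Function.Embedding.subtype _)
      by_cases hcomp : ∀ a ∈ s', ∀ b ∈ s', c a b
      · have hf : ∀ j k, c (f j) (f k) := fun j k => hcomp _ (e j).2 _ (e k).2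
        have hsup : ∀ p : ↥({p | ∀ a ∈ s, a ∉ s' → (F p).val a = 0} ∩
            {_p | ∀ a ∈ s', ∀ b ∈ s', c a b}), ∀ a, (F p).val a ≠ 0 → ∃ j, f j = a := by
          intro p a ha
          have has : a ∈ s := by by_contra h; exact ha (hs p a h)
          have has' : a ∈ s' := by by_contra h; exact ha (p.2.1 a has h)
          exact ⟨e.symm ⟨a, has'⟩, by simp [f]⟩
        refine Continuous.congr ?_ fun p => C.point_pull f hf (F p) (hsup p)
        refine (continuous_point _).comp (Continuous.subtype_mk (continuous_pi fun j => ?_) _)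
        exact (hF _ (hs' (e j).2)).comp continuous_subtype_val
      · refine continuous_iff_continuousAt.2 fun p => ?_
        exact absurd p.2.2 hcomp

end Chart

namespace Weight

variable {α : Type*} {c : α → α → Prop}

/-- The weight concentrated at one element. -/
noncomputable def single (a : α) (ha : c a a) : Weight c where
  val b := by classical exact if b = a then 1 else 0
  nonneg b := by split_ifs <;> norm_num
  exists_finset := ⟨{a}, fun b hb => if_neg (by simpa using hb), by
    rw [Finset.sum_singleton, if_pos rfl]⟩
  compat b b' hb hb' := by
    have h : b = a := by by_contra h; simp [h] at hb
    have h' : b' = a := by by_contra h; simp [h] at hb'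
    rwa [h, h']

theorem single_apply_self (a : α) (ha : c a a) : (single a ha).val a = 1 := if_pos rfl

theorem single_apply_of_ne (a : α) (ha : c a a) {b : α} (h : b ≠ a) :
    (single a ha).val b = 0 := if_neg h

theorem eq_zero_of_eq_one (w : Weight c) {a b : α} (h : w.val a = 1) (hb : b ≠ a) :
    w.val b = 0 := by
  classical
  have h1 := w.sum_eq (w.finite_support.toFinset ∪ {a, b}) (by simp +contextual)
  have h2 : ∑ x ∈ ({a, b} : Finset α), w.val x ≤ 1 := by
    rw [← h1]
    exact Finset.sum_le_sum_of_subset_of_nonneg Finset.subset_union_right fun x _ _ => w.nonneg x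
  rw [Finset.sum_pair hb.symm, h] at h2
  linarith [w.nonneg b]

end Weight

theorem stdSimplex_fin_one (t : stdSimplex ℝ (Fin (0 + 1))) : t 0 = 1 := by
  simp

/-! ### Charts of the simplexification and maps out of it -/

namespace VHComplex

open GenSimplicialComplex

variable {X : VHComplex.{u}}

/-- The endpoints of a vertical edge are not both used. -/
def StarCompat {e : X.E} (x y : X.StarCorner e) : Prop := x = .apex false → y ≠ .apex true

theorem starCompat_self {e : X.E} (x : X.StarCorner e) : StarCompat x x := by
  rintro rfl; simp

/-- No restriction. -/
def AllCompat {α : Type*} (_ _ : α) : Prop := True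

/-- The simplices in the star of `e*`. -/
def starChart (e : X.E) (he : e ∈ X.vertical) :
    Chart X.simplexification (X.StarCorner e) StarCompat where
  simplex f hf := ofStar he f hf
  face θ f hf _ := simplexFace_ofStar he θ f hf

/-- The simplices in a horizontal edge. -/
def horChart (e : X.E) (he : e ∉ X.vertical) : Chart X.simplexification Bool AllCompat where
  simplex f _ := ofHor e he f
  face θ f _ _ := simplexFace_ofHor e he θ f

/-- The simplices in the triangle with a horizontal side `side s i t` and corner `s*`. -/
def triChart (s : X.S) (i t : Bool) (h : X.side s i t ∉ X.vertical) :
    Chart X.simplexification (Option Bool) AllCompat where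
  simplex f _ := ofTri s i t h f
  face θ f _ _ := simplexFace_ofTri s i t h θ f

theorem side_not_mem {s : X.S} {i t : Bool} (h : X.side s i t ∉ X.vertical) (a : Bool) :
    X.side s (!i) a ∈ X.vertical := by
  by_contra h'
  exact h ((X.alternates s i t a).2 h')

theorem pairEmb_eq {α : Type*} (f : Fin (1 + 1) ↪ α) (x y : α) (h : x ≠ y) (h0 : f 0 = x)
    (h1 : f 1 = y) : f = pairEmb x y h := by
  ext1 a
  fin_cases a
  · exact h0
  · exact h1

theorem emb_ne {α : Type*} (f : Fin (1 + 1) ↪ α) : f 0 ≠ f 1 := fun h => by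
  simpa using f.injective h

/-- Compatible maps from the charts of the simplexification to a space. -/
structure ChartMaps (X : VHComplex.{u}) (Z : Type*) [TopologicalSpace Z] where
  onVert : X.V → Z
  onEdge : ∀ e ∈ X.vertical, Z
  onSquare : X.S → Z
  onHor : ∀ e ∉ X.vertical, Weight (AllCompat (α := Bool)) → Z
  onTri : ∀ (s : X.S) (i t : Bool), X.side s i t ∉ X.vertical →
    Weight (AllCompat (α := Option Bool)) → Z
  onStar : ∀ e ∈ X.vertical, Weight (StarCompat (X := X) (e := e)) → Z
  continuous_onHor : ∀ e he {m : ℕ} (f : Fin (m + 1) ↪ Bool) (hf),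
    Continuous fun t => onHor e he (Weight.push f hf t)
  continuous_onTri : ∀ s i t h {m : ℕ} (f : Fin (m + 1) ↪ Option Bool) (hf),
    Continuous fun x => onTri s i t h (Weight.push f hf x)
  continuous_onStar : ∀ e he {m : ℕ} (f : Fin (m + 1) ↪ X.StarCorner e) (hf),
    Continuous fun t => onStar e he (Weight.push f hf t)
  onHor_eq : ∀ e he w b, w.val b = 1 → onHor e he w = onVert (X.ends e b)
  onStar_apex : ∀ e he w b, w.val (.apex b) = 1 → onStar e he w = onVert (X.ends e b)
  onStar_center : ∀ e he w, w.val .center = 1 → onStar e he w = onEdge e he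
  onStar_square : ∀ e he w s i t h, w.val (.square s i t h) = 1 → onStar e he w = onSquare s
  onTri_star : ∀ s i t h a (w : Weight _) (w' : Weight _), w.val (some (!a)) = 0 →
    w'.val (.apex (t ^^ X.reversed s (!i) a)) = w.val (some a) →
    w'.val (.square s (!i) a rfl) = w.val none →
    onTri s i t h w = onStar (X.side s (!i) a) (side_not_mem h a) w'
  onTri_hor : ∀ s i t h (w : Weight _) (w' : Weight _), w.val none = 0 →
    (∀ a, w'.val (a ^^ X.reversed s i t) = w.val (some a)) →
    onTri s i t h w = onHor (X.side s i t) h w'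

namespace ChartMaps

variable {Z : Type*} [TopologicalSpace Z] (φ : ChartMaps X Z)

/-- The corners of a triangle need no axioms of their own: the segment from `s*` to a corner lies in
the star of a vertical side, where `onTri_star` moves the question. Either vertical side serves
here. -/
theorem onTri_none (s i t h) (w : Weight _) (hw : w.val none = 1) :
    φ.onTri s i t h w = φ.onSquare s := by
  rw [φ.onTri_star s i t h false w
    (Weight.single (.square s (!i) false rfl) (starCompat_self _))
    (w.eq_zero_of_eq_one hw (by simp)), φ.onStar_square _ _ _ s (!i) false rfl]
  · exact Weight.single_apply_self _ _
  · rw [Weight.single_apply_of_ne _ _ (by simp), w.eq_zero_of_eq_one hw (by simp)]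
  · rw [Weight.single_apply_self, hw]

theorem onTri_some (s i t h) (w : Weight _) (a : Bool) (hw : w.val (some a) = 1) :
    φ.onTri s i t h w = φ.onVert (X.ends (X.side s i t) (a ^^ X.reversed s i t)) := by
  rw [φ.onTri_star s i t h a w
    (Weight.single (.apex (t ^^ X.reversed s (!i) a)) (starCompat_self _))
    (w.eq_zero_of_eq_one hw (by simp)), φ.onStar_apex, corner_vertex]
  · exact Weight.single_apply_self _ _
  · rw [Weight.single_apply_self, hw]
  · rw [Weight.single_apply_of_ne _ _ (by simp), w.eq_zero_of_eq_one hw (by simp)]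

/-- The map on a single ordered simplex. -/
noncomputable def onSimplex : ∀ {n : ℕ}, X.OrderedSimplex n → stdSimplex ℝ (Fin (n + 1)) → Z
  | _, .vert v, _ => φ.onVert v
  | _, .edge e he, _ => φ.onEdge e he
  | _, .square s, _ => φ.onSquare s
  | _, .hor e he b, t => φ.onHor e he (Weight.push (pairEmb b (!b) (by simp)) (fun _ _ => trivial) t)
  | _, .tri s i t h f, x => φ.onTri s i t h (Weight.push f (fun _ _ => trivial) x)
  | _, .star e he f hf, t => φ.onStar e he (Weight.push f hf t)

/-- Only dimension `0` is not definitional: there `ofStar` returns a named vertex of the complex,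
whose value is supplied by the axioms at the corners of the star. -/
theorem onSimplex_ofStar {e : X.E} (he : e ∈ X.vertical) {m : ℕ} (f : Fin (m + 1) ↪ X.StarCorner e)
    (hf : ∀ j k, StarCompat (f j) (f k)) (t) : φ.onSimplex (ofStar he f hf) t = φ.onStar e he (Weight.push f hf t) := by
  cases m with
  | succ m => rfl
  | zero =>
    have h1 : (Weight.push f hf t).val (f 0) = 1 :=
      (Weight.push_apply f hf t 0).trans (stdSimplex_fin_one t)
    change φ.onSimplex (starVertex he (f 0)) t = _
    cases h : f 0 with
    | apex b => exact (φ.onStar_apex e he _ b (h ▸ h1)).symm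
    | center => exact (φ.onStar_center e he _ (h ▸ h1)).symm
    | square s i t' h' => exact (φ.onStar_square e he _ s i t' h' (h ▸ h1)).symm

theorem onSimplex_ofHor (e : X.E) (he : e ∉ X.vertical) {m : ℕ} (f : Fin (m + 1) ↪ Bool) (t) :
    φ.onSimplex (ofHor e he f) t = φ.onHor e he (Weight.push f (fun _ _ => trivial) t) := by
  match m, f with
  | 0, f =>
    have h1 : (Weight.push (c := AllCompat) f (fun _ _ => trivial) t).val (f 0) = 1 :=
      (Weight.push_apply _ _ t 0).trans (stdSimplex_fin_one t)
    exact (φ.onHor_eq e he _ _ h1).symm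
  | 1, f =>
    obtain ⟨b, h0⟩ : ∃ b, f 0 = b := ⟨_, rfl⟩
    have h1 : f 1 = !b := by
      have h := emb_ne f
      rw [h0] at h
      cases b <;> cases h1 : f 1 <;> simp_all
    obtain rfl := pairEmb_eq f b (!b) (by simp) h0 h1
    rfl
  | m + 2, f => exact absurd (Fintype.card_le_of_embedding f) (by simp)

/-- The sides of the triangle are stored as simplices of other kinds, two in the stars of vertical
sides and one as a horizontal edge. The axioms `onTri_star` and `onTri_hor` make up for this. -/
theorem onSimplex_ofTri (s : X.S) (i t : Bool) (h : X.side s i t ∉ X.vertical) {m : ℕ}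
    (f : Fin (m + 1) ↪ Option Bool) (x) :
    φ.onSimplex (ofTri s i t h f) x = φ.onTri s i t h (Weight.push f (fun _ _ => trivial) x) := by
  match m, f with
  | 0, f =>
    have h1 : (Weight.push (c := AllCompat) f (fun _ _ => trivial) x).val (f 0) = 1 :=
      (Weight.push_apply _ _ x 0).trans (stdSimplex_fin_one x)
    change φ.onSimplex (triVertex s i t (f 0)) x = _
    cases h0 : f 0 with
    | none => exact (φ.onTri_none s i t h _ (h0 ▸ h1)).symm
    | some a => exact (φ.onTri_some s i t h _ a (h0 ▸ h1)).symm
  | 1, f =>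
    set w := Weight.push (c := AllCompat) f (fun _ _ => trivial) x with hw
    have hf := emb_ne f
    have h0 : w.val (f 0) = x 0 := Weight.push_apply _ _ x 0
    have h1 : w.val (f 1) = x 1 := Weight.push_apply _ _ x 1
    have h2 : ∀ y, f 0 ≠ y → f 1 ≠ y → w.val y = 0 := fun y hy0 hy1 =>
      Weight.push_of_notMem _ _ _ (by simp [Fin.forall_fin_two, hy0, hy1])
    change φ.onSimplex (triEdge s i t h (f 0) (f 1)) x = _
    cases hx : f 0 with
    | none =>
      cases hy : f 1 with
      | none => exact absurd (hx.trans hy.symm) hf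
      | some a =>
        rw [hx] at h0 h2
        rw [hy] at h1 h2
        refine (φ.onTri_star s i t h a w _ (h2 _ (by simp) (by simp)) ?_ ?_).symm
        · exact (Weight.push_apply _ _ x 1).trans h1.symm
        · exact (Weight.push_apply _ _ x 0).trans h0.symm
    | some a =>
      cases hy : f 1 with
      | none =>
        rw [hx] at h0 h2
        rw [hy] at h1 h2
        refine (φ.onTri_star s i t h a w _ (h2 _ (by simp) (by simp)) ?_ ?_).symm
        · exact (Weight.push_apply _ _ x 0).trans h0.symm
        · exact (Weight.push_apply _ _ x 1).trans h1.symm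
      | some b =>
        have hb : b = !a := by
          rw [hx, hy] at hf
          cases a <;> cases b <;> simp_all
        subst hb
        rw [hx] at h0 h2
        rw [hy] at h1 h2
        refine (φ.onTri_hor s i t h w _ (h2 _ (by simp) (by simp)) fun b => ?_).symm
        by_cases hb : b = a
        · subst hb
          exact (Weight.push_apply (pairEmb _ _ _) _ x 0).trans h0.symm
        · have hb : b = !a := by cases a <;> cases b <;> simp_all
          subst hb
          refine Eq.trans ?_ h1.symm
          rw [Bool.not_xor]
          exact Weight.push_apply (pairEmb _ _ _) _ x 1
  | 2, f => rfl
  | m + 3, f => exact absurd (Fintype.card_le_of_embedding f) (by simp)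

theorem onSimplex_face {m n : ℕ} (θ : Fin (m + 1) ↪ Fin (n + 1)) (x : X.OrderedSimplex n) (t) :
    φ.onSimplex (simplexFace θ x) t = φ.onSimplex x (stdSimplex.map θ t) := by
  cases x with
  | vert v => obtain rfl := emb_fin_one θ; rfl
  | edge e he => obtain rfl := emb_fin_one θ; rfl
  | square s => obtain rfl := emb_fin_one θ; rfl
  | hor e he b =>
    refine (φ.onSimplex_ofHor e he _ t).trans ?_
    exact congrArg (φ.onHor e he) (Weight.push_map _ _ _ _ _).symm
  | tri s i t' h f =>
    refine (φ.onSimplex_ofTri s i t' h _ t).trans ?_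
    exact congrArg (φ.onTri s i t' h) (Weight.push_map _ _ _ _ _).symm
  | star e he f hf =>
    refine (φ.onSimplex_ofStar he _ _ t).trans ?_
    exact congrArg (φ.onStar e he) (Weight.push_map _ _ _ _ _).symm

/-- The induced continuous map on the realisation of the simplexification. -/
noncomputable def toContinuousMap : C(X.simplexification.Realization, Z) where
  toFun := Quot.lift (fun p => φ.onSimplex p.1.2 p.2) (by
    rintro _ _ ⟨θ, x, t⟩
    exact φ.onSimplex_face θ x t)
  continuous_toFun := by
    refine continuous_quot_lift _ (continuous_sigma ?_)
    rintro ⟨n, x⟩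
    cases x with
    | vert v => exact continuous_const
    | edge e he => exact continuous_const
    | square s => exact continuous_const
    | hor e he b => exact φ.continuous_onHor e he _ _
    | tri s i t h f => exact φ.continuous_onTri s i t h _ _
    | star e he f hf => exact φ.continuous_onStar e he _ _

theorem map_hor (e he w) : φ.toContinuousMap ((horChart e he).pt w) = φ.onHor e he w := by
  obtain ⟨m, f, hf, h⟩ := w.exists_emb
  rw [← (horChart e he).point_pull f hf w fun a => (h a).1]
  refine (φ.onSimplex_ofHor e he f _).trans ?_
  exact congrArg (φ.onHor e he) (w.push_pull f hf fun a => (h a).1)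

theorem map_tri (s i t h w) : φ.toContinuousMap ((triChart s i t h).pt w) = φ.onTri s i t h w := by
  obtain ⟨m, f, hf, hw⟩ := w.exists_emb
  rw [← (triChart s i t h).point_pull f hf w fun a => (hw a).1]
  refine (φ.onSimplex_ofTri s i t h f _).trans ?_
  exact congrArg (φ.onTri s i t h) (w.push_pull f hf fun a => (hw a).1)

theorem map_star (e he w) : φ.toContinuousMap ((starChart e he).pt w) = φ.onStar e he w := by
  obtain ⟨m, f, hf, h⟩ := w.exists_emb
  rw [← (starChart e he).point_pull f hf w fun a => (h a).1]
  refine (φ.onSimplex_ofStar he f _ _).trans ?_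
  exact congrArg (φ.onStar e he) (w.push_pull f hf fun a => (h a).1)

end ChartMaps

/-- The point of the realisation at a vertex `v*`. -/
noncomputable def vertPoint (v : X.V) : X.simplexification.Realization :=
  point (K := X.simplexification) (.vert v) (stdSimplex.vertex 0)

theorem point_vertex_eq (x : X.simplexification.simplex 0) (t t' : stdSimplex ℝ (Fin (0 + 1))) :
    point x t = point x t' := by
  congr 1
  ext j
  obtain rfl : j = 0 := Subsingleton.elim (α := Fin 1) _ _
  exact (stdSimplex_fin_one t).trans (stdSimplex_fin_one t').symm

theorem starChart_pt_of_eq_one {e : X.E} (he : e ∈ X.vertical) (w : Weight (StarCompat (e := e)))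
    (c : X.StarCorner e) (hc : w.val c = 1) (t) :
    (starChart e he).pt w = point (K := X.simplexification) (starVertex he c) t := by
  let f : Fin (0 + 1) ↪ X.StarCorner e := ⟨fun _ => c, fun _ _ _ => Subsingleton.elim (α := Fin 1) _ _⟩
  rw [← (starChart e he).point_pull f (fun _ _ => starCompat_self c) w]
  · exact point_vertex_eq _ _ _
  · intro a ha
    refine ⟨0, ?_⟩
    by_contra h
    exact ha (w.eq_zero_of_eq_one hc (Ne.symm h))

theorem starChart_pt_apex {e : X.E} (he : e ∈ X.vertical) (w : Weight (StarCompat (e := e)))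
    (b : Bool) (hb : w.val (.apex b) = 1) : (starChart e he).pt w = vertPoint (X.ends e b) :=
  starChart_pt_of_eq_one he w _ hb _

theorem horChart_pt_eq {e : X.E} (he : e ∉ X.vertical) (w : Weight AllCompat) (b : Bool)
    (hb : w.val b = 1) : (horChart e he).pt w = vertPoint (X.ends e b) := by
  let f : Fin (0 + 1) ↪ Bool := ⟨fun _ => b, fun _ _ _ => Subsingleton.elim (α := Fin 1) _ _⟩
  rw [← (horChart e he).point_pull f (fun _ _ => trivial) w]
  · exact point_vertex_eq _ _ _
  · intro a ha
    refine ⟨0, ?_⟩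
    by_contra h
    exact ha (w.eq_zero_of_eq_one hb (Ne.symm h))

/-- The realisation itself satisfies the compatibility axioms of `ChartMaps`; here the one for the
segment from `s*` to a corner. The two prescribed coordinates of `w'` already add up to `1`, so its
support contains nothing else, and both charts evaluate the same `cornerSegment`. -/
theorem triChart_pt_star (s : X.S) (i t : Bool) (h : X.side s i t ∉ X.vertical) (a : Bool)
    (w : Weight AllCompat) (w' : Weight StarCompat) (h0 : w.val (some (!a)) = 0)
    (h1 : w'.val (.apex (t ^^ X.reversed s (!i) a)) = w.val (some a))
    (h2 : w'.val (.square s (!i) a rfl) = w.val none) :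
    (triChart s i t h).pt w = (starChart (X.side s (!i) a) (side_not_mem h a)).pt w' := by
  have hsum : w.val none + w.val (some a) = 1 := by
    rw [← w.sum_eq {none, some a}, Finset.sum_pair (by simp)]
    rintro (_ | b) hb
    · simp at hb
    · have : b = !a := by cases a <;> cases b <;> simp_all
      rw [this, h0]
  let f : Fin (1 + 1) ↪ Option Bool := pairEmb none (some a) (by simp)
  let f' : Fin (1 + 1) ↪ X.StarCorner (X.side s (!i) a) :=
    pairEmb (.square s (!i) a rfl) (.apex (t ^^ X.reversed s (!i) a)) (by simp)
  have hw : ∀ x, w.val x ≠ 0 → ∃ j, f j = x := by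
    rintro (_ | b) hb
    · exact ⟨0, rfl⟩
    · refine ⟨1, ?_⟩
      change some a = some b
      by_contra hne
      have : b = !a := by cases a <;> cases b <;> simp_all
      exact hb (by rw [this, h0])
  have hw' : ∀ x, w'.val x ≠ 0 → ∃ j, f' j = x := by
    classical
    intro x hx
    by_contra! hne
    have h01 := hne 0
    have h11 := hne 1
    have hs := w'.sum_eq (w'.finite_support.toFinset ∪
      {x, .square s (!i) a rfl, .apex (t ^^ X.reversed s (!i) a)}) (by simp +contextual)
    have h3 : ∑ y ∈ ({x, .square s (!i) a rfl, .apex (t ^^ X.reversed s (!i) a)} : Finset _),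
        w'.val y ≤ 1 := by
      rw [← hs]
      exact Finset.sum_le_sum_of_subset_of_nonneg Finset.subset_union_right
        fun y _ _ => w'.nonneg y
    rw [Finset.sum_insert, Finset.sum_pair (by simp), h1, h2] at h3
    · have := w'.nonneg x
      exact hx (by linarith)
    · simp only [Finset.mem_insert, Finset.mem_singleton, not_or]
      exact ⟨fun h => h01 h.symm, fun h => h11 h.symm⟩
  have hf' : ∀ j k, StarCompat (f' j) (f' k) := by
    simp [StarCompat, f', Fin.forall_fin_two, pairEmb_zero, pairEmb_one]
  rw [← (triChart s i t h).point_pull f (fun _ _ => trivial) w hw,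
    ← (starChart _ _).point_pull f' hf' w' hw']
  change point (K := X.simplexification) (cornerSegment s i t h a true) _ =
    point (K := X.simplexification) (cornerSegment s i t h a true) _
  congr 1
  ext j
  fin_cases j
  · exact h2.symm
  · exact h1.symm

/-- Both charts evaluate the same ordered horizontal edge, the one that starts at the corner of the
square with coordinate `false`; `reversed` matches the endpoints. -/
theorem triChart_pt_hor (s : X.S) (i t : Bool) (h : X.side s i t ∉ X.vertical)
    (w : Weight AllCompat) (w' : Weight AllCompat) (h0 : w.val none = 0)
    (h1 : ∀ a, w'.val (a ^^ X.reversed s i t) = w.val (some a)) :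
    (triChart s i t h).pt w = (horChart (X.side s i t) h).pt w' := by
  let f : Fin (1 + 1) ↪ Option Bool := pairEmb (some false) (some true) (by simp)
  let f' : Fin (1 + 1) ↪ Bool := pairEmb (false ^^ X.reversed s i t) (true ^^ X.reversed s i t)
    (by simp)
  have hw : ∀ x, w.val x ≠ 0 → ∃ j, f j = x := by
    rintro (_ | _ | _) hb
    · exact absurd h0 hb
    · exact ⟨0, rfl⟩
    · exact ⟨1, rfl⟩
  have hw' : ∀ x, w'.val x ≠ 0 → ∃ j, f' j = x := by
    intro x _
    by_cases hx : x = (false ^^ X.reversed s i t)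
    · exact ⟨0, hx.symm⟩
    · refine ⟨1, ?_⟩
      change (true ^^ X.reversed s i t) = x
      cases h : X.reversed s i t <;> cases x <;> simp_all
  rw [← (triChart s i t h).point_pull f (fun _ _ => trivial) w hw,
    ← (horChart _ _).point_pull f' (fun _ _ => trivial) w' hw']
  change point (K := X.simplexification) (.hor _ h (false ^^ X.reversed s i t)) _ =
    point (K := X.simplexification) (.hor _ h (false ^^ X.reversed s i t)) _
  congr 1
  ext j
  fin_cases j
  · exact (h1 false).symm
  · exact (h1 true).symm

/-- Some vertical side of a square. -/
theorem exists_vertical_side (s : X.S) : ∃ i, ∀ t, X.side s i t ∈ X.vertical := by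
  by_cases h : X.side s false false ∈ X.vertical
  · refine ⟨false, fun t => ?_⟩
    have h' := (X.alternates s false false true).1 h
    by_contra ht
    exact h' ((X.alternates s true true t).2 ht)
  · exact ⟨true, fun t => side_not_mem h t⟩

/-- Every point of the realisation lies in one of the charts or at a vertex `v*`. -/
theorem realization_cases {motive : X.simplexification.Realization → Prop}
    (vert : ∀ v, motive (vertPoint v)) (hor : ∀ e he w, motive ((horChart e he).pt w))
    (tri : ∀ s i t h w, motive ((triChart s i t h).pt w))
    (star : ∀ e he w, motive ((starChart e he).pt w)) (p) : motive p := by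
  obtain ⟨⟨⟨n, x⟩, t⟩, rfl⟩ := Quot.exists_rep p
  change motive (point (K := X.simplexification) x t)
  cases x with
  | vert v =>
    exact point_vertex_eq (X := X) (.vert v) (stdSimplex.vertex 0) t ▸ vert v
  | edge e he =>
    have := starChart_pt_of_eq_one he (Weight.single .center (starCompat_self _)) _
      (Weight.single_apply_self _ _) t
    exact (this : _ = point (K := X.simplexification) (.edge e he) t) ▸ star e he _
  | square s =>
    obtain ⟨i, hi⟩ := exists_vertical_side s
    have := starChart_pt_of_eq_one (hi false)
      (Weight.single (.square s i false rfl) (starCompat_self _)) _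
      (Weight.single_apply_self _ _) t
    exact (this : _ = point (K := X.simplexification) (.square s) t) ▸ star _ (hi false) _
  | hor e he b =>
    have := (horChart e he).point_eq (pairEmb b (!b) (by simp)) (fun _ _ => trivial) t
    exact (this : point (K := X.simplexification) (.hor e he b) t = _) ▸ hor e he _
  | tri s i t' h f =>
    have := (triChart s i t' h).point_eq f (fun _ _ => trivial) t
    exact (this : point (K := X.simplexification) (.tri s i t' h f) t = _) ▸ tri s i t' h _
  | star e he f hf =>
    have := (starChart e he).point_eq f hf t
    exact (this : point (K := X.simplexification) (.star e he f hf) t = _) ▸ star e he _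

end VHComplex

/-! ### Segments between weights, truncation and signs -/

namespace Weight

variable {α : Type*} {c : α → α → Prop}

/-- Two weights that agree except possibly at one element are equal. -/
theorem ext_of_ne (a₀ : α) {v w : Weight c} (h : ∀ a, a ≠ a₀ → v.val a = w.val a) : v = w := by
  classical
  ext a
  by_cases ha : a = a₀
  · subst ha
    set s := v.finite_support.toFinset ∪ w.finite_support.toFinset ∪ {a} with hs
    have hv := v.sum_eq s (by simp +contextual [hs])
    have hw := w.sum_eq s (by simp +contextual [hs])
    have has : a ∈ s := by simp [hs]
    rw [← Finset.add_sum_erase _ _ has] at hv hw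
    rw [Finset.sum_congr rfl fun b hb => h b (Finset.ne_of_mem_erase hb)] at hv
    linarith
  · exact h a ha

/-- The segment between two weights with compatible supports. -/
noncomputable def mix (v w : Weight c)
    (h : ∀ a b, v.val a ≠ 0 ∨ w.val a ≠ 0 → v.val b ≠ 0 ∨ w.val b ≠ 0 → c a b) (s : I) :
    Weight c where
  val a := (1 - s) * v.val a + s * w.val a
  nonneg a := add_nonneg (mul_nonneg (by linarith [s.2.2]) (v.nonneg a))
    (mul_nonneg s.2.1 (w.nonneg a))
  exists_finset := by
    classical
    refine ⟨v.finite_support.toFinset ∪ w.finite_support.toFinset, ?_, ?_⟩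
    · intro a ha
      simp only [Finset.mem_union, Finite.mem_toFinset, mem_ofPred_eq, not_or, not_not] at ha
      simp [ha.1, ha.2]
    · rw [Finset.sum_add_distrib, ← Finset.mul_sum, ← Finset.mul_sum, v.sum_eq, w.sum_eq]
      · ring
      · simp +contextual
      · simp +contextual
  compat a b ha hb := by
    refine h a b ?_ ?_ <;> by_contra! h
    · simp [h.1, h.2] at ha
    · simp [h.1, h.2] at hb

end Weight

/-- A variant of `Chart.continuous_pt`, in which one coordinate need not be considered. -/
theorem Chart.continuous_pt_of_ne {K : GenSimplicialComplex.{u}} {α : Type*} {c : α → α → Prop}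
    (C : Chart K α c) {P : Type*} [TopologicalSpace P] (F : P → Weight c) (s : Finset α) (a₀ : α)
    (hs : ∀ p, ∀ a ∉ s, (F p).val a = 0)
    (hF : ∀ a ∈ s, a ≠ a₀ → Continuous fun p => (F p).val a) :
    Continuous fun p => C.pt (F p) := by
  classical
  refine C.continuous_pt F s hs fun a ha => ?_
  by_cases h : a = a₀
  · subst h
    -- The omitted coordinate is determined by the others, as their sum is `1`.
    have : (fun p => (F p).val a) = fun p => 1 - ∑ b ∈ s.erase a, (F p).val b := by
      funext p
      rw [eq_sub_iff_add_eq, Finset.add_sum_erase _ _ ha, (F p).sum_eq s (hs p)]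
    rw [this]
    exact continuous_const.sub (continuous_finsetSum _ fun b hb =>
      hF b (Finset.mem_of_mem_erase hb) (Finset.ne_of_mem_erase hb))
  · exact hF a ha h

/-- The nearest number to `x` in `[-r, r]`. -/
noncomputable def clamp (x r : ℝ) : ℝ := max (-r) (min x r)

theorem clamp_eq {x r : ℝ} (h : |x| ≤ r) : clamp x r = x := by
  rw [abs_le] at h
  rw [clamp, min_eq_left h.2, max_eq_right h.1]

theorem abs_clamp_le (x : ℝ) {r : ℝ} (h : 0 ≤ r) : |clamp x r| ≤ r := by
  rw [abs_le, clamp]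
  exact ⟨le_max_left _ _, max_le (by linarith) (min_le_right _ _)⟩

theorem continuous_clamp {P : Type*} [TopologicalSpace P] {f g : P → ℝ} (hf : Continuous f)
    (hg : Continuous g) : Continuous fun p => clamp (f p) (g p) :=
  hg.neg.max (hf.min hg)

/-- The nearest number in the unit interval. -/
noncomputable abbrev toUnit (x : ℝ) : I := projIcc 0 1 zero_le_one x

theorem coe_toUnit {x : ℝ} (h0 : 0 ≤ x) (h1 : x ≤ 1) : (toUnit x : ℝ) = x := by
  rw [toUnit, projIcc_of_mem zero_le_one ⟨h0, h1⟩]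

theorem toUnit_coe (x : I) : toUnit x = x := projIcc_val zero_le_one x

/-- The sign of a truth value. -/
def sgn (b : Bool) : ℝ := if b then 1 else -1

theorem abs_sgn (b : Bool) : |sgn b| = 1 := by cases b <;> simp [sgn]

theorem abs_sgn_mul (b : Bool) (x : ℝ) : |sgn b * x| = |x| := by rw [abs_mul, abs_sgn, one_mul]

/-! ### Explicit coordinates on stars, triangles and horizontal edges -/

namespace VHComplex

open GenSimplicialComplex

variable {X : VHComplex.{u}}

section weights

variable {e : X.E}

/-- Corners of the star of `e*` that are not endpoints of `e`. -/
def NonApex (c : X.StarCorner e) : Prop := ∀ b, c ≠ .apex b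

/-- The point of the union of the triangles with corners `c`, `e*` and an endpoint of `e` with
height `y` above `e*` and distance `b` from `c` (where `|y| ≤ b ≤ 1`). -/
noncomputable def barWeight (c : X.StarCorner e) (hc : NonApex c) (y b : ℝ) :
    Weight (StarCompat (e := e)) where
  val x := by
    classical
    -- Truncating `b` to `[0, 1]` and then `y` to `[-b, b]` gives a weight for all real arguments
    -- without losing continuity; it changes nothing if `|y| ≤ b ≤ 1`. If `c` is `.center`, the last
    -- two summands add up at the same corner.
    exact (if x = .apex true then max (clamp y (max 0 (min b 1))) 0 else 0) +
      (if x = .apex false then max (-clamp y (max 0 (min b 1))) 0 else 0) +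
      (if x = c then 1 - max 0 (min b 1) else 0) +
      (if x = .center then max 0 (min b 1) - |clamp y (max 0 (min b 1))| else 0)
  nonneg x := by
    have h1 : max 0 (min b 1) ≤ 1 := max_le zero_le_one (min_le_right _ _)
    have h2 := abs_clamp_le y (le_max_left 0 (min b 1))
    refine add_nonneg (add_nonneg (add_nonneg ?_ ?_) ?_) ?_ <;> split_ifs <;>
      first | exact le_rfl | exact le_max_right _ _ | linarith
  exists_finset := by
    classical
    refine ⟨{.apex true, .apex false, c, .center}, fun x hx => ?_, ?_⟩
    · simp only [Finset.mem_insert, Finset.mem_singleton, not_or] at hx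
      simp [hx]
    · simp only [Finset.sum_add_distrib, Finset.sum_ite_eq']
      simp only [Finset.mem_insert, Finset.mem_singleton, true_or, or_true, if_true]
      have : max (clamp y (max 0 (min b 1))) 0 + max (-clamp y (max 0 (min b 1))) 0 =
          |clamp y (max 0 (min b 1))| := by
        generalize clamp y (max 0 (min b 1)) = z
        rcases le_total 0 z with h | h
        · rw [max_eq_left h, max_eq_right (by linarith), abs_of_nonneg h, add_zero]
        · rw [max_eq_right h, max_eq_left (by linarith), abs_of_nonpos h, zero_add]
      linarith
  compat x x' hx hx' := by
    rintro rfl rfl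
    simp only [(hc _).symm, reduceCtorEq, if_true, if_false, add_zero, zero_add,
      StarCorner.apex.injEq] at hx hx'
    rcases le_total 0 (clamp y (max 0 (min b 1))) with h | h
    · exact hx (max_eq_right (by linarith))
    · exact hx' (max_eq_right (by linarith))

theorem barWeight_apex (c : X.StarCorner e) (hc : NonApex c) {y b : ℝ} (hy : |y| ≤ b) (hb : b ≤ 1)
    (β : Bool) : (barWeight c hc y b).val (.apex β) = max (sgn β * y) 0 := by
  have h : max 0 (min b 1) = b := by
    rw [min_eq_left hb, max_eq_right ((abs_nonneg _).trans hy)]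
  cases β <;> simp [barWeight, (hc _).symm, h, clamp_eq hy, sgn]

theorem barWeight_self (c : X.StarCorner e) (hc : NonApex c) (hc' : c ≠ .center) {y b : ℝ}
    (hb0 : 0 ≤ b) (hb : b ≤ 1) : (barWeight c hc y b).val c = 1 - b := by
  have h : max 0 (min b 1) = b := by
    rw [min_eq_left hb, max_eq_right hb0]
  simp [barWeight, hc _, h, hc']

theorem barWeight_of_ne (c : X.StarCorner e) (hc : NonApex c) {y b : ℝ} (x : X.StarCorner e)
    (hx : NonApex x) (hx' : x ≠ .center) (hne : x ≠ c) : (barWeight c hc y b).val x = 0 := by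
  simp [barWeight, hx _, hx', hne]

theorem continuous_barWeight {P : Type*} [TopologicalSpace P] (he : e ∈ X.vertical)
    (c : X.StarCorner e) (hc : NonApex c) {y b : P → ℝ} (hy : Continuous y) (hb : Continuous b) :
    Continuous fun p => (starChart e he).pt (barWeight c hc (y p) (b p)) := by
  classical
  refine (starChart e he).continuous_pt _ {.apex true, .apex false, c, .center} ?_ fun a _ => ?_
  · intro p x hx
    simp only [Finset.mem_insert, Finset.mem_singleton, not_or] at hx
    simp [barWeight, hx]
  · have h1 : Continuous fun p => max 0 (min (b p) 1) := continuous_const.max (hb.min continuous_const)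
    have h2 := continuous_clamp hy h1
    simp only [barWeight]
    refine ((Continuous.add ?_ ?_).add ?_).add ?_
    all_goals split_ifs
    · exact h2.max continuous_const
    · exact continuous_const
    · exact h2.neg.max continuous_const
    · exact continuous_const
    · exact continuous_const.sub h1
    · exact continuous_const
    · exact h1.sub h2.abs
    · exact continuous_const

end weights

/-- The point of a triangle at distance `a` from its corner `s*`, with horizontal position `b`
(where `|b| ≤ a ≤ 1`). -/
noncomputable def triWeight (a b : ℝ) : Weight (AllCompat (α := Option Bool)) where
  val
    | none => 1 - max 0 (min a 1)
    | some τ => (max 0 (min a 1) + sgn τ * clamp b (max 0 (min a 1))) / 2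
  nonneg x := by
    have h1 : max 0 (min a 1) ≤ 1 := max_le zero_le_one (min_le_right _ _)
    have h2 := abs_clamp_le b (le_max_left 0 (min a 1))
    rw [abs_le] at h2
    rcases x with _ | _ | _
    · simp
    · simp only [sgn]
      norm_num
      linarith
    · simp only [sgn]
      norm_num
      linarith
  exists_finset := ⟨Finset.univ, by simp, by
    rw [Fintype.sum_option, Fintype.sum_bool]
    simp only [sgn]
    norm_num
    ring⟩
  compat _ _ _ _ := trivial

theorem triWeight_none {a b : ℝ} (h0 : 0 ≤ a) (h1 : a ≤ 1) : (triWeight a b).val none = 1 - a := by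
  simp only [triWeight, min_eq_left h1, max_eq_right h0]

theorem triWeight_some {a b : ℝ} (hb : |b| ≤ a) (h1 : a ≤ 1) (τ : Bool) :
    (triWeight a b).val (some τ) = (a + sgn τ * b) / 2 := by
  simp only [triWeight, min_eq_left h1, max_eq_right ((abs_nonneg _).trans hb), clamp_eq hb]

theorem continuous_triWeight {P : Type*} [TopologicalSpace P] (s : X.S) (i t : Bool)
    (h : X.side s i t ∉ X.vertical) {a b : P → ℝ} (ha : Continuous a) (hb : Continuous b) :
    Continuous fun p => (triChart s i t h).pt (triWeight (a p) (b p)) := by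
  refine (triChart s i t h).continuous_pt _ Finset.univ (by simp) fun x _ => ?_
  have h1 : Continuous fun p => max 0 (min (a p) 1) := continuous_const.max (ha.min continuous_const)
  rcases x with _ | τ
  · exact continuous_const.sub h1
  · exact (h1.add (continuous_const.mul (continuous_clamp hb h1))).div_const 2

/-- The point of a horizontal edge. -/
noncomputable def horWeight (x : I) : Weight (AllCompat (α := Bool)) where
  val b := if b then x else 1 - x
  nonneg b := by
    split_ifs
    exacts [x.2.1, by linarith [x.2.2]]
  exists_finset := ⟨Finset.univ, by simp, by simp⟩
  compat _ _ _ _ := trivial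

theorem continuous_horWeight {P : Type*} [TopologicalSpace P] (e : X.E) (he : e ∉ X.vertical)
    {x : P → I} (hx : Continuous x) :
    Continuous fun p => (horChart e he).pt (horWeight (x p)) := by
  refine (horChart e he).continuous_pt _ Finset.univ (by simp) fun b _ => ?_
  have := continuous_subtype_val.comp hx
  cases b
  · exact continuous_const.sub this
  · exact this

/-! ### The triangulation of the square complex -/

theorem exists_horizontal_direction (s : X.S) : ∃ i, ∀ t, X.side s i t ∉ X.vertical := by
  obtain ⟨i, hi⟩ := exists_vertical_side s
  exact ⟨!i, fun t => (X.alternates s i false t).1 (hi false)⟩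

/-- The direction of the horizontal sides of a square. -/
noncomputable def hdir (s : X.S) : Bool := (exists_horizontal_direction s).choose

theorem hdir_spec (s : X.S) (t : Bool) : X.side s (hdir s) t ∉ X.vertical :=
  (exists_horizontal_direction s).choose_spec t

theorem hdir_spec' (s : X.S) (t : Bool) : X.side s (!hdir s) t ∈ X.vertical :=
  side_not_mem (hdir_spec s t) t

theorem eq_hdir {s : X.S} {i t : Bool} (h : X.side s i t ∉ X.vertical) : i = hdir s := by
  by_contra hne
  have : i = !hdir s := by cases hi : hdir s <;> cases i <;> simp_all
  subst this
  exact h (hdir_spec' s t)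

theorem eq_not_hdir {s : X.S} {i t : Bool} (h : X.side s i t ∈ X.vertical) : i = !hdir s := by
  by_contra hne
  have : i = hdir s := by cases hi : hdir s <;> cases i <;> simp_all
  subst this
  exact hdir_spec s t h

theorem nonApex_square {e : X.E} (s : X.S) (i t : Bool) (h : X.side s i t = e) :
    NonApex (.square s i t h) := fun _ => by simp

theorem nonApex_center {e : X.E} : NonApex (.center : X.StarCorner e) := fun _ => by simp

/-- The part of a square (with vertical and horizontal coordinates `a`, `b` in `[-1, 1]`) near its
horizontal side on the side `ε`. -/
noncomputable def triPart (s : X.S) (ε : Bool) (a b : ℝ) : X.simplexification.Realization :=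
  (triChart s (hdir s) ε (hdir_spec s ε)).pt (triWeight |a| b)

/-- The part of a square near its vertical side on the side `τ`. -/
noncomputable def starPart (s : X.S) (τ : Bool) (a b : ℝ) : X.simplexification.Realization :=
  (starChart _ (hdir_spec' s τ)).pt (barWeight (.square s (!hdir s) τ rfl)
    (nonApex_square _ _ _ _) (sgn (!X.reversed s (!hdir s) τ) * a) |b|)

/-- The point `s*`. -/
noncomputable def squarePoint (s : X.S) : X.simplexification.Realization :=
  point (K := X.simplexification) (.square s) (stdSimplex.vertex 0)

theorem starChart_pt_square {e : X.E} (he : e ∈ X.vertical) (w : Weight (StarCompat (e := e)))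
    (s i t h) (hw : w.val (.square s i t h) = 1) : (starChart e he).pt w = squarePoint s :=
  starChart_pt_of_eq_one he w _ hw _

theorem triChart_pt_none (s : X.S) (i t : Bool) (h : X.side s i t ∉ X.vertical)
    (w : Weight AllCompat) (hw : w.val none = 1) : (triChart s i t h).pt w = squarePoint s := by
  rw [triChart_pt_star s i t h false w
    (Weight.single (.square s (!i) false rfl) (starCompat_self _)),
    starChart_pt_square _ _ s (!i) false rfl]
  · exact Weight.single_apply_self _ _
  · exact w.eq_zero_of_eq_one hw (by simp)
  · rw [Weight.single_apply_of_ne _ _ (by simp), w.eq_zero_of_eq_one hw (by simp)]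
  · rw [Weight.single_apply_self, hw]

theorem triPart_zero (s : X.S) (ε : Bool) (b : ℝ) : triPart s ε 0 b = squarePoint s := by
  refine triChart_pt_none _ _ _ _ _ ?_
  rw [abs_zero, triWeight_none le_rfl zero_le_one, sub_zero]

theorem starPart_zero (s : X.S) (τ : Bool) (a : ℝ) : starPart s τ a 0 = squarePoint s := by
  refine starChart_pt_square _ _ s _ τ rfl ?_
  rw [abs_zero, barWeight_self _ _ (by simp) le_rfl zero_le_one, sub_zero]

/-- The diagonal from `s*` to a corner is where a triangle over a horizontal side meets a star. In
both charts the corner has weight `r` and `s*` has weight `1 - r`. -/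
theorem triPart_eq_starPart (s : X.S) (ε τ : Bool) {r : ℝ} (h0 : 0 ≤ r) (h1 : r ≤ 1) :
    triPart s ε (sgn ε * r) (sgn τ * r) = starPart s τ (sgn ε * r) (sgn τ * r) := by
  rw [triPart, starPart]
  have e1 : ∀ b, |sgn b * r| = r := fun b => by rw [abs_sgn_mul, abs_of_nonneg h0]
  have e2 : |sgn (!X.reversed s (!hdir s) τ) * (sgn ε * r)| ≤ r := by rw [abs_sgn_mul, e1]
  rw [e1, e1]
  refine triChart_pt_star _ _ _ _ τ _ _ ?_ ?_ ?_
  · rw [triWeight_some (e1 τ).le h1]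
    cases τ <;> simp [sgn]
  · rw [triWeight_some (e1 τ).le h1, barWeight_apex _ _ e2 h1]
    cases X.reversed s (!hdir s) τ <;> cases ε <;> cases τ <;> simp [sgn, h0]
  · rw [triWeight_none h0 h1, barWeight_self _ _ (by simp) h0 h1]

/-- The map from a square, with coordinates in `[-1, 1]`, to the simplexification. -/
noncomputable def squareMap (s : X.S) (a b : ℝ) : X.simplexification.Realization :=
  if |b| ≤ |a| then (if 0 ≤ a then triPart s true a b else triPart s false a b)
  else (if 0 ≤ b then starPart s true a b else starPart s false a b)

theorem exists_sgn (x : ℝ) : ∃ ε, x = sgn ε * |x| := by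
  rcases le_total 0 x with h | h
  · exact ⟨true, by simp [sgn, abs_of_nonneg h]⟩
  · exact ⟨false, by simp [sgn, abs_of_nonpos h]⟩

/-- The sign is ambiguous only for `a = 0`, where both parts are the point `s*`. -/
theorem ite_triPart (s : X.S) (ε : Bool) {a b : ℝ} (h : a = sgn ε * |a|) :
    (if 0 ≤ a then triPart s true a b else triPart s false a b) = triPart s ε a b := by
  split_ifs with h0
  · cases ε
    · have : a = 0 := by
        rw [abs_of_nonneg h0] at h; simp [sgn] at h; linarith
      rw [this, triPart_zero, triPart_zero]
    · rfl
  · cases ε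
    · rfl
    · exfalso
      simp only [sgn, if_true, one_mul] at h
      exact h0 (h ▸ abs_nonneg _)

theorem ite_starPart (s : X.S) (τ : Bool) {a b : ℝ} (h : b = sgn τ * |b|) :
    (if 0 ≤ b then starPart s true a b else starPart s false a b) = starPart s τ a b := by
  split_ifs with h0
  · cases τ
    · have : b = 0 := by
        rw [abs_of_nonneg h0] at h; simp [sgn] at h; linarith
      rw [this, starPart_zero, starPart_zero]
    · rfl
  · cases τ
    · rfl
    · exfalso
      simp only [sgn, if_true, one_mul] at h
      exact h0 (h ▸ abs_nonneg _)

theorem parts_agree (s : X.S) (ε τ : Bool) {a b : ℝ} (h : |b| = |a|) (ha : |a| ≤ 1)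
    (hε : a = sgn ε * |a|) (hτ : b = sgn τ * |b|) : triPart s ε a b = starPart s τ a b := by
  rw [hε, hτ, h]
  exact triPart_eq_starPart s ε τ (abs_nonneg a) ha

theorem squareMap_tri (s : X.S) (ε : Bool) {a b : ℝ} (h : |b| ≤ |a|) (hε : a = sgn ε * |a|) :
    squareMap s a b = triPart s ε a b := by
  rw [squareMap, if_pos h, ite_triPart s ε hε]

/-- The definition prefers the triangles on the diagonals; `parts_agree` makes the stars equally
valid there. -/
theorem squareMap_star (s : X.S) (τ : Bool) {a b : ℝ} (h : |a| ≤ |b|) (hb : |b| ≤ 1)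
    (hτ : b = sgn τ * |b|) : squareMap s a b = starPart s τ a b := by
  rw [squareMap]
  split_ifs with h1 h2
  · exact parts_agree s true τ (le_antisymm h1 h) (h.trans hb) (by simp [sgn, abs_of_nonneg h2]) hτ
  · exact parts_agree s false τ (le_antisymm h1 h) (h.trans hb)
      (by simp [sgn, abs_of_nonpos (not_le.1 h2).le]) hτ
  · exact (ite_starPart s τ hτ) ▸ by rw [if_pos ‹_›]
  · exact (ite_starPart s τ hτ) ▸ by rw [if_neg ‹_›]

theorem continuous_squareMap {P : Type*} [TopologicalSpace P] (s : X.S) {a b : P → ℝ}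
    (ha : Continuous a) (hb : Continuous b) (ha1 : ∀ p, |a p| ≤ 1) :
    Continuous fun p => squareMap s (a p) (b p) := by
  have hT : ∀ ε, Continuous fun p => triPart s ε (a p) (b p) := fun ε =>
    continuous_triWeight s _ ε _ ha.abs hb
  have hS : ∀ τ, Continuous fun p => starPart s τ (a p) (b p) := fun τ =>
    continuous_barWeight _ _ _ (continuous_const.mul ha) hb.abs
  refine Continuous.if_le ?_ ?_ hb.abs ha.abs ?_
  · refine Continuous.if_le (hT _) (hT _) continuous_const ha fun p hp => ?_
    rw [← hp, triPart_zero, triPart_zero]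
  · refine Continuous.if_le (hS _) (hS _) continuous_const hb fun p hp => ?_
    rw [← hp, starPart_zero, starPart_zero]
  · intro p hp
    obtain ⟨ε, hε⟩ := exists_sgn (a p)
    obtain ⟨τ, hτ⟩ := exists_sgn (b p)
    rw [ite_triPart s ε hε, ite_starPart s τ hτ]
    exact parts_agree s ε τ hp (ha1 p) hε hτ

/-- The map from an edge to the simplexification. -/
noncomputable def edgeMap (e : X.E) (x : I) : X.simplexification.Realization := by
  classical
  exact if he : e ∈ X.vertical then (starChart e he).pt (barWeight .center nonApex_center (2 * x - 1) 1)
    else (horChart e he).pt (horWeight x)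

theorem abs_two_mul_sub_one_le (x : I) : |2 * (x : ℝ) - 1| ≤ 1 := by
  rw [abs_le]
  constructor <;> linarith [x.2.1, x.2.2]

/-- At distance `1` from `s*` the weight of the square vanishes, so the point no longer remembers
the square. For this reason all squares along `e` induce the same map on `e`. -/
theorem barWeight_square_one {e : X.E} (s i t h) {y : ℝ} (hy : |y| ≤ 1) :
    barWeight (.square s i t h : X.StarCorner e) (nonApex_square _ _ _ _) y 1 =
      barWeight .center nonApex_center y 1 := by
  refine Weight.ext_of_ne .center fun x hx => ?_
  cases x with
  | apex β => rw [barWeight_apex _ _ hy le_rfl, barWeight_apex _ _ hy le_rfl]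
  | center => exact absurd rfl hx
  | square s' i' t' h' =>
    rw [barWeight_of_ne .center _ _ (nonApex_square _ _ _ _) hx hx]
    by_cases h : (.square s' i' t' h' : X.StarCorner e) = .square s i t h
    · rw [h, barWeight_self _ _ (by simp) zero_le_one le_rfl, sub_self]
    · exact barWeight_of_ne _ _ _ (nonApex_square _ _ _ _) hx h

/-- The map from the cells of the square complex to the simplexification. -/
noncomputable def cellMap : X.toSquareComplex.Cells → X.simplexification.Realization
  | .inl ⟨v, _⟩ => vertPoint v
  | .inr (.inl ⟨e, x⟩) => edgeMap e x
  | .inr (.inr ⟨s, x⟩) => squareMap s (2 * x (!hdir s) - 1) (2 * x (hdir s) - 1)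

theorem edgeMap_endPt (e : X.E) (b : Bool) :
    edgeMap e (SquareComplex.endPt b) = vertPoint (X.ends e b) := by
  rw [edgeMap]
  split_ifs with he
  · refine starChart_pt_apex he _ b ?_
    rw [barWeight_apex _ _ (abs_two_mul_sub_one_le _) le_rfl]
    cases b <;> (simp [sgn, SquareComplex.endPt]; try norm_num)
  · refine horChart_pt_eq he _ b ?_
    cases b <;> simp [horWeight, SquareComplex.endPt]

theorem two_mul_endPt (b : Bool) : 2 * (SquareComplex.endPt b : ℝ) - 1 = sgn b := by
  cases b <;> simp [sgn, SquareComplex.endPt]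
  norm_num

/-- On a side one coordinate is `1` or `-1`, so the side lies in a single part of the square: in the
star of that side if it is vertical, and in the triangle over it if it is horizontal. It remains to
match orientations through `reversed`. -/
theorem cellMap_glue {p q : X.toSquareComplex.Cells} (h : X.toSquareComplex.Glue p q) :
    cellMap p = cellMap q := by
  cases h with
  | ends e b => exact edgeMap_endPt e b
  | side s i t x =>
    change squareMap s _ _ = edgeMap _ _
    have hx := abs_two_mul_sub_one_le x
    by_cases hi : X.side s i t ∈ X.vertical
    · obtain rfl := eq_not_hdir hi
      simp only [if_true, Bool.eq_not_self, if_false, two_mul_endPt]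
      rw [squareMap_star s t (by rwa [abs_sgn]) (abs_sgn t).le (by rw [abs_sgn, mul_one]), starPart,
        edgeMap, dif_pos hi, abs_sgn, barWeight_square_one _ _ _ _ (by rwa [abs_sgn_mul])]
      congr 2
      cases X.reversed s (!hdir s) t <;> simp [sgn]
      ring
    · obtain rfl := eq_hdir hi
      simp only [if_true, Bool.not_eq_self, if_false, two_mul_endPt]
      rw [squareMap_tri s t (by rwa [abs_sgn]) (by rw [abs_sgn, mul_one]), triPart, edgeMap,
        dif_neg hi, abs_sgn]
      refine triChart_pt_hor _ _ _ _ _ _ ?_ fun a => ?_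
      · rw [triWeight_none zero_le_one le_rfl, sub_self]
      · rw [triWeight_some hx le_rfl]
        cases X.reversed s (hdir s) t <;> cases a <;> simp [horWeight, sgn] <;> ring

/-- The map from a `VH`-complex to its simplexification that subdivides the vertical edges and the
squares. -/
noncomputable def subdivide : C(X.toSquareComplex.Realization, X.simplexification.Realization) where
  toFun := Quot.lift cellMap fun _ _ h => cellMap_glue h
  continuous_toFun := by
    refine continuous_quot_lift _ (continuous_sum_dom.2 ⟨?_, continuous_sum_dom.2 ⟨?_, ?_⟩⟩)
    · exact continuous_sigma fun v => continuous_const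
    · refine continuous_sigma fun e => ?_
      change Continuous (edgeMap e)
      unfold edgeMap
      split_ifs with he
      · exact continuous_barWeight he _ _ (by fun_prop) continuous_const
      · exact continuous_horWeight e he continuous_id
    · refine continuous_sigma fun s => ?_
      have hx : ∀ i, Continuous fun x : Bool → I => 2 * (x i : ℝ) - 1 := fun i => by fun_prop
      exact continuous_squareMap s (hx _) (hx _) fun x => abs_two_mul_sub_one_le _

end VHComplex

/-! ### The retraction of a star -/

theorem Weight.sum_le_one {α : Type*} {c : α → α → Prop} (w : Weight c) (s : Finset α) :
    ∑ a ∈ s, w.val a ≤ 1 := by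
  classical
  rw [← w.sum_eq (w.finite_support.toFinset ∪ s) (by simp +contextual)]
  exact Finset.sum_le_sum_of_subset_of_nonneg Finset.subset_union_right fun a _ _ => w.nonneg a

namespace VHComplex

open GenSimplicialComplex

variable {X : VHComplex.{u}}

section retraction

variable {e : X.E} (w : Weight (StarCompat (e := e)))

/-- The total weight of the squares adjacent to `e`. -/
noncomputable def squareSum : ℝ :=
  1 - w.val .center - w.val (.apex false) - w.val (.apex true)

/-- The (signed) weight of the endpoints of `e`. -/
noncomputable def height : ℝ := w.val (.apex true) - w.val (.apex false)

/-- The amount by which the weight of a square exceeds that of the other squares. -/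
noncomputable def excess (c : X.StarCorner e) : ℝ :=
  match c with
  | .square _ _ _ _ => 2 * w.val c - squareSum w
  | _ => 0

theorem excess_square (s i t h) :
    excess w (.square s i t h) = 2 * w.val (.square s i t h) - squareSum w := rfl

theorem excess_of_nonApex {c : X.StarCorner e} (hc : NonApex c) (hc' : c ≠ .center) :
    excess w c = 2 * w.val c - squareSum w := by
  cases c with
  | apex b => exact absurd rfl (hc b)
  | center => exact absurd rfl hc'
  | square s i t h => rfl

theorem squareSum_nonneg : 0 ≤ squareSum w := by
  classical
  have := w.sum_le_one {.center, .apex false, .apex true}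
  rw [Finset.sum_insert (by simp), Finset.sum_pair (by simp)] at this
  rw [squareSum]
  linarith

theorem val_le_squareSum {c : X.StarCorner e} (hc : NonApex c) (hc' : c ≠ .center) :
    w.val c ≤ squareSum w := by
  classical
  have := w.sum_le_one {c, .center, .apex false, .apex true}
  rw [Finset.sum_insert (by simp [hc _, hc']), Finset.sum_insert (by simp),
    Finset.sum_pair (by simp)] at this
  rw [squareSum]
  linarith

theorem val_add_le_squareSum {c d : X.StarCorner e} (hc : NonApex c) (hc' : c ≠ .center)
    (hd : NonApex d) (hd' : d ≠ .center) (hcd : c ≠ d) : w.val c + w.val d ≤ squareSum w := by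
  classical
  have := w.sum_le_one {c, d, .center, .apex false, .apex true}
  rw [Finset.sum_insert (by simp [hc _, hc', hcd]), Finset.sum_insert (by simp [hd _, hd']),
    Finset.sum_insert (by simp), Finset.sum_pair (by simp)] at this
  rw [squareSum]
  linarith

theorem apex_eq_zero_or : w.val (.apex false) = 0 ∨ w.val (.apex true) = 0 := by
  by_contra! h
  exact w.compat _ _ h.1 h.2 rfl rfl

/-- At most one endpoint of `e` carries weight, so the signed height determines the weights of both.
-/
theorem max_sgn_mul_height (β : Bool) : max (sgn β * height w) 0 = w.val (.apex β) := by
  have h0 := w.nonneg (.apex false)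
  have h1 := w.nonneg (.apex true)
  rcases apex_eq_zero_or w with h | h <;> cases β <;> simp [sgn, height, h, h0, h1]

theorem abs_height : |height w| = w.val (.apex false) + w.val (.apex true) := by
  rcases apex_eq_zero_or w with h | h
  · simp [height, h, abs_of_nonneg (w.nonneg _)]
  · simp [height, h, abs_of_nonneg (w.nonneg _)]

theorem excess_cases (c : X.StarCorner e) :
    excess w c = 0 ∨ (NonApex c ∧ c ≠ .center ∧ excess w c = 2 * w.val c - squareSum w) := by
  cases c with
  | apex b => exact .inl rfl
  | center => exact .inl rfl
  | square s i t h => exact .inr ⟨nonApex_square s i t h, by simp, rfl⟩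

/-- The excess is at most the total weight of the squares, and the endpoints have at most the
complementary weight. This puts `retract` in the range where `barWeight` truncates nothing. -/
theorem abs_height_le (c : X.StarCorner e) : |height w| ≤ 1 - excess w c := by
  have h1 := squareSum_nonneg w
  have h2 := w.nonneg .center
  rw [abs_height]
  rcases excess_cases w c with h | ⟨hc, hc', h⟩
  · rw [h]
    unfold squareSum at h1
    linarith
  · have := val_le_squareSum w hc hc'
    rw [h]
    unfold squareSum at *
    linarith

/-- Positive excess means more than half of the total weight of the squares, which two squares
cannot both have. -/
theorem excess_le_of_pos {c d : X.StarCorner e} (hc : 0 < excess w c) (hd : d ≠ c) :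
    excess w d ≤ 0 := by
  rcases excess_cases w d with h | ⟨hd1, hd2, hd3⟩
  · exact h.le
  · rcases excess_cases w c with h | ⟨hc1, hc2, hc3⟩
    · exact absurd h hc.ne'
    · have := val_add_le_squareSum w hc1 hc2 hd1 hd2 hd.symm
      linarith

/-- The square of positive excess, or `e*` if there is none. -/
noncomputable def dominant : X.StarCorner e := by
  classical
  exact if h : ∃ c, 0 < excess w c then h.choose else .center

theorem excess_dominant_nonneg : 0 ≤ excess w (dominant w) := by
  unfold dominant
  split_ifs with h
  · exact h.choose_spec.le
  · exact le_rfl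

theorem excess_le_of_ne_dominant {c : X.StarCorner e} (hc : c ≠ dominant w) : excess w c ≤ 0 := by
  unfold dominant at hc
  split_ifs at hc with h
  · exact excess_le_of_pos w h.choose_spec hc
  · exact not_lt.1 fun h' => h ⟨c, h'⟩

theorem dominant_eq_of_pos {c : X.StarCorner e} (hc : 0 < excess w c) : dominant w = c := by
  by_contra h
  exact absurd hc (excess_le_of_ne_dominant w (Ne.symm h)).not_gt

theorem nonApex_dominant : NonApex (dominant w) := by
  unfold dominant
  split_ifs with h
  · intro b hb
    have := h.choose_spec
    rw [hb] at this
    exact lt_irrefl _ this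
  · exact nonApex_center

/-- The retraction of the star of `e*` onto the union of the triangles in it that come from the
squares. -/
noncomputable def retract : Weight (StarCompat (e := e)) :=
  barWeight (dominant w) (nonApex_dominant w) (height w) (1 - excess w (dominant w))

theorem retract_apex (b : Bool) : (retract w).val (.apex b) = w.val (.apex b) := by
  rw [retract, barWeight_apex _ _ (abs_height_le w _) (by linarith [excess_dominant_nonneg w]),
    max_sgn_mul_height]

/-- Although `retract` selects a corner by choice, this formula and `retract_apex` show that all its
coordinates away from `e*` are continuous in `w`. The continuity of the homotopy rests on this. -/
theorem retract_square {c : X.StarCorner e} (hc : NonApex c) (hc' : c ≠ .center) :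
    (retract w).val c = max 0 (excess w c) := by
  by_cases h : c = dominant w
  · have h1 := barWeight_self (dominant w) (nonApex_dominant w) (h ▸ hc') (y := height w)
      ((abs_nonneg _).trans (abs_height_le w (dominant w)))
      (by linarith [excess_dominant_nonneg w])
    rw [← retract, sub_sub_cancel, ← h] at h1
    rw [h1, max_eq_right]
    rw [h]
    exact excess_dominant_nonneg w
  · rw [retract, barWeight_of_ne _ _ _ hc hc' h, max_eq_left (excess_le_of_ne_dominant w h)]

/-- A square that carries all the weight of the squares has that same weight as its excess, so
nothing is moved. This makes the homotopy stationary on the triangles that come from squares. -/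
theorem retract_eq_self (c : X.StarCorner e)
    (h : ∀ d, NonApex d → d ≠ .center → d ≠ c → w.val d = 0) : retract w = w := by
  classical
  refine Weight.ext_of_ne .center fun d hd => ?_
  cases d with
  | apex b => exact retract_apex w b
  | center => exact absurd rfl hd
  | square s i t h' =>
    have hn := nonApex_square (e := e) s i t h'
    rw [retract_square w hn hd]
    by_cases h0 : w.val (.square s i t h') = 0
    · rw [h0, excess_square, h0]
      exact max_eq_left (by linarith [squareSum_nonneg w])
    · have hdc : ∀ d, NonApex d → d ≠ .center → d ≠ .square s i t h' → w.val d = 0 := by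
        intro d hd1 hd2 hd3
        by_cases hd4 : d = c
        · by_contra
          exact h0 (h _ hn hd fun h5 => hd3 (hd4.trans h5.symm))
        · exact h d hd1 hd2 hd4
      have hs := w.sum_eq {.square s i t h', .center, .apex false, .apex true} (by
        intro d hd
        simp only [Finset.mem_insert, Finset.mem_singleton, not_or] at hd
        exact hdc d (by rintro (_ | _) <;> tauto) hd.2.1 hd.1)
      rw [Finset.sum_insert (by simp), Finset.sum_insert (by simp),
        Finset.sum_pair (by simp)] at hs
      have : excess w (.square s i t h') = w.val (.square s i t h') := by
        rw [excess_square, squareSum]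
        linarith
      rw [this, max_eq_right (w.nonneg _)]

theorem excess_le_val (c : X.StarCorner e) : excess w c ≤ w.val c := by
  rcases excess_cases w c with h | ⟨h1, h2, h3⟩
  · rw [h]; exact w.nonneg c
  · rw [h3]
    linarith [val_le_squareSum w h1 h2]

/-- The weights of the endpoints do not change, and only pairs of endpoints can be incompatible. So
the segment from `w` to its retraction stays in the star. -/
theorem retract_compat (a b : X.StarCorner e) (ha : w.val a ≠ 0 ∨ (retract w).val a ≠ 0)
    (hb : w.val b ≠ 0 ∨ (retract w).val b ≠ 0) : StarCompat a b := by
  rintro rfl rfl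
  simp only [retract_apex, or_self] at ha hb
  exact w.compat _ _ ha hb rfl rfl

end retraction

/-! ### The map to the square complex -/

/-- A point of an edge, in the realisation. -/
noncomputable def edgePoint (e : X.E) (x : I) : X.toSquareComplex.Realization :=
  Quot.mk _ (X.edgePt e x)

/-- A point of a square, in the realisation. -/
noncomputable def sqPoint (s : X.S) (x : Bool → I) : X.toSquareComplex.Realization :=
  Quot.mk _ (X.squarePt s x)

theorem edgePoint_endPt (e : X.E) (b : Bool) :
    edgePoint e (SquareComplex.endPt b) = Quot.mk _ (.inl ⟨X.ends e b, ()⟩) :=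
  Quot.sound (.ends e b)

theorem sqPoint_side (s : X.S) (i t : Bool) (x : I) :
    sqPoint s (fun j => if j = i then x else SquareComplex.endPt t) =
      edgePoint (X.side s i t) (if X.reversed s i t then unitInterval.symm x else x) :=
  Quot.sound (.side s i t x)

theorem continuous_edgePoint (e : X.E) : Continuous (edgePoint e) :=
  continuous_quot_mk.comp (continuous_inr.comp (continuous_inl.comp continuous_sigmaMk))

theorem continuous_sqPoint (s : X.S) : Continuous (sqPoint s) :=
  continuous_quot_mk.comp (continuous_inr.comp (continuous_inr.comp continuous_sigmaMk))

/-- The point of a vertical edge at height `y`, or of an adjacent square at height `y` and at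
distance `b` from the vertical middle line. -/
noncomputable def cornerPoint {e : X.E} (c : X.StarCorner e) (y b : ℝ) :
    X.toSquareComplex.Realization :=
  match c with
  | .square s i t _ => sqPoint s fun j =>
      if j = i then toUnit ((1 + if X.reversed s i t then -y else y) / 2)
      else toUnit ((1 + sgn t * b) / 2)
  | _ => edgePoint e (toUnit ((1 + y) / 2))

theorem toUnit_sgn (t : Bool) : toUnit ((1 + sgn t) / 2) = SquareComplex.endPt t := by
  ext
  rw [coe_toUnit] <;> cases t <;> norm_num [sgn, SquareComplex.endPt]

theorem symm_toUnit {y : ℝ} (hy : |y| ≤ 1) :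
    unitInterval.symm (toUnit ((1 + y) / 2)) = toUnit ((1 - y) / 2) := by
  rw [abs_le] at hy
  ext
  rw [unitInterval.coe_symm_eq, coe_toUnit, coe_toUnit] <;> linarith

theorem cornerPoint_square {e : X.E} (s i t) (h : X.side s i t = e) (y b : ℝ) :
    cornerPoint (.square s i t h) y b = sqPoint s fun j =>
      if j = i then toUnit ((1 + if X.reversed s i t then -y else y) / 2)
      else toUnit ((1 + sgn t * b) / 2) := rfl

/-- At distance `1` from the middle line the point lies on a vertical side, that is, on `e`,
whichever adjacent square is used. -/
theorem cornerPoint_one {e : X.E} (c : X.StarCorner e) {y : ℝ} (hy : |y| ≤ 1) :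
    cornerPoint c y 1 = edgePoint e (toUnit ((1 + y) / 2)) := by
  cases c with
  | apex b => rfl
  | center => rfl
  | square s i t h =>
    rw [cornerPoint_square, mul_one, toUnit_sgn, sqPoint_side, h]
    congr 1
    split_ifs
    · rw [symm_toUnit (by rwa [abs_neg]), sub_neg_eq_add]
    · rfl

theorem continuous_cornerPoint {e : X.E} (c : X.StarCorner e) {P : Type*} [TopologicalSpace P]
    {y b : P → ℝ} (hy : Continuous y) (hb : Continuous b) :
    Continuous fun p => cornerPoint c (y p) (b p) := by
  have hu : Continuous toUnit := continuous_projIcc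
  have he : Continuous fun p => edgePoint e (toUnit ((1 + y p) / 2)) :=
    (continuous_edgePoint e).comp (hu.comp ((continuous_const.add hy).div_const 2))
  cases c with
  | apex _ => exact he
  | center => exact he
  | square s i t h =>
    refine (continuous_sqPoint s).comp (continuous_pi fun j => ?_)
    split_ifs
    · exact hu.comp ((continuous_const.add hy.neg).div_const 2)
    · exact hu.comp ((continuous_const.add hy).div_const 2)
    · exact hu.comp ((continuous_const.add (continuous_const.mul hb)).div_const 2)

/-- The map from the star of `e*` to the square complex. -/
noncomputable def starRetract {e : X.E} (w : Weight (StarCompat (e := e))) :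
    X.toSquareComplex.Realization :=
  cornerPoint (dominant w) (height w) (1 - excess w (dominant w))

theorem abs_height_le_one {e : X.E} (w : Weight (StarCompat (e := e))) : |height w| ≤ 1 := by
  simpa [excess] using abs_height_le w .center

theorem starRetract_of_nonpos {e : X.E} (w : Weight (StarCompat (e := e)))
    (h : ∀ c, excess w c ≤ 0) :
    starRetract w = edgePoint e (toUnit ((1 + height w) / 2)) := by
  rw [starRetract, le_antisymm (h _) (excess_dominant_nonneg w), sub_zero,
    cornerPoint_one _ (abs_height_le_one w)]

theorem starRetract_of_nonneg {e : X.E} (w : Weight (StarCompat (e := e))) (c : X.StarCorner e)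
    (hc : 0 ≤ excess w c) (hc1 : NonApex c) (hc2 : c ≠ .center) :
    starRetract w = cornerPoint c (height w) (1 - excess w c) := by
  rcases hc.eq_or_lt with h | h
  -- With excess zero, `c` need not be dominant, but it has half of the weight of the squares. So no
  -- other square has positive excess, and both sides are the same point of `e`.
  · rw [← h, sub_zero, cornerPoint_one _ (abs_height_le_one w)]
    refine starRetract_of_nonpos w fun d => ?_
    by_contra! hd
    rcases excess_cases w d with hd' | ⟨hd1, hd2, hd3⟩
    · exact hd.ne' hd'
    · have hcd : c ≠ d := by rintro rfl; exact hd.ne h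
      have := val_add_le_squareSum w hc1 hc2 hd1 hd2 hcd
      rw [excess_of_nonApex w hc1 hc2] at h
      linarith
  · rw [starRetract, dominant_eq_of_pos w h]

theorem continuous_starRetract {e : X.E} {m : ℕ} (f : Fin (m + 1) ↪ X.StarCorner e) (hf) :
    Continuous fun t => starRetract (Weight.push (c := StarCompat) f hf t) := by
  have hS : Continuous fun t => squareSum (Weight.push (c := StarCompat) f hf t) :=
    ((continuous_const.sub (Weight.continuous_push f hf _)).sub
      (Weight.continuous_push f hf _)).sub (Weight.continuous_push f hf _)
  have hY : Continuous fun t => height (Weight.push (c := StarCompat) f hf t) :=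
    (Weight.continuous_push f hf _).sub (Weight.continuous_push f hf _)
  have hE : ∀ c, Continuous fun t => excess (Weight.push (c := StarCompat) f hf t) c := by
    intro c
    cases c with
    | apex _ => exact continuous_const
    | center => exact continuous_const
    | square s i t h => exact (continuous_const.mul (Weight.continuous_push f hf _)).sub hS
  have hpos : ∀ t c, 0 < excess (Weight.push (c := StarCompat) f hf t) c → ∃ j, f j = c := by
    intro t c hc
    by_contra! h
    have := excess_le_val (Weight.push (c := StarCompat) f hf t) c
    rw [Weight.push_of_notMem f hf t h] at this
    linarith
  -- The inequalities are not strict, so the pieces are closed, and by the two preceding lemmas each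
  -- formula is valid on its whole piece. Only corners of the simplex can have positive excess, so
  -- finitely many pieces suffice; `none` stands for the piece without any.
  refine continuous_of_finite_closed_cover (ι := Option (Fin (m + 1)))
    (fun o => o.elim {t | ∀ j, excess (Weight.push (c := StarCompat) f hf t) (f j) ≤ 0}
      fun j => {t | 0 ≤ excess (Weight.push (c := StarCompat) f hf t) (f j)} ∩
        {_t | NonApex (f j) ∧ f j ≠ .center}) ?_ ?_ ?_
  · rintro (_ | j)
    · simp only [Option.elim, Set.ofPred_forall]
      exact isClosed_iInter fun j => isClosed_le (hE _) continuous_const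
    · exact (isClosed_le continuous_const (hE _)).inter isClosed_const
  · intro t
    by_cases h : ∃ j, 0 < excess (Weight.push (c := StarCompat) f hf t) (f j)
    · obtain ⟨j, hj⟩ := h
      refine ⟨some j, hj.le, ?_⟩
      rcases excess_cases (Weight.push (c := StarCompat) f hf t) (f j) with h | ⟨h1, h2, -⟩
      · exact absurd h hj.ne'
      · exact ⟨h1, h2⟩
    · push Not at h
      exact ⟨none, h⟩
  · rintro (_ | j)
    · refine ContinuousOn.congr (f := fun t => edgePoint e (toUnit
        ((1 + height (Weight.push (c := StarCompat) f hf t)) / 2))) ?_ fun t ht => ?_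
      -- At `.center` the distance is ignored by `cornerPoint`, so the value `0` is arbitrary.
      · exact (continuous_cornerPoint (.center : X.StarCorner e) hY continuous_const (b := fun _ => 0)).continuousOn
      · refine starRetract_of_nonpos _ fun c => ?_
        by_contra! hc
        obtain ⟨j, rfl⟩ := hpos t c hc
        exact absurd hc (ht j).not_gt
    · exact ContinuousOn.congr (continuous_cornerPoint (f j) hY
        (continuous_const.sub (hE (f j)))).continuousOn
        fun t ht => starRetract_of_nonneg _ (f j) ht.1 ht.2.1 ht.2.2

theorem weight_le_one_of_sum {w : Weight (AllCompat (α := Option Bool))} :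
    w.val none + w.val (some false) + w.val (some true) = 1 := by
  have := w.sum_eq Finset.univ (by simp)
  rw [Fintype.sum_option, Fintype.sum_bool] at this
  linarith

/-- The weights of one square and one endpoint exhaust `w'`. So the excess of the square is its
whole weight, and the height is the weight of the endpoint up to sign. -/
theorem height_excess_of_tri (s : X.S) (i t a : Bool) (w : Weight (AllCompat (α := Option Bool)))
    (w' : Weight (StarCompat (X := X) (e := X.side s (!i) a))) (h0 : w.val (some (!a)) = 0)
    (h1 : w'.val (.apex (t ^^ X.reversed s (!i) a)) = w.val (some a))
    (h2 : w'.val (.square s (!i) a rfl) = w.val none) :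
    height w' = sgn (t ^^ X.reversed s (!i) a) * w.val (some a) ∧
      excess w' (.square s (!i) a rfl) = w.val none ∧ w.val none + w.val (some a) = 1 := by
  have hsum := weight_le_one_of_sum (w := w)
  have hsum' : w.val none + w.val (some a) = 1 := by
    cases a <;> simp only [Bool.not_false, Bool.not_true] at h0 <;> linarith
  have hn : NonApex (.square s (!i) a rfl : X.StarCorner (X.side s (!i) a)) :=
    nonApex_square _ _ _ _
  have h3 : w'.val .center = 0 ∧ w'.val (.apex (!(t ^^ X.reversed s (!i) a))) = 0 := by
    classical
    have := w'.sum_le_one {.square s (!i) a rfl, .center, .apex (t ^^ X.reversed s (!i) a),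
      .apex (!(t ^^ X.reversed s (!i) a))}
    rw [Finset.sum_insert (by simp), Finset.sum_insert (by simp), Finset.sum_pair (by simp),
      h1, h2] at this
    have h4 := w'.nonneg .center
    have h5 := w'.nonneg (.apex (!(t ^^ X.reversed s (!i) a)))
    constructor <;> linarith
  have hY : height w' = sgn (t ^^ X.reversed s (!i) a) * w.val (some a) := by
    rw [height]
    have h4 := h3.2
    cases hb : (t ^^ X.reversed s (!i) a) <;> rw [hb] at h1 h4 <;>
      simp only [Bool.not_false, Bool.not_true] at h4 <;> simp [sgn, h1, h4]
  have hE : excess w' (.square s (!i) a rfl) = w.val none := by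
    have h4 := h3.2
    rw [excess_square, h2, squareSum, h3.1]
    cases hb : (t ^^ X.reversed s (!i) a) <;> rw [hb] at h1 h4 <;>
      simp only [Bool.not_false, Bool.not_true] at h4 <;> rw [h1, h4] <;> linarith
  exact ⟨hY, hE, hsum'⟩

/-- The point of a square with given barycentric coordinates in the triangle with corner `s*` and
opposite side `side s i t`. -/
noncomputable def trianglePoint (s : X.S) (i t : Bool) (w : Weight (AllCompat (α := Option Bool))) :
    X.toSquareComplex.Realization :=
  sqPoint s fun j =>
    if j = i then toUnit ((1 + (w.val (some true) - w.val (some false))) / 2)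
    else toUnit ((1 + sgn t * (1 - w.val none)) / 2)

theorem starRetract_tri (s : X.S) (i t a : Bool) (w : Weight (AllCompat (α := Option Bool)))
    (w' : Weight (StarCompat (X := X) (e := X.side s (!i) a))) (h0 : w.val (some (!a)) = 0)
    (h1 : w'.val (.apex (t ^^ X.reversed s (!i) a)) = w.val (some a))
    (h2 : w'.val (.square s (!i) a rfl) = w.val none) :
    starRetract w' = trianglePoint s i t w := by
  obtain ⟨hY, hE, hsum⟩ := height_excess_of_tri s i t a w w' h0 h1 h2
  have hn : NonApex (.square s (!i) a rfl : X.StarCorner (X.side s (!i) a)) :=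
    nonApex_square _ _ _ _
  rw [starRetract_of_nonneg w' (.square s (!i) a rfl) (by rw [hE]; exact w.nonneg _) hn (by simp),
    hE, hY]
  rw [cornerPoint_square, trianglePoint]
  congr 1
  funext j
  by_cases hj : j = i
  · subst hj
    simp only [if_true, Bool.eq_not_self, if_false]
    congr 3
    cases a <;> simp only [Bool.not_false, Bool.not_true] at h0 <;> simp [sgn, h0] <;> linarith
  · have hj' : j = !i := by cases i <;> cases j <;> simp_all
    subst hj'
    simp only [if_true, Bool.not_eq_self, if_false]
    congr 3
    rw [show 1 - w.val none = w.val (some a) by linarith]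
    cases X.reversed s (!i) a <;> cases t <;> simp [sgn]

theorem triangleSide (s : X.S) (i t : Bool) (w : Weight (AllCompat (α := Option Bool)))
    (w' : Weight (AllCompat (α := Bool))) (h0 : w.val none = 0)
    (h1 : ∀ a, w'.val (a ^^ X.reversed s i t) = w.val (some a)) :
    trianglePoint s i t w = edgePoint (X.side s i t) (toUnit (w'.val true)) := by
  have hsum := weight_le_one_of_sum (w := w)
  rw [h0, zero_add] at hsum
  have hlt := w.le_one (some true)
  have hnn := w.nonneg (some true)
  have e1 : (1 + (w.val (some true) - w.val (some false))) / 2 = w.val (some true) := by linarith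
  rw [trianglePoint, h0, sub_zero, mul_one, toUnit_sgn, e1, sqPoint_side]
  congr 1
  split_ifs with hr
  · have := h1 false
    rw [hr] at this
    simp only [Bool.false_xor] at this
    rw [this]
    ext
    rw [unitInterval.coe_symm_eq, coe_toUnit hnn hlt,
      coe_toUnit (w.nonneg _) (w.le_one _)]
    linarith
  · have := h1 true
    simp only [hr, Bool.xor_false] at this
    rw [this]

/-- The map from the simplexification to the square complex, on the charts. -/
noncomputable def retractMaps (X : VHComplex.{u}) : ChartMaps X X.toSquareComplex.Realization where
  onVert v := Quot.mk _ (.inl ⟨v, ()⟩)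
  onEdge e _ := edgePoint e (toUnit (1 / 2))
  onSquare s := sqPoint s fun _ => toUnit (1 / 2)
  onHor e _ w := edgePoint e (toUnit (w.val true))
  onTri s i t _ w := trianglePoint s i t w
  onStar e _ w := starRetract w
  continuous_onHor e he m f hf :=
    (continuous_edgePoint e).comp (continuous_projIcc.comp (Weight.continuous_push f hf true))
  continuous_onTri s i t h m f hf := by
    have hp := Weight.continuous_push (c := AllCompat) f hf
    refine (continuous_sqPoint s).comp (continuous_pi fun j => ?_)
    split_ifs
    · exact continuous_projIcc.comp
        ((continuous_const.add ((hp (some true)).sub (hp (some false)))).div_const 2)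
    · exact continuous_projIcc.comp ((continuous_const.add
        (continuous_const.mul (continuous_const.sub (hp none)))).div_const 2)
  continuous_onStar e he m f hf := continuous_starRetract f hf
  onHor_eq e he w b hb := by
    rw [← edgePoint_endPt]
    congr 1
    have hw : w.val true = (SquareComplex.endPt b : ℝ) := by
      cases b
      · rw [w.eq_zero_of_eq_one hb (by simp)]; simp [SquareComplex.endPt]
      · rw [hb]; simp [SquareComplex.endPt]
    rw [hw, toUnit_coe]
  onStar_apex e he w b hb := by
    rw [starRetract_of_nonpos]
    · rw [← edgePoint_endPt, ← toUnit_sgn]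
      congr 3
      have h := w.eq_zero_of_eq_one hb (b := .apex (!b)) (by simp)
      cases b <;> simp at h <;> simp [height, sgn, h, hb]
    · intro c
      have h1 := excess_le_val w c
      rcases excess_cases w c with h | ⟨h, -, -⟩
      · exact h.le
      · rwa [w.eq_zero_of_eq_one hb (h b)] at h1
  onStar_center e he w hw := by
    rw [starRetract_of_nonpos]
    · have hh : height w = 0 := by simp [height, w.eq_zero_of_eq_one hw]
      rw [hh, add_zero]
    · intro c
      have h1 := excess_le_val w c
      rcases excess_cases w c with h | ⟨-, h, -⟩
      · exact h.le
      · rwa [w.eq_zero_of_eq_one hw h] at h1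
  onStar_square e he w s i t h hw := by
    have hS : excess w (.square s i t h) = 1 := by
      rw [excess_square, hw, squareSum, w.eq_zero_of_eq_one hw (by simp),
        w.eq_zero_of_eq_one hw (by simp), w.eq_zero_of_eq_one hw (by simp)]
      norm_num
    have hY : height w = 0 := by
      rw [height, w.eq_zero_of_eq_one hw (by simp), w.eq_zero_of_eq_one hw (by simp), sub_zero]
    rw [starRetract_of_nonneg w (.square s i t h) (by rw [hS]; norm_num) (nonApex_square _ _ _ _)
      (by simp), hS, hY]
    simp [cornerPoint_square]
  onTri_star s i t h a w w' h0 h1 h2 := (starRetract_tri s i t a w w' h0 h1 h2).symm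
  onTri_hor s i t h w w' h0 h1 := triangleSide s i t w w' h0 h1

/-! ### The homotopy -/

/-- The straight line from a point of the star of `e*` to its retraction. -/
noncomputable def retractPath {e : X.E} (he : e ∈ X.vertical) (w : Weight (StarCompat (e := e))) :
    C(I, X.simplexification.Realization) where
  toFun s := (starChart e he).pt (w.mix (retract w) (retract_compat w) s)
  continuous_toFun := by
    classical
    refine (starChart e he).continuous_pt _
      (w.finite_support.toFinset ∪ (retract w).finite_support.toFinset) ?_ ?_
    · intro s a ha
      simp only [Finset.mem_union, Finite.mem_toFinset, mem_ofPred_eq, not_or, not_not] at ha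
      simp [Weight.mix, ha.1, ha.2]
    · intro a _
      simp only [Weight.mix]
      fun_prop

theorem retractPath_of_eq {e : X.E} (he : e ∈ X.vertical) (w : Weight (StarCompat (e := e)))
    (h : retract w = w) : retractPath he w = ContinuousMap.const I ((starChart e he).pt w) := by
  ext s
  refine congrArg (starChart e he).pt ?_
  ext a
  simp only [Weight.mix, h]
  ring

theorem continuous_retractPath {e : X.E} (he : e ∈ X.vertical) {m : ℕ}
    (f : Fin (m + 1) ↪ X.StarCorner e) (hf) :
    Continuous fun t => retractPath he (Weight.push (c := StarCompat) f hf t) := by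
  classical
  refine ContinuousMap.continuous_of_continuous_uncurry _ ?_
  -- Along the segments the support stays among the corners of the simplex and `e*`. The coordinate
  -- of `e*`, for which there is no direct formula, may be disregarded.
  refine (starChart e he).continuous_pt_of_ne (fun p : stdSimplex ℝ (Fin (m + 1)) × I =>
    (Weight.push (c := StarCompat) f hf p.1).mix _ (retract_compat _) p.2)
    (insert .center (Finset.univ.map f)) .center ?_ ?_
  · rintro ⟨t, s⟩ a ha
    simp only [Finset.mem_insert, Finset.mem_map, Finset.mem_univ, true_and, not_or,
      not_exists] at ha
    have h0 := Weight.push_of_notMem (c := StarCompat) f hf t ha.2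
    have h1 : (retract (Weight.push (c := StarCompat) f hf t)).val a = 0 := by
      cases a with
      | apex b => rw [retract_apex, h0]
      | center => exact absurd rfl ha.1
      | square s' i t' h =>
        rw [retract_square _ (nonApex_square _ _ _ _) (by simp), max_eq_left]
        exact h0 ▸ excess_le_val (Weight.push (c := StarCompat) f hf t) _
    simp [Weight.mix, h0, h1]
  · intro a _ ha
    have h0 : Continuous fun p : stdSimplex ℝ (Fin (m + 1)) × I =>
        (Weight.push (c := StarCompat) f hf p.1).val a :=
      (Weight.continuous_push f hf a).comp continuous_fst
    have h1 : Continuous fun p : stdSimplex ℝ (Fin (m + 1)) × I =>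
        (retract (Weight.push (c := StarCompat) f hf p.1)).val a := by
      cases a with
      | apex b => simpa only [retract_apex] using h0
      | center => exact absurd rfl ha
      | square s' i t' h =>
        simp only [retract_square _ (nonApex_square _ _ _ _) ha, excess_square, squareSum]
        have hp : ∀ c, Continuous fun p : stdSimplex ℝ (Fin (m + 1)) × I =>
            (Weight.push (c := StarCompat) f hf p.1).val c := fun c =>
          (Weight.continuous_push f hf c).comp continuous_fst
        exact continuous_const.max ((continuous_const.mul (hp _)).sub
          (((continuous_const.sub (hp _)).sub (hp _)).sub (hp _)))
    have h2 : Continuous fun p : stdSimplex ℝ (Fin (m + 1)) × I => (p.2 : ℝ) :=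
      continuous_subtype_val.comp continuous_snd
    exact ((continuous_const.sub h2).mul h0).add (h2.mul h1)

theorem retract_eq_of_eq_one {e : X.E} (w : Weight (StarCompat (e := e))) (c : X.StarCorner e)
    (hc : w.val c = 1) : retract w = w :=
  retract_eq_self w c fun _ _ _ hd => w.eq_zero_of_eq_one hc hd

/-- The homotopy from the identity of the simplexification to the composition of the retraction and
the subdivision, on the charts. -/
noncomputable def homotopyMaps (X : VHComplex.{u}) :
    ChartMaps X C(I, X.simplexification.Realization) where
  onVert v := .const I (vertPoint v)
  onEdge e he := .const I (point (K := X.simplexification) (.edge e he) (stdSimplex.vertex 0))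
  onSquare s := .const I (squarePoint s)
  onHor e he w := .const I ((horChart e he).pt w)
  onTri s i t h w := .const I ((triChart s i t h).pt w)
  onStar e he w := retractPath he w
  continuous_onHor e he m f hf := ContinuousMap.continuous_const'.comp
    ((horChart e he).continuous_pt _ Finset.univ (by simp) fun a _ => Weight.continuous_push f hf a)
  continuous_onTri s i t h m f hf := ContinuousMap.continuous_const'.comp
    ((triChart s i t h).continuous_pt _ Finset.univ (by simp)
      fun a _ => Weight.continuous_push f hf a)
  continuous_onStar e he m f hf := continuous_retractPath he f hf
  onHor_eq e he w b hb := by rw [horChart_pt_eq he w b hb]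
  onStar_apex e he w b hb := by
    rw [retractPath_of_eq he w (retract_eq_of_eq_one w _ hb), starChart_pt_apex he w b hb]
  onStar_center e he w hw := by
    rw [retractPath_of_eq he w (retract_eq_of_eq_one w _ hw)]
    exact congrArg _ (starChart_pt_of_eq_one he w _ hw _)
  onStar_square e he w s i t h hw := by
    rw [retractPath_of_eq he w (retract_eq_of_eq_one w _ hw), starChart_pt_square he w s i t h hw]
  onTri_star s i t h a w w' h0 h1 h2 := by
    rw [retractPath_of_eq, triChart_pt_star s i t h a w w' h0 h1 h2]
    refine retract_eq_self w' (.square s (!i) a rfl) fun d hd1 hd2 hd3 => ?_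
    classical
    have := w'.sum_le_one {d, .square s (!i) a rfl, .apex (t ^^ X.reversed s (!i) a)}
    rw [Finset.sum_insert (by simp [hd3, hd1 _]), Finset.sum_pair (by simp), h1, h2] at this
    have hsum := weight_le_one_of_sum (w := w)
    refine le_antisymm ?_ (w'.nonneg d)
    cases a <;> simp only [Bool.not_false, Bool.not_true] at h0 <;> linarith
  onTri_hor s i t h w w' h0 h1 := by rw [triChart_pt_hor s i t h w w' h0 h1]

theorem homotopy_zero (p : X.simplexification.Realization) :
    (homotopyMaps X).toContinuousMap p 0 = p := by
  refine realization_cases (motive := fun p => (homotopyMaps X).toContinuousMap p 0 = p)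
    (fun v => ?_) (fun e he w => ?_) (fun s i t h w => ?_) (fun e he w => ?_) p
  · rfl
  · rw [ChartMaps.map_hor]; rfl
  · rw [ChartMaps.map_tri]; rfl
  · rw [ChartMaps.map_star]
    refine congrArg (starChart e he).pt ?_
    ext a
    simp [Weight.mix]

/-- Height and distance describe the same point in the square (`cornerPoint`) and in the star
(`barWeight`). Hence `starRetract` followed by `subdivide` is `retract` in each star. -/
theorem subdivide_cornerPoint {e : X.E} (he : e ∈ X.vertical) (c : X.StarCorner e) (hc : NonApex c)
    {y b : ℝ} (hy : |y| ≤ b) (hb : b ≤ 1) (hb' : c = .center → b = 1) :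
    subdivide (cornerPoint c y b) = (starChart e he).pt (barWeight c hc y b) := by
  have h0 : 0 ≤ b := (abs_nonneg _).trans hy
  have hy' := abs_le.1 (hy.trans hb)
  cases c with
  | apex β => exact absurd rfl (hc β)
  | center =>
    obtain rfl := hb' rfl
    change edgeMap e _ = _
    rw [edgeMap, dif_pos he, coe_toUnit (by linarith) (by linarith)]
    congr 2
    ring
  | square s i t h =>
    cases h
    obtain rfl := eq_not_hdir he
    change squareMap s _ _ = _
    have hsb : |sgn t * b| = b := by rw [abs_sgn_mul, abs_of_nonneg h0]
    have hsb' := abs_le.1 (hsb.trans_le hb)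
    have e1 : 2 * ((1 + sgn t * b) / 2) - 1 = sgn t * b := by ring
    have e2 : ∀ z : ℝ, 2 * ((1 + z) / 2) - 1 = z := fun z => by ring
    simp only [if_true, Bool.eq_not_self, if_false]
    rw [coe_toUnit (by split_ifs <;> linarith) (by split_ifs <;> linarith),
      coe_toUnit (by linarith) (by linarith), e2, e2]
    have hr : |if X.reversed s (!hdir s) t then -y else y| = |y| := by
      split_ifs <;> simp
    rw [squareMap_star s t (by rw [hr, hsb]; exact hy) (by rw [hsb]; exact hb) (by rw [hsb]),
      starPart, hsb]
    congr 2
    cases X.reversed s (!hdir s) t <;> simp [sgn]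

theorem homotopy_one (p : X.simplexification.Realization) :
    (homotopyMaps X).toContinuousMap p 1 = subdivide ((retractMaps X).toContinuousMap p) := by
  refine realization_cases (motive := fun p => (homotopyMaps X).toContinuousMap p 1 =
      subdivide ((retractMaps X).toContinuousMap p))
    (fun v => ?_) (fun e he w => ?_) (fun s i t h w => ?_) (fun e he w => ?_) p
  · rfl
  · rw [ChartMaps.map_hor, ChartMaps.map_hor]
    change (horChart e he).pt w = edgeMap e _
    rw [edgeMap, dif_neg he]
    congr 1
    have := w.sum_eq Finset.univ (by simp)
    rw [Fintype.sum_bool] at this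
    ext b
    simp only [horWeight, coe_toUnit (w.nonneg _) (w.le_one _)]
    cases b
    · simp; linarith
    · simp
  · rw [ChartMaps.map_tri, ChartMaps.map_tri]
    change (triChart s i t h).pt w = squareMap s _ _
    obtain rfl := eq_hdir h
    have hsum := weight_le_one_of_sum (w := w)
    have n0 := w.nonneg none
    have n1 := w.nonneg (some true)
    have n2 := w.nonneg (some false)
    have ha : |sgn t * (1 - w.val none)| = 1 - w.val none := by
      rw [abs_sgn_mul, abs_of_nonneg (by linarith)]
    have ha' := abs_le.1 (ha.trans_le (by linarith : _ ≤ (1 : ℝ)))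
    have hb : |w.val (some true) - w.val (some false)| ≤ 1 - w.val none := by
      rw [abs_le]; constructor <;> linarith
    have e2 : ∀ z : ℝ, 2 * ((1 + z) / 2) - 1 = z := fun z => by ring
    simp only [if_true, Bool.not_eq_self, if_false]
    rw [coe_toUnit (by linarith) (by linarith), coe_toUnit (by linarith) (by linarith), e2, e2,
      squareMap_tri s t (by rwa [ha]) (by rw [ha]), triPart, ha]
    congr 1
    ext x
    rcases x with _ | _ | _
    · rw [triWeight_none (by linarith) (by linarith)]; ring
    · rw [triWeight_some hb (by linarith)]; simp [sgn]; linarith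
    · rw [triWeight_some hb (by linarith)]; simp [sgn]; linarith
  · rw [ChartMaps.map_star, ChartMaps.map_star]
    refine Eq.trans ?_ (subdivide_cornerPoint he _ (nonApex_dominant w) (abs_height_le w _)
      (by linarith [excess_dominant_nonneg w]) ?_).symm
    · refine congrArg (starChart e he).pt ?_
      ext a
      simp [Weight.mix, retract]
    · intro h
      rw [h, show excess w (.center : X.StarCorner e) = 0 from rfl, sub_zero]

/-- The simplexification of a simply connected `VH`-complex is simply connected. -/
theorem simplyConnectedSpace_simplexification [SimplyConnectedSpace X.toSquareComplex.Realization] :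
    SimplyConnectedSpace X.simplexification.Realization :=
  SimplyConnectedSpace.of_homotopy_comp subdivide (retractMaps X).toContinuousMap
    { toFun := fun p => (homotopyMaps X).toContinuousMap p.2 p.1
      -- A map into `C(I, _)` need only be continuous on each simplex. As `I` is locally compact, it
      -- uncurries to a jointly continuous map, so no product of a quotient map with `I` has to be
      -- examined.
      continuous_toFun := (ContinuousMap.continuous_uncurry_of_continuous
        (homotopyMaps X).toContinuousMap).comp continuous_swap
      map_zero_left := homotopy_zero
      map_one_left := homotopy_one }

end VHComplex

/-! ### A criterion for flagness -/

namespace GenSimplicialComplex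

variable {K : GenSimplicialComplex.{u}}

theorem emb_eq_pointEmb {n : ℕ} (θ : Fin (0 + 1) ↪ Fin (n + 1)) : θ = pointEmb (θ 0) := by
  ext1 j
  exact congrArg θ (Subsingleton.elim (α := Fin 1) _ _)

theorem vertex_face {m n : ℕ} (θ : Fin (m + 1) ↪ Fin (n + 1)) (x : K.simplex n) (j : Fin (m + 1)) :
    K.vertex (K.face θ x) j = K.vertex x (θ j) := by
  rw [vertex, vertex, K.face_comp]
  rfl

/-- A complex is flag if its simplices have distinct corners, are determined by them, and each
clique spans a simplex. -/
theorem isFlag_of_vertex (hinj : ∀ n (x : K.simplex n), Function.Injective (K.vertex x))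
    (huniq : ∀ n (x y : K.simplex n), (∀ j, K.vertex x j = K.vertex y j) → x = y)
    (hspan : ∀ (n : ℕ) (p : Fin (n + 1) → K.simplex 0), Function.Injective p →
      (∀ i j, i ≠ j → K.Adj (p i) (p j)) → ∃ x : K.simplex n, ∀ i, K.vertex x i = p i) :
    K.IsFlag := by
  refine ⟨⟨fun x h => absurd (hinj 1 x h) (by decide), fun n hn x y hxy => ?_⟩, hspan⟩
  -- Since `1 ≤ n`, vertices are proper faces, so equal boundaries have the same vertices. The
  -- resulting `k` is the required reordering of corners.
  have h : ∀ j, ∃ k, K.vertex x k = K.vertex y j := by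
    intro j
    obtain ⟨θ, hθ⟩ := (hxy 0 hn (K.vertex y j)).2 ⟨pointEmb j, rfl⟩
    refine ⟨θ 0, ?_⟩
    rw [← hθ, vertex, ← emb_eq_pointEmb]
  choose k hk using h
  refine ⟨⟨k, fun a b hab => hinj n y ?_⟩, huniq _ _ _ fun j => ?_⟩
  · rw [← hk, ← hk, hab]
  · rw [vertex_face]
    exact hk j

end GenSimplicialComplex

/-! ### Graphs that consist of cliques or suspensions, connected by some further edges -/

/-- A graph whose vertices are partly distributed to bases. Distinct vertices with the same base
are adjacent unless they are opposite; there are further adjacencies `T`. -/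
structure ClusterGraph {L B : Type*} (base : L → Option B) (opp T : L → L → Prop) : Prop where
  opp_symm : ∀ a b, opp a b → opp b a
  T_symm : ∀ a b, T a b → T b a
  T_unique : ∀ a b c, base a ≠ none → T a b → T a c → b = c
  T_unique_of_none : ∀ a b c, base a = none → T a b → T a c → base b = base c → b = c
  base_ne : ∀ a b, T a b → base a ≠ base b
  eq_or_opp_of_T : ∀ a a' b b', base a ≠ none → base a = base b → T a a' → T b b' →
    base b' ≠ none → a = b ∨ opp a b
  eq_or_eq_of_opp : ∀ a b c d, base a = base c → opp a b → opp c d → a = c ∨ a = d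

namespace ClusterGraph

variable {L B : Type*} {base : L → Option B} {opp T : L → L → Prop}

/-- Adjacency of vertices with the same base. -/
def BaseAdj (base : L → Option B) (opp : L → L → Prop) (a b : L) : Prop :=
  base a ≠ none ∧ base a = base b ∧ a ≠ b ∧ ¬ opp a b

theorem T_of_none {a b : L} (ha : base a = none) (hab : BaseAdj base opp a b ∨ T a b) : T a b :=
  hab.resolve_left fun h' => h'.1 ha

variable (h : ClusterGraph base opp T)

include h

theorem baseAdj_symm {a b : L} (hab : BaseAdj base opp a b) : BaseAdj base opp b a :=
  ⟨hab.2.1 ▸ hab.1, hab.2.1.symm, hab.2.2.1.symm, fun ho => hab.2.2.2 (h.opp_symm _ _ ho)⟩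

theorem adj_symm {a b : L} (hab : BaseAdj base opp a b ∨ T a b) : BaseAdj base opp b a ∨ T b a :=
  hab.imp h.baseAdj_symm (h.T_symm a b)

theorem baseAdj_of_T_ne {a b c : L} (hab : T a b) (hb : base b ≠ none) (hac : a ≠ c)
    (hbc : BaseAdj base opp b c ∨ T b c) : BaseAdj base opp b c :=
  hbc.resolve_right fun hT => hac (h.T_unique b a c hb (h.T_symm _ _ hab) hT)

/-- If `ab` is a further edge and `b` has a base, then `bc` stays in that base, because `b` has no
second further edge. Either `a` has no base and sends two further edges into one base, or `ac` stays
in the base of `a` and the bases of `a` and `b` coincide; both are impossible. -/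
theorem not_T_of_triangle {a b c : L} (hab : T a b) (hac : a ≠ c) (hbc : b ≠ c)
    (hac' : BaseAdj base opp a c ∨ T a c) (hbc' : BaseAdj base opp b c ∨ T b c) : False := by
  have key : ∀ {a b c : L}, T a b → a ≠ c → b ≠ c → (BaseAdj base opp a c ∨ T a c) →
      (BaseAdj base opp b c ∨ T b c) → base b ≠ none → False := by
    intro a b c hab hac hbc hac' hbc' hb
    have hbc1 := h.baseAdj_of_T_ne hab hb hac hbc'
    by_cases ha : base a = none
    · exact hbc (h.T_unique_of_none a b c ha hab (T_of_none ha hac') hbc1.2.1)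
    · have hac1 := h.baseAdj_of_T_ne (h.T_symm _ _ hab) ha hbc hac'
      exact h.base_ne a b hab (hac1.2.1.trans hbc1.2.1.symm)
  -- By `base_ne` at least one end of the further edge has a base, and the configuration can be
  -- reversed.
  by_cases hb : base b = none
  · exact key (h.T_symm _ _ hab) hbc hac hbc' hac' fun ha => h.base_ne a b hab (ha.trans hb.symm)
  · exact key hab hac hbc hac' hbc' hb

/-- If `x` and `y` have the same base and are adjacent, and further edges lead away from both of
them, then they both lead to vertices without base. -/
theorem not_T_of_baseAdj {x y x' y' : L} (hxy : BaseAdj base opp x y) (hx : T x x') (hy : T y y')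
    (hne : base x' ≠ none ∨ base y' ≠ none) : False := by
  rcases hne with hne | hne
  · have hyx := h.baseAdj_symm hxy
    rcases h.eq_or_opp_of_T y y' x x' hyx.1 hyx.2.1 hy hx hne with h' | h'
    · exact hyx.2.2.1 h'
    · exact hyx.2.2.2 h'
  · rcases h.eq_or_opp_of_T x x' y y' hxy.1 hxy.2.1 hx hy hne with h' | h'
    · exact hxy.2.2.1 h'
    · exact hxy.2.2.2 h'

/-- Beyond the argument for triangles, `cd` may be a further edge as well. If `a` has a base, then
`b` and `c` would be adjacent in one base with further edges leaving both, against
`not_T_of_baseAdj`. Diagonals are permitted here. -/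
theorem not_T_of_square {a b c d : L} (hab : T a b) (hbc : BaseAdj base opp b c ∨ T b c)
    (hcd : BaseAdj base opp c d ∨ T c d) (hda : BaseAdj base opp d a ∨ T d a) (hac : a ≠ c)
    (hbd : b ≠ d) : False := by
  have key : ∀ {a b c d : L}, T a b → (BaseAdj base opp b c ∨ T b c) →
      (BaseAdj base opp c d ∨ T c d) → (BaseAdj base opp d a ∨ T d a) → a ≠ c → b ≠ d →
      base b ≠ none → False := by
    intro a b c d hab hbc hcd hda hac hbd hb
    have hbc1 := h.baseAdj_of_T_ne hab hb hac hbc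
    have hc : base c ≠ none := hbc1.2.1 ▸ hbc1.1
    by_cases ha : base a = none
    · have had := T_of_none ha (h.adj_symm hda)
      have hd : base d ≠ none := fun hd => h.base_ne a d had (ha.trans hd.symm)
      have hdc := h.baseAdj_of_T_ne had hd hac (h.adj_symm hcd)
      exact hbd (h.T_unique_of_none a b d ha hab had (hbc1.2.1.trans hdc.2.1.symm))
    · have had := h.baseAdj_of_T_ne (h.T_symm _ _ hab) ha hbd (h.adj_symm hda)
      rcases hcd with hcd | hcd
      · exact h.base_ne a b hab (had.2.1.trans (hcd.2.1.symm.trans hbc1.2.1.symm))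
      · exact h.not_T_of_baseAdj hbc1 (h.T_symm _ _ hab) hcd (.inl ha)
  by_cases hb : base b = none
  · exact key (h.T_symm _ _ hab) (h.adj_symm hda) (h.adj_symm hcd) (h.adj_symm hbc) hbd hac
      fun ha => h.base_ne a b hab (ha.trans hb.symm)
  · exact key hab hbc hcd hda hac hbd hb

/-- Let `b` have a base. If `a` has none, `bc` and `de` lie within bases, and `cd` would either
merge these, so that `b = e`, or be a further edge between vertices with bases, against
`not_T_of_baseAdj`. If `a` has a base, then `bc` and `ea` lie in different bases; a further edge
`cd` or `de` is again excluded by `not_T_of_baseAdj`, and without one the bases would agree. -/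
theorem not_T_of_pentagon {a b c d e : L} (hab : T a b) (hbc : BaseAdj base opp b c ∨ T b c)
    (hcd : BaseAdj base opp c d ∨ T c d) (hde : BaseAdj base opp d e ∨ T d e)
    (hea : BaseAdj base opp e a ∨ T e a) (hac : a ≠ c) (hbe : b ≠ e) (had' : a ≠ d)
    (hbd' : b ≠ d) : False := by
  have key : ∀ {a b c d e : L}, T a b → (BaseAdj base opp b c ∨ T b c) →
      (BaseAdj base opp c d ∨ T c d) → (BaseAdj base opp d e ∨ T d e) →
      (BaseAdj base opp e a ∨ T e a) → a ≠ c → b ≠ e → a ≠ d → b ≠ d →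
      base b ≠ none → False := by
    intro a b c d e hab hbc hcd hde hea hac hbe had' hbd' hb
    have hbc1 := h.baseAdj_of_T_ne hab hb hac hbc
    have hc : base c ≠ none := hbc1.2.1 ▸ hbc1.1
    by_cases ha : base a = none
    · have hae := T_of_none ha (h.adj_symm hea)
      have he : base e ≠ none := fun he => h.base_ne a e hae (ha.trans he.symm)
      have hed := h.baseAdj_of_T_ne hae he had' (h.adj_symm hde)
      have hd : base d ≠ none := hed.2.1 ▸ hed.1
      rcases hcd with hcd | hcd
      · exact hbe (h.T_unique_of_none a b e ha hab hae
          (hbc1.2.1.trans (hcd.2.1.trans hed.2.1.symm)))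
      · exact h.not_T_of_baseAdj hbc1 (h.T_symm _ _ hab) hcd (.inr hd)
    · have hae := h.baseAdj_of_T_ne (h.T_symm _ _ hab) ha hbe (h.adj_symm hea)
      rcases hcd with hcd | hcd
      · rcases hde with hde | hde
        · exact h.base_ne a b hab (hae.2.1.trans
            (hde.2.1.symm.trans (hcd.2.1.symm.trans hbc1.2.1.symm)))
        · exact h.not_T_of_baseAdj hae hab (h.T_symm _ _ hde) (.inl hb)
      · exact h.not_T_of_baseAdj hbc1 (h.T_symm _ _ hab) hcd (.inl ha)
  by_cases hb : base b = none
  · exact key (h.T_symm _ _ hab) (h.adj_symm hea) (h.adj_symm hde) (h.adj_symm hcd)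
      (h.adj_symm hbc) hbe hac hbd' had' fun ha => h.base_ne a b hab (ha.trans hb.symm)
  · exact key hab hbc hcd hde hea hac hbe had' hbd' hb

/-- All edges lie in one base, where distinct vertices fail to be adjacent only if they are
opposite. Two missing diagonals would be two opposite pairs in one base. -/
theorem not_square {a b c d : L} (hab : BaseAdj base opp a b ∨ T a b)
    (hbc : BaseAdj base opp b c ∨ T b c) (hcd : BaseAdj base opp c d ∨ T c d)
    (hda : BaseAdj base opp d a ∨ T d a) (hac : a ≠ c) (hbd : b ≠ d)
    (hac' : ¬ BaseAdj base opp a c) (hbd' : ¬ BaseAdj base opp b d) : False := by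
  have h1 := hab.resolve_right fun hT => h.not_T_of_square hT hbc hcd hda hac hbd
  have h2 := hbc.resolve_right fun hT => h.not_T_of_square hT hcd hda hab hbd hac.symm
  have h3 := hcd.resolve_right fun hT => h.not_T_of_square hT hda hab hbc hac.symm hbd.symm
  have h4 := hda.resolve_right fun hT => h.not_T_of_square hT hab hbc hcd hbd.symm hac
  have o1 : opp a c := by
    by_contra ho
    exact hac' ⟨h1.1, h1.2.1.trans h2.2.1, hac, ho⟩
  have o2 : opp b d := by
    by_contra ho
    exact hbd' ⟨h2.1, h2.2.1.trans h3.2.1, hbd, ho⟩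
  rcases h.eq_or_eq_of_opp a c b d h1.2.1 o1 o2 with h' | h'
  · exact h1.2.2.1 h'
  · exact h4.2.2.1 h'.symm

/-- Three consecutive edges in one base suffice: the missing diagonals `ac` and `bd` would be
different opposite pairs in it. -/
theorem not_pentagon {a b c d e : L} (hab : BaseAdj base opp a b ∨ T a b)
    (hbc : BaseAdj base opp b c ∨ T b c) (hcd : BaseAdj base opp c d ∨ T c d)
    (hde : BaseAdj base opp d e ∨ T d e) (hea : BaseAdj base opp e a ∨ T e a)
    (hac : a ≠ c) (hbd : b ≠ d) (hce : c ≠ e) (hda : d ≠ a) (heb : e ≠ b)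
    (hac' : ¬ BaseAdj base opp a c) (hbd' : ¬ BaseAdj base opp b d) : False := by
  have h1 := hab.resolve_right fun hT =>
    h.not_T_of_pentagon hT hbc hcd hde hea hac heb.symm hda.symm hbd
  have h2 := hbc.resolve_right fun hT =>
    h.not_T_of_pentagon hT hcd hde hea hab hbd hac.symm heb.symm hce
  have h3 := hcd.resolve_right fun hT =>
    h.not_T_of_pentagon hT hde hea hab hbc hce hbd.symm hac.symm hda
  have o1 : opp a c := by
    by_contra ho
    exact hac' ⟨h1.1, h1.2.1.trans h2.2.1, hac, ho⟩
  have o2 : opp b d := by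
    by_contra ho
    exact hbd' ⟨h2.1, h2.2.1.trans h3.2.1, hbd, ho⟩
  rcases h.eq_or_eq_of_opp a c b d h1.2.1 o1 o2 with h' | h'
  · exact h1.2.2.1 h'
  · exact hda h'.symm

end ClusterGraph

namespace VHComplex

open GenSimplicialComplex

variable {X : VHComplex.{u}}

/-! ### Labels -/

/-- The corners of all stars, without reference to a fixed edge. -/
inductive Code (X : VHComplex.{u}) : Type u
  | apex (b : Bool)
  | center
  | square (s : X.S) (i t : Bool)

/-- The corner of a star, without reference to the edge. -/
def StarCorner.code {e : X.E} : X.StarCorner e → Code X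
  | .apex b => .apex b
  | .center => .center
  | .square s i t _ => .square s i t

theorem StarCorner.code_injective {e : X.E} :
    Function.Injective (StarCorner.code : X.StarCorner e → Code X) := by
  intro x y h
  cases x <;> cases y <;> simp_all [StarCorner.code]

/-- Codes do not depend on `e`, so embeddings into different types `StarCorner e` can be compared by
ordinary equalities. -/
theorem star_eq_iff {n : ℕ} {e e' : X.E} {he : e ∈ X.vertical} {he' : e' ∈ X.vertical}
    {f : Fin (n + 2) ↪ X.StarCorner e} {f' : Fin (n + 2) ↪ X.StarCorner e'} {hf : Spans f}
    {hf' : Spans f'} : OrderedSimplex.star e he f hf = .star e' he' f' hf' ↔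
      e = e' ∧ ∀ j, (f j).code = (f' j).code := by
  constructor
  · intro h
    cases h
    exact ⟨rfl, fun _ => rfl⟩
  · rintro ⟨rfl, h⟩
    obtain rfl : f = f' := by
      ext1 j
      exact StarCorner.code_injective (h j)
    rfl

/-- A description of an edge of the simplexification. -/
inductive Label (X : VHComplex.{u}) : Type u
  | hor (e : X.E) (b : Bool)
  | seg (e : X.E) (c c' : Code X)

/-- The description of an edge of the simplexification. -/
def label : X.OrderedSimplex 1 → Label X
  | .hor e _ b => .hor e b
  | .star e _ f _ => .seg e (f 0).code (f 1).code

theorem label_injective : Function.Injective (label : X.OrderedSimplex 1 → Label X) := by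
  intro x y h
  cases x <;> cases y
  · simp only [label, Label.hor.injEq] at h
    obtain ⟨rfl, rfl⟩ := h
    rfl
  · simp [label] at h
  · simp [label] at h
  · simp only [label, Label.seg.injEq] at h
    refine star_eq_iff.2 ⟨h.1, fun j => ?_⟩
    fin_cases j
    exacts [h.2.1, h.2.2]

/-! ### The edges of a simplex at its first corner -/

/-- The edge of a simplex from its first corner to another one. -/
def edgeFrom {n : ℕ} (x : X.OrderedSimplex (n + 1)) (j : Fin (n + 1)) : X.OrderedSimplex 1 :=
  simplexFace (consEmb (pointEmb j)) x

theorem edgeFrom_zero (x : X.OrderedSimplex 1) (j : Fin (0 + 1)) : edgeFrom x j = x := by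
  have h : consEmb (pointEmb j) = Function.Embedding.refl (Fin (1 + 1)) := by
    ext1 a
    fin_cases a
    · rfl
    · exact congrArg Fin.succ (Subsingleton.elim (α := Fin 1) j 0)
  rw [edgeFrom, h, simplexFace_id]

theorem vertex_edgeFrom {n : ℕ} (x : X.OrderedSimplex (n + 1)) (j : Fin (n + 1)) :
    X.simplexification.vertex (edgeFrom x j) 0 = X.simplexification.vertex (n := n + 1) x 0 :=
  vertex_face (K := X.simplexification) (consEmb (pointEmb j)) x 0

theorem label_edgeFrom_star {n : ℕ} (e : X.E) (he : e ∈ X.vertical)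
    (f : Fin (n + 2) ↪ X.StarCorner e) (hf : Spans f) (j : Fin (n + 1)) :
    label (edgeFrom (.star e he f hf) j) = .seg e (f 0).code (f j.succ).code := rfl

theorem edgeFrom_tri (s : X.S) (i t : Bool) (h : X.side s i t ∉ X.vertical)
    (f : Fin 3 ↪ Option Bool) (j : Fin 2) :
    edgeFrom (.tri s i t h f) j = triEdge s i t h (f 0) (f j.succ) := rfl

/-- The label of the segment from `s*` to a corner of `s`. -/
def outLabel (s : X.S) (i t a : Bool) : Label X :=
  .seg (X.side s (!i) a) (.square s (!i) a) (.apex (t ^^ X.reversed s (!i) a))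

/-- The label of the segment from a corner of `s` to `s*`. -/
def inLabel (s : X.S) (i t a : Bool) : Label X :=
  .seg (X.side s (!i) a) (.apex (t ^^ X.reversed s (!i) a)) (.square s (!i) a)

/-- The label of the horizontal edge from a corner of `s`. -/
def horLabel (s : X.S) (i t a : Bool) : Label X :=
  .hor (X.side s i t) (a ^^ X.reversed s i t)

theorem label_triEdge (s : X.S) (i t : Bool) (h : X.side s i t ∉ X.vertical) :
    (∀ a, label (triEdge s i t h none (some a)) = outLabel s i t a) ∧
    (∀ a, label (triEdge s i t h (some a) none) = inLabel s i t a) ∧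
    ∀ a b, label (triEdge s i t h (some a) (some b)) = horLabel s i t a :=
  ⟨fun _ => rfl, fun _ => rfl, fun _ _ => rfl⟩

/-- The edges with the two labels lie in a triangle with a horizontal side. -/
inductive TriAdj : Label X → Label X → Prop
  | out (s : X.S) (i t a : Bool) (h : X.side s i t ∉ X.vertical) :
      TriAdj (outLabel s i t a) (outLabel s i t !a)
  | inHor (s : X.S) (i t a : Bool) (h : X.side s i t ∉ X.vertical) :
      TriAdj (inLabel s i t a) (horLabel s i t a)
  | horIn (s : X.S) (i t a : Bool) (h : X.side s i t ∉ X.vertical) :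
      TriAdj (horLabel s i t a) (inLabel s i t a)

/-- The star that contains an edge, with the first corner of the edge. -/
def base : Label X → Option (X.E × Code X)
  | .hor _ _ => none
  | .seg e c _ => some (e, c)

/-- The edges lead to the two endpoints of a vertical edge. -/
def Opp (l l' : Label X) : Prop :=
  ∃ e c b, l = .seg e c (.apex b) ∧ l' = .seg e c (.apex !b)

theorem triAdj_symm (l l' : Label X) (h : TriAdj l l') : TriAdj l' l := by
  cases h with
  | out s i t a h =>
    have := TriAdj.out s i t (!a) h
    rwa [Bool.not_not] at this
  | inHor s i t a h => exact .horIn s i t a h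
  | horIn s i t a h => exact .inHor s i t a h

theorem outLabel_injective {s s' : X.S} {i i' t t' a a' : Bool}
    (h : outLabel s i t a = outLabel s' i' t' a') : s = s' ∧ i = i' ∧ t = t' ∧ a = a' := by
  simp only [outLabel, Label.seg.injEq, Code.square.injEq, Code.apex.injEq] at h
  obtain ⟨-, ⟨rfl, hi, rfl⟩, ht⟩ := h
  obtain rfl := Bool.not_inj hi
  exact ⟨rfl, rfl, by simpa using ht, rfl⟩

theorem inLabel_injective {s s' : X.S} {i i' t t' a a' : Bool}
    (h : inLabel s i t a = inLabel s' i' t' a') : s = s' ∧ i = i' ∧ t = t' ∧ a = a' := by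
  simp only [inLabel, Label.seg.injEq, Code.square.injEq, Code.apex.injEq] at h
  obtain ⟨-, ht, rfl, hi, rfl⟩ := h
  obtain rfl := Bool.not_inj hi
  exact ⟨rfl, rfl, by simpa using ht, rfl⟩

/-- The cells at a corner of a square determine the square and the corner, if the square complex is
nonpositively curved. -/
theorem eq_of_corner_edges (hX : X.toSquareComplex.IsNonpositivelyCurved) {s s' : X.S}
    {i i' t t' a a' : Bool} (h : X.side s i t ∉ X.vertical) (h' : X.side s' i' t' ∉ X.vertical)
    (hh : horLabel s i t a = horLabel s' i' t' a')
    (hv : base (inLabel s i t a) = base (inLabel s' i' t' a')) :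
    inLabel s i t a = inLabel s' i' t' a' := by
  simp only [horLabel, Label.hor.injEq] at hh
  simp only [base, inLabel, Option.some.injEq, Prod.mk.injEq, Code.apex.injEq] at hv
  by_contra hne
  let d : ZMod 2 → X.OrientedEdge := fun j => if j = 0 then (X.side s i t, a ^^ X.reversed s i t)
    else (X.side s (!i) a, t ^^ X.reversed s (!i) a)
  let q : ZMod 2 → X.Corner := fun j => if j = 0 then (s, fun k => if k = i then a else t)
    else (s', fun k => if k = i' then a' else t')
  have hjoin : ∀ (s : X.S) (i t a : Bool), X.Joins (s, fun k => if k = i then a else t)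
      (X.side s i t, a ^^ X.reversed s i t) (X.side s (!i) a, t ^^ X.reversed s (!i) a) := by
    intro s i t a
    cases i
    · exact .inl ⟨rfl, rfl⟩
    · exact .inr ⟨rfl, rfl⟩
  -- The two corners join the same horizontal oriented edge to the same vertical one. If distinct,
  -- they form an embedded cycle of length `2` in the link of their common vertex. This is the only
  -- place where nonpositive curvature enters.
  refine hX (X.ends (X.side s i t) (a ^^ X.reversed s i t)) 2 (by norm_num) (by norm_num)
    ⟨d, q, ?_, ?_, ?_, ?_⟩
  · intro j
    fin_cases j
    · rfl
    · exact corner_vertex s i t a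
  · have : d 0 ≠ d 1 := by
      intro h0
      have : X.side s i t = X.side s (!i) a := congrArg Prod.fst h0
      exact h (this ▸ side_not_mem h a)
    intro j k hjk
    fin_cases j <;> fin_cases k
    · rfl
    · exact absurd hjk this
    · exact absurd hjk.symm this
    · rfl
  · have : q 0 ≠ q 1 := by
      intro h0
      have h1 : s = s' := congrArg Prod.fst h0
      have h2 : (fun k => if k = i then a else t) = fun k => if k = i' then a' else t' :=
        congrArg Prod.snd h0
      subst h1
      obtain rfl : i = i' := (eq_hdir h).trans (eq_hdir h').symm
      have h3 := congrFun h2 i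
      have h4 := congrFun h2 (!i)
      simp only [if_true, Bool.not_eq_self, if_false] at h3 h4
      exact hne (by rw [h3, h4])
    intro j k hjk
    fin_cases j <;> fin_cases k
    · rfl
    · exact absurd hjk this
    · exact absurd hjk.symm this
    · rfl
  · intro j
    fin_cases j
    · exact hjoin s i t a
    · have := hjoin s' i' t' a'
      rw [← hh.1, ← hh.2, ← hv.1, ← hv.2] at this
      exact this.symm

/-- The label of a segment between `s*` and a corner of `s` contains the square and both coordinates
of the corner, hence determines its further edge. A horizontal edge has one further edge for each
corner of a square at its start, and two of them into the same base coincide by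
`eq_of_corner_edges`. Further edges between vertices with bases occur only at `s*`; those leaving
the same base belong to the two horizontal sides of `s`, so they start at opposite poles. -/
theorem clusterGraph (hX : X.toSquareComplex.IsNonpositivelyCurved) :
    ClusterGraph (base (X := X)) Opp TriAdj where
  opp_symm := by
    rintro _ _ ⟨e, c, b, rfl, rfl⟩
    exact ⟨e, c, !b, rfl, by rw [Bool.not_not]⟩
  T_symm := triAdj_symm
  T_unique := by
    intro l l1 l2 hl h1 h2
    cases h1 with
    | out s i t a h =>
      generalize hm : outLabel s i t a = m at h2
      cases h2 with
      | out s' i' t' a' h' =>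
        obtain ⟨rfl, rfl, rfl, rfl⟩ := outLabel_injective hm
        rfl
      | inHor s' i' t' a' h' => simp [outLabel, inLabel] at hm
      | horIn s' i' t' a' h' => simp [outLabel, horLabel] at hm
    | inHor s i t a h =>
      generalize hm : inLabel s i t a = m at h2
      cases h2 with
      | out s' i' t' a' h' => simp [outLabel, inLabel] at hm
      | inHor s' i' t' a' h' =>
        obtain ⟨rfl, rfl, rfl, rfl⟩ := inLabel_injective hm
        rfl
      | horIn s' i' t' a' h' => simp [inLabel, horLabel] at hm
    | horIn s i t a h => exact absurd rfl hl
  T_unique_of_none := by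
    intro l l1 l2 hl h1 h2 h12
    cases h1 with
    | out s i t a h => simp [base, outLabel] at hl
    | inHor s i t a h => simp [base, inLabel] at hl
    | horIn s i t a h =>
      generalize hm : horLabel s i t a = m at h2
      cases h2 with
      | out s' i' t' a' h' => simp [outLabel, horLabel] at hm
      | inHor s' i' t' a' h' => simp [inLabel, horLabel] at hm
      | horIn s' i' t' a' h' => exact eq_of_corner_edges hX h h' hm h12
  base_ne := by
    intro l l' h hb
    cases h with
    | out s i t a h => simp [base, outLabel] at hb
    | inHor s i t a h => simp [base, inLabel, horLabel] at hb
    | horIn s i t a h => simp [base, inLabel, horLabel] at hb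
  eq_or_opp_of_T := by
    intro l l' m m' hl hlm h1 h2 hm'
    cases h2 with
    | out s i t a h =>
      cases h1 with
      | out s' i' t' a' h' =>
        simp only [base, outLabel, Option.some.injEq, Prod.mk.injEq, Code.square.injEq] at hlm
        obtain ⟨-, rfl, hi, rfl⟩ := hlm
        obtain rfl := Bool.not_inj hi
        by_cases ht : t' = t
        · exact .inl (by rw [ht])
        · obtain rfl : t = !t' := by cases t <;> cases t' <;> simp_all
          exact .inr ⟨_, _, _, rfl, by rw [outLabel, Bool.not_xor]⟩
      | inHor s' i' t' a' h' => simp [base, outLabel, inLabel] at hlm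
      | horIn s' i' t' a' h' => exact absurd rfl hl
    | inHor s i t a h => exact absurd rfl hm'
    | horIn s i t a h => exact absurd hlm hl
  eq_or_eq_of_opp := by
    rintro _ _ _ _ hac ⟨e, c, b, rfl, rfl⟩ ⟨e', c', b', rfl, rfl⟩
    simp only [base, Option.some.injEq, Prod.mk.injEq] at hac
    obtain ⟨rfl, rfl⟩ := hac
    cases b <;> cases b' <;> simp

/-! ### Links in the simplexification -/

/-- A simplex with two edges at its first corner lies in a star, where `Spans` prevents both poles
from occurring, or is a triangle over a horizontal side. These are the two alternatives. -/
theorem edgeFrom_cases {n : ℕ} (x : X.OrderedSimplex (n + 1)) (j k : Fin (n + 1)) (hjk : j ≠ k) :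
    ClusterGraph.BaseAdj base Opp (label (edgeFrom x j)) (label (edgeFrom x k)) ∨
      TriAdj (label (edgeFrom x j)) (label (edgeFrom x k)) := by
  cases x with
  | hor e he b => exact absurd (Subsingleton.elim (α := Fin 1) j k) hjk
  | tri s i t h f =>
    right
    rw [edgeFrom_tri, edgeFrom_tri]
    have h0j : f 0 ≠ f j.succ := fun h => Fin.succ_ne_zero j (f.injective h).symm
    have h0k : f 0 ≠ f k.succ := fun h => Fin.succ_ne_zero k (f.injective h).symm
    have hjk' : f j.succ ≠ f k.succ := fun h => hjk (Fin.succ_injective _ (f.injective h))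
    revert h0j h0k hjk'
    generalize f 0 = x
    generalize f j.succ = y
    generalize f k.succ = z
    intro h0j h0k hjk'
    rcases x with _ | a <;> rcases y with _ | b <;> rcases z with _ | c
    all_goals try exact absurd rfl h0j
    all_goals try exact absurd rfl h0k
    all_goals try exact absurd rfl hjk'
    · obtain rfl : c = !b := by cases b <;> cases c <;> simp_all
      exact .out s i t b h
    · exact .inHor s i t a h
    · exact .horIn s i t a h
    · cases a <;> cases b <;> cases c <;> simp_all
  | star e he f hf =>
    left
    rw [label_edgeFrom_star, label_edgeFrom_star]
    refine ⟨by simp [base], rfl, ?_, ?_⟩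
    · intro h
      simp only [Label.seg.injEq, true_and] at h
      exact hjk (Fin.succ_injective _ (f.injective (StarCorner.code_injective h)))
    · rintro ⟨e', c, b, h1, h2⟩
      simp only [Label.seg.injEq] at h1 h2
      have key : ∀ (x : X.StarCorner e) b, x.code = .apex b → x = .apex b := fun x b hx =>
        StarCorner.code_injective hx
      have h3 := key _ _ h1.2.2
      have h4 := key _ _ h2.2.2
      cases b
      · exact hf _ _ h3 h4
      · exact hf _ _ h4 h3

theorem edgeFrom_injective (hX : X.toSquareComplex.IsNonpositivelyCurved) {n : ℕ}
    (x : X.OrderedSimplex (n + 1)) : Function.Injective (edgeFrom x) := by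
  intro j k h
  by_contra hjk
  rcases edgeFrom_cases x j k hjk with h' | h'
  · exact h'.2.2.1 (by rw [h])
  · exact (clusterGraph hX).base_ne _ _ h' (by rw [h])

theorem emb_option_bool (f : Fin 3 ↪ Option Bool) :
    (∃ a, f 0 = none ∧ f 1 = some a ∧ f 2 = some !a) ∨
      (∃ a, f 0 = some a ∧ f 1 = none ∧ f 2 = some !a) ∨
      ∃ a, f 0 = some a ∧ f 1 = some (!a) ∧ f 2 = none := by
  have h01 : f 0 ≠ f 1 := fun h => absurd (f.injective h) (by decide)
  have h02 : f 0 ≠ f 2 := fun h => absurd (f.injective h) (by decide)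
  have h12 : f 1 ≠ f 2 := fun h => absurd (f.injective h) (by decide)
  revert h01 h02 h12
  generalize f 0 = x
  generalize f 1 = y
  generalize f 2 = z
  revert x y z
  decide

/-- In a star the labels of the edges record the star and all corners. For a triangle over a
horizontal side, one of the two edges joins `s*` to a corner of `s`, and its label determines the
triangle and the ordering. The two kinds differ because edges at a corner of a star share a base. -/
theorem eq_of_edgeFrom_eq {n : ℕ} (x y : X.OrderedSimplex (n + 1))
    (h : ∀ j, edgeFrom x j = edgeFrom y j) : x = y := by
  cases n with
  | zero => rw [← edgeFrom_zero x 0, ← edgeFrom_zero y 0, h]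
  | succ n =>
    have starTri : ∀ (e : X.E) (he : e ∈ X.vertical) (f : Fin (1 + 2) ↪ X.StarCorner e)
        (hf : Spans f) (s : X.S) (i t : Bool) (hs : X.side s i t ∉ X.vertical)
        (f' : Fin 3 ↪ Option Bool),
        (∀ j, edgeFrom (.star e he f hf) j = edgeFrom (.tri s i t hs f') j) → False := by
      intro e he f hf s i t hs f' h
      have h0 : base (label (edgeFrom (.tri s i t hs f') 0)) =
          base (label (edgeFrom (.tri s i t hs f') 1)) := by
        rw [← h, ← h]; rfl
      rw [edgeFrom_tri, edgeFrom_tri] at h0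
      rcases emb_option_bool f' with ⟨a, h1, h2, h3⟩ | ⟨a, h1, h2, h3⟩ | ⟨a, h1, h2, h3⟩ <;>
        simp [h1, h2, h3, label_triEdge, base, outLabel, inLabel, horLabel] at h0
    cases x with
    | tri s i t hs f =>
      cases y with
      | star e he f' hf' => exact (starTri _ _ _ _ _ _ _ _ _ fun j => (h j).symm).elim
      | tri s' i' t' hs' f' =>
        have h0 := congrArg label (h 0)
        have h1 := congrArg label (h 1)
        rw [edgeFrom_tri, edgeFrom_tri] at h0 h1
        have key : s = s' ∧ i = i' ∧ t = t' ∧ f = f' := by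
          have hext : f 0 = f' 0 → f 1 = f' 1 → f 2 = f' 2 → f = f' := by
            intro h0 h1 h2
            ext1 j
            fin_cases j
            exacts [h0, h1, h2]
          rcases emb_option_bool f with ⟨a, h2, h3, h4⟩ | ⟨a, h2, h3, h4⟩ | ⟨a, h2, h3, h4⟩ <;>
            rcases emb_option_bool f' with ⟨b, h5, h6, h7⟩ | ⟨b, h5, h6, h7⟩ | ⟨b, h5, h6, h7⟩ <;>
            simp only [Fin.succ_zero_eq_one, Fin.succ_one_eq_two, h2, h3, h4, h5, h6, h7,
              label_triEdge] at h0 h1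
          · obtain ⟨rfl, rfl, rfl, rfl⟩ := outLabel_injective h0
            exact ⟨rfl, rfl, rfl, hext (h2.trans h5.symm) (h3.trans h6.symm) (h4.trans h7.symm)⟩
          · simp [outLabel, inLabel] at h0
          · simp [outLabel, horLabel] at h0
          · simp [outLabel, inLabel] at h0
          · obtain ⟨rfl, rfl, rfl, rfl⟩ := inLabel_injective h0
            exact ⟨rfl, rfl, rfl, hext (h2.trans h5.symm) (h3.trans h6.symm) (h4.trans h7.symm)⟩
          · simp [inLabel, horLabel] at h0
          · simp [outLabel, horLabel] at h0
          · simp [inLabel, horLabel] at h0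
          · obtain ⟨rfl, rfl, rfl, rfl⟩ := inLabel_injective h1
            exact ⟨rfl, rfl, rfl, hext (h2.trans h5.symm) (h3.trans h6.symm) (h4.trans h7.symm)⟩
        obtain ⟨rfl, rfl, rfl, rfl⟩ := key
        rfl
    | star e he f hf =>
      cases y with
      | tri s' i' t' hs' f' => exact (starTri _ _ _ _ _ _ _ _ _ h).elim
      | star e' he' f' hf' =>
        have h' := fun j => congrArg label (h j)
        simp only [label_edgeFrom_star, Label.seg.injEq] at h'
        refine star_eq_iff.2 ⟨(h' 0).1, fun j => ?_⟩
        refine Fin.cases ?_ (fun j => ?_) j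
        · exact (h' 0).2.1
        · exact (h' j).2.2

/-- Edges at the same corner of the same star, any two of which are adjacent, span a simplex. -/
theorem exists_simplex_of_baseAdj {n : ℕ} (d : Fin (n + 2) → X.OrderedSimplex 1)
    (h : ∀ j k, j ≠ k → ClusterGraph.BaseAdj base Opp (label (d j)) (label (d k))) :
    ∃ x : X.OrderedSimplex (n + 2), ∀ j, edgeFrom x j = d j := by
  have h01 := h 0 1 (by simp)
  obtain ⟨⟨e, c⟩, hec⟩ := Option.ne_none_iff_exists'.1 h01.1
  have hb : ∀ j, base (label (d j)) = some (e, c) := by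
    intro j
    by_cases hj : j = 0
    · rw [hj, hec]
    · rw [← (h 0 j (Ne.symm hj)).2.1, hec]
  have hd : ∀ j, ∃ (he : e ∈ X.vertical) (f : Fin 2 ↪ X.StarCorner e) (hf : Spans f),
      d j = .star e he f hf ∧ (f 0).code = c := by
    intro j
    have := hb j
    generalize d j = y at this
    cases y with
    | hor e he b => simp [base, label] at this
    | star e' he f hf =>
      simp only [base, label, Option.some.injEq, Prod.mk.injEq] at this
      obtain ⟨rfl, h2⟩ := this
      exact ⟨he, f, hf, rfl, h2⟩
  choose he f hf hdf hc using hd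
  have hcode : ∀ j, (f j 0) = f 0 0 := fun j =>
    StarCorner.code_injective ((hc j).trans (hc 0).symm)
  have hlab : ∀ j, label (d j) = .seg e c (f j 1).code := by
    intro j
    rw [hdf, ← hc j]
    rfl
  let F : Fin (n + 3) ↪ X.StarCorner e := ⟨Fin.cons (f 0 0) fun j => f j 1, by
    rw [Fin.cons_injective_iff]
    refine ⟨?_, fun j k hjk => ?_⟩
    · rintro ⟨j, hj⟩
      dsimp only at hj
      rw [← hcode j] at hj
      exact emb_ne (f j) hj.symm
    · by_contra hne
      refine (h j k hne).2.2.1 ?_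
      dsimp only at hjk
      rw [hlab, hlab, hjk]⟩
  have hF0 : F 0 = f 0 0 := rfl
  have hFs : ∀ j, F (Fin.succ j) = f j 1 := fun j => rfl
  have hF : Spans F := by
    intro j k
    refine Fin.cases ?_ (fun j => ?_) j <;> refine Fin.cases ?_ (fun k => ?_) k
    · rw [hF0]; intro h1 h2; rw [h1] at h2; simp at h2
    · rw [hF0, hFs, ← hcode k]
      exact hf k 0 1
    · rw [hF0, hFs, ← hcode j]
      exact hf j 1 0
    · rw [hFs, hFs]
      intro h1 h2
      have hjk : j ≠ k := by rintro rfl; rw [h1] at h2; simp at h2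
      refine (h j k hjk).2.2.2 ⟨e, c, false, ?_, ?_⟩
      · rw [hlab, h1]; rfl
      · rw [hlab, h2]; rfl
  refine ⟨.star e (he 0) F hF, fun j => label_injective ?_⟩
  rw [label_edgeFrom_star, hlab, hF0, hFs, hc]

theorem link_adj_iff {v : X.OrderedSimplex 0} (p q : (X.simplexification.link v).simplex 0) :
    (X.simplexification.link v).Adj p q ↔
      ∃ x : X.OrderedSimplex 2, edgeFrom x 0 = p.1 ∧ edgeFrom x 1 = q.1 := by
  constructor
  · rintro ⟨x, rfl, rfl⟩
    exact ⟨x.1, rfl, rfl⟩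
  · rintro ⟨x, h0, h1⟩
    refine ⟨⟨x, ?_⟩, Subtype.ext h0, Subtype.ext h1⟩
    rw [← p.2, ← h0]
    exact (vertex_edgeFrom x 0).symm

theorem baseAdj_or_triAdj_of_adj {v : X.OrderedSimplex 0}
    {p q : (X.simplexification.link v).simplex 0} (h : (X.simplexification.link v).Adj p q) :
    ClusterGraph.BaseAdj base Opp (label p.1) (label q.1) ∨ TriAdj (label p.1) (label q.1) := by
  obtain ⟨x, h0, h1⟩ := (link_adj_iff p q).1 h
  rw [← h0, ← h1]
  exact edgeFrom_cases x 0 1 (by decide)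

/-- A converse of `baseAdj_or_triAdj_of_adj` is needed for this alternative only, because the
diagonals that have to be excluded are adjacencies within a base. -/
theorem adj_of_baseAdj (hX : X.toSquareComplex.IsNonpositivelyCurved) {v : X.OrderedSimplex 0}
    {p q : (X.simplexification.link v).simplex 0}
    (h : ClusterGraph.BaseAdj base Opp (label p.1) (label q.1)) :
    (X.simplexification.link v).Adj p q := by
  obtain ⟨x, hx⟩ := exists_simplex_of_baseAdj (n := 0) ![p.1, q.1] (by
    intro j k hjk
    fin_cases j <;> fin_cases k
    · exact absurd rfl hjk
    · exact h
    · exact (clusterGraph hX).baseAdj_symm h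
    · exact absurd rfl hjk)
  exact (link_adj_iff p q).2 ⟨x, hx 0, hx 1⟩

/-- By `not_T_of_triangle` a clique of at least three vertices uses no triangle over a horizontal
side. So it lies in one cluster, where `exists_simplex_of_baseAdj` fills it. -/
theorem isFlag_link (hX : X.toSquareComplex.IsNonpositivelyCurved) (v : X.OrderedSimplex 0) :
    (X.simplexification.link v).IsFlag := by
  refine isFlag_of_vertex (fun n x j k h => ?_) (fun n x y h => ?_) fun n p hp hadj => ?_
  · exact edgeFrom_injective hX x.1 (congrArg Subtype.val h)
  · exact Subtype.ext (eq_of_edgeFrom_eq x.1 y.1 fun j => congrArg Subtype.val (h j))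
  · have hlab : ∀ j k, j ≠ k → label (p j).1 ≠ label (p k).1 := fun j k hjk h =>
      hjk (hp (Subtype.ext (label_injective h)))
    have key : ∃ x : X.OrderedSimplex (n + 1), ∀ j, edgeFrom x j = (p j).1 := by
      match n, p with
      | 0, p =>
        refine ⟨(p 0).1, fun j => ?_⟩
        exact (edgeFrom_zero _ j).trans <| congrArg (fun j => (p j).1) (Subsingleton.elim (α := Fin 1) 0 j)
      | 1, p =>
        obtain ⟨x, h0, h1⟩ := (link_adj_iff _ _).1 (hadj 0 1 (by decide))
        refine ⟨x, fun j => ?_⟩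
        fin_cases j
        exacts [h0, h1]
      | n + 2, p =>
        refine exists_simplex_of_baseAdj _ fun j k hjk => ?_
        refine (baseAdj_or_triAdj_of_adj (hadj j k hjk)).resolve_right fun hT => ?_
        obtain ⟨l, hl⟩ : ∃ l, l ∉ ({j, k} : Finset (Fin (n + 2 + 1))) := by
          by_contra! hall
          have := Finset.card_le_card (fun x _ => hall x : Finset.univ ⊆ _)
          have h2 := Finset.card_le_two (a := j) (b := k)
          simp at this
          omega
        simp only [Finset.mem_insert, Finset.mem_singleton, not_or] at hl
        exact (clusterGraph hX).not_T_of_triangle hT (hlab _ _ (Ne.symm hl.1))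
          (hlab _ _ (Ne.symm hl.2)) (baseAdj_or_triAdj_of_adj (hadj _ _ (Ne.symm hl.1)))
          (baseAdj_or_triAdj_of_adj (hadj _ _ (Ne.symm hl.2)))
    obtain ⟨x, hx⟩ := key
    refine ⟨⟨x, ?_⟩, fun j => Subtype.ext (hx j)⟩
    rw [← (p 0).2, ← hx 0]
    exact (vertex_edgeFrom x 0).symm

/-- Labels are injective, so an embedded cycle in the link gives distinct vertices of the cluster
graph, where `not_square` and `not_pentagon` need only two missing diagonals. -/
theorem isLocallySixLarge_simplexification (hX : X.toSquareComplex.IsNonpositivelyCurved) :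
    X.simplexification.IsLocallySixLarge := by
  intro v
  have hC := clusterGraph hX
  refine ⟨isFlag_link hX v, ?_, ?_⟩
  · rintro ⟨p, hp, hadj, hdiag⟩
    have ha := fun i => baseAdj_or_triAdj_of_adj (hadj i)
    have hne : ∀ i j, i ≠ j → label (p i).1 ≠ label (p j).1 := fun i j hij h =>
      hij (hp (Subtype.ext (label_injective h)))
    have hn : ∀ i j, i ≠ j → j ≠ i + 1 → i ≠ j + 1 →
        ¬ ClusterGraph.BaseAdj base Opp (label (p i).1) (label (p j).1) := fun i j h1 h2 h3 h =>
      (hdiag i j h1 (adj_of_baseAdj hX h)).elim h2 h3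
    exact hC.not_square (ha 0) (ha 1) (ha 2) (ha 3) (hne 0 2 (by decide)) (hne 1 3 (by decide))
      (hn 0 2 (by decide) (by decide) (by decide)) (hn 1 3 (by decide) (by decide) (by decide))
  · rintro ⟨p, hp, hadj, hdiag⟩
    have ha := fun i => baseAdj_or_triAdj_of_adj (hadj i)
    have hne : ∀ i j, i ≠ j → label (p i).1 ≠ label (p j).1 := fun i j hij h =>
      hij (hp (Subtype.ext (label_injective h)))
    have hn : ∀ i j, i ≠ j → j ≠ i + 1 → i ≠ j + 1 →
        ¬ ClusterGraph.BaseAdj base Opp (label (p i).1) (label (p j).1) := fun i j h1 h2 h3 h =>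
      (hdiag i j h1 (adj_of_baseAdj hX h)).elim h2 h3
    exact hC.not_pentagon (ha 0) (ha 1) (ha 2) (ha 3) (ha 4) (hne 0 2 (by decide))
      (hne 1 3 (by decide)) (hne 2 4 (by decide)) (hne 3 0 (by decide)) (hne 4 1 (by decide))
      (hn 0 2 (by decide) (by decide) (by decide)) (hn 1 3 (by decide) (by decide) (by decide))

end VHComplex

namespace VHComplex

open GenSimplicialComplex

variable {X : VHComplex.{u}}

/-! ### Corners of squares in coordinates -/

/-- The corner of a square with horizontal coordinate `a` and vertical coordinate `t`. -/
noncomputable def corner (s : X.S) (a t : Bool) : X.Corner := (s, fun k => if k = hdir s then a else t)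

theorem corner_injective {s s' : X.S} {a a' t t' : Bool} (h : corner s a t = corner s' a' t') :
    s = s' ∧ a = a' ∧ t = t' := by
  obtain rfl : s = s' := congrArg Prod.fst h
  have h2 : (fun k => if k = hdir s then a else t) = fun k => if k = hdir s then a' else t' :=
    congrArg Prod.snd h
  have h3 := congrFun h2 (hdir s)
  have h4 := congrFun h2 (!hdir s)
  simp only [if_true, Bool.not_eq_self, if_false] at h3 h4
  exact ⟨rfl, h3, h4⟩

theorem eq_corner (q : X.Corner) : q = corner q.1 (q.2 (hdir q.1)) (q.2 (!hdir q.1)) := by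
  refine Prod.ext rfl (funext fun k => ?_)
  simp only [corner]
  split_ifs with h
  · rw [h]
  · rw [Bool.eq_not_of_ne h]

theorem nextCorner_hdir (s : X.S) (a t : Bool) :
    X.nextCorner (corner s a t) (hdir s) = corner s (!a) t := by
  refine Prod.ext rfl (funext fun k => ?_)
  simp only [corner, SquareComplex.nextCorner, if_true]
  by_cases h : k = hdir s
  · subst h; simp
  · rw [Function.update_of_ne h, if_neg h, if_neg h]

theorem nextCorner_not_hdir (s : X.S) (a t : Bool) :
    X.nextCorner (corner s a t) (!hdir s) = corner s a (!t) := by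
  refine Prod.ext rfl (funext fun k => ?_)
  simp only [corner, SquareComplex.nextCorner, Bool.not_eq_self, if_false]
  by_cases h : k = hdir s
  · subst h; simp
  · obtain rfl := Bool.eq_not_of_ne h
    simp

theorem cornerEdge_hdir (s : X.S) (a t : Bool) : X.cornerEdge (corner s a t) (hdir s) =
    (X.side s (hdir s) t, a ^^ X.reversed s (hdir s) t) := by
  simp [SquareComplex.cornerEdge, corner]

theorem cornerEdge_not_hdir (s : X.S) (a t : Bool) : X.cornerEdge (corner s a t) (!hdir s) =
    (X.side s (!hdir s) a, t ^^ X.reversed s (!hdir s) a) := by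
  simp [SquareComplex.cornerEdge, corner]

section action

variable {G : Type*} [Group G] (ρ : X.toSquareComplex.Action G)

/-- The action on the ends of an edge. -/
def endMap (g : G) (e : X.E) (b : Bool) : Bool := (ρ.onEdge g (e, b)).2

theorem onEdge_eq (g : G) (e : X.E) (b : Bool) :
    ρ.onEdge g (e, b) = (ρ.edgeMap g e, endMap ρ g e b) := by
  cases b with
  | false => rfl
  | true =>
    have h := congrArg Prod.fst (ρ.rev_eq g (e, false))
    exact Prod.ext h rfl

theorem endMap_not (g : G) (e : X.E) (b : Bool) : endMap ρ g e (!b) = !endMap ρ g e b :=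
  congrArg Prod.snd (ρ.rev_eq g (e, b))

theorem endMap_injective (g : G) (e : X.E) : Function.Injective (endMap ρ g e) := by
  intro a b h
  by_contra hne
  rw [Bool.eq_not_of_ne hne, endMap_not] at h
  simp at h

theorem edgeMap_mul (g h : G) (e : X.E) : ρ.edgeMap (g * h) e = ρ.edgeMap g (ρ.edgeMap h e) := by
  have : ρ.onEdge (g * h) (e, false) = ρ.onEdge g (ρ.onEdge h (e, false)) := by
    rw [map_mul]; rfl
  rw [onEdge_eq, onEdge_eq ρ h, onEdge_eq] at this
  exact (Prod.mk.inj this).1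

theorem endMap_mul (g h : G) (e : X.E) (b : Bool) :
    endMap ρ (g * h) e b = endMap ρ g (ρ.edgeMap h e) (endMap ρ h e b) := by
  have : ρ.onEdge (g * h) (e, b) = ρ.onEdge g (ρ.onEdge h (e, b)) := by
    rw [map_mul]; rfl
  rw [onEdge_eq, onEdge_eq ρ h, onEdge_eq] at this
  exact (Prod.mk.inj this).2

theorem edgeMap_one (e : X.E) : ρ.edgeMap 1 e = e := by
  rw [SquareComplex.Action.edgeMap, map_one]; rfl

theorem endMap_one (e : X.E) (b : Bool) : endMap ρ 1 e b = b := by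
  rw [endMap, map_one]; rfl

theorem onVertex_ends (g : G) (e : X.E) (b : Bool) :
    ρ.onVertex g (X.ends e b) = X.ends (ρ.edgeMap g e) (endMap ρ g e b) := by
  have := ρ.origin_eq g (e, b)
  rw [onEdge_eq] at this
  exact this.symm

/-- The change of the horizontal coordinate. -/
noncomputable def hflip (g : G) (s : X.S) : Bool :=
  (ρ.onCorner g (corner s false false)).2 (hdir (ρ.squareMap g s))

/-- The change of the vertical coordinate. -/
noncomputable def vflip (g : G) (s : X.S) : Bool :=
  (ρ.onCorner g (corner s false false)).2 (!hdir (ρ.squareMap g s))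

variable {ρ} (hρ : PreservesVH ρ)

include hρ

/-- The permutation of directions at a corner is forced: horizontal sides go to horizontal sides. -/
theorem cornerEdge_equivariant (g : G) (q : X.Corner) :
    (ρ.onEdge g (X.cornerEdge q (hdir q.1)) =
        X.cornerEdge (ρ.onCorner g q) (hdir (ρ.onCorner g q).1) ∧
      ρ.onCorner g (X.nextCorner q (hdir q.1)) =
        X.nextCorner (ρ.onCorner g q) (hdir (ρ.onCorner g q).1)) ∧
    ρ.onEdge g (X.cornerEdge q (!hdir q.1)) =
        X.cornerEdge (ρ.onCorner g q) (!hdir (ρ.onCorner g q).1) ∧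
      ρ.onCorner g (X.nextCorner q (!hdir q.1)) =
        X.nextCorner (ρ.onCorner g q) (!hdir (ρ.onCorner g q).1) := by
  obtain ⟨π, hπ⟩ := ρ.corner_eq g q
  have h1 : π (hdir q.1) = hdir (ρ.onCorner g q).1 := by
    have h := congrArg Prod.fst (hπ (hdir q.1)).1
    have h2 : (ρ.onEdge g (X.cornerEdge q (hdir q.1))).1 ∉ X.vertical := by
      rw [← Prod.mk.eta (p := X.cornerEdge q (hdir q.1)), onEdge_eq]
      exact fun h => hdir_spec _ _ ((hρ _ _).1 h)
    rw [h] at h2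
    exact eq_hdir h2
  have h2 : π (!hdir q.1) = !hdir (ρ.onCorner g q).1 := by
    rw [← h1]
    refine Bool.eq_not_of_ne fun h => ?_
    exact absurd (π.injective h) (by simp)
  have h3 := hπ (hdir q.1)
  have h4 := hπ (!hdir q.1)
  rw [h1] at h3
  rw [h2] at h4
  exact ⟨h3, h4⟩

/-- The image of one corner determines those of the others by walking along the sides. As directions
are preserved, each coordinate is either kept or flipped. -/
theorem onCorner_corner (g : G) (s : X.S) (a t : Bool) : ρ.onCorner g (corner s a t) =
    corner (ρ.squareMap g s) (a ^^ hflip ρ g s) (t ^^ vflip ρ g s) := by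
  have h00 : ρ.onCorner g (corner s false false) =
      corner (ρ.squareMap g s) (hflip ρ g s) (vflip ρ g s) := by
    have h : (ρ.onCorner g (corner s false false)).1 = ρ.squareMap g s := by
      rw [SquareComplex.Action.squareMap]
      congr 3
      exact Prod.ext rfl (funext fun k => by simp [corner])
    conv_lhs => rw [eq_corner (ρ.onCorner g (corner s false false)), h]
    rfl
  have h10 : ∀ b b' b'', ρ.onCorner g (corner s b false) = corner (ρ.squareMap g s) b' b'' →
      ρ.onCorner g (corner s b true) = corner (ρ.squareMap g s) b' !b'' := by
    intro b b' b'' h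
    have h' := (cornerEdge_equivariant hρ g (corner s b false)).2.2
    rw [h] at h'
    exact (congrArg _ (nextCorner_not_hdir s b false)).symm.trans
      (h'.trans (nextCorner_not_hdir _ _ _))
  have h01 : ρ.onCorner g (corner s true false) =
      corner (ρ.squareMap g s) (!hflip ρ g s) (vflip ρ g s) := by
    have h' := (cornerEdge_equivariant hρ g (corner s false false)).1.2
    rw [h00] at h'
    exact (congrArg _ (nextCorner_hdir s false false)).symm.trans
      (h'.trans (nextCorner_hdir _ _ _))
  cases a <;> cases t <;> simp only [Bool.false_xor, Bool.true_xor]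
  · exact h00
  · exact h10 _ _ _ h00
  · exact h01
  · exact h10 _ _ _ h01

theorem horizontal_side_equivariant (g : G) (s : X.S) (a t : Bool) :
    X.side (ρ.squareMap g s) (hdir (ρ.squareMap g s)) (t ^^ vflip ρ g s) =
        ρ.edgeMap g (X.side s (hdir s) t) ∧
      ((a ^^ hflip ρ g s) ^^
        X.reversed (ρ.squareMap g s) (hdir (ρ.squareMap g s)) (t ^^ vflip ρ g s)) =
        endMap ρ g (X.side s (hdir s) t) (a ^^ X.reversed s (hdir s) t) := by
  have h := (cornerEdge_equivariant hρ g (corner s a t)).1.1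
  rw [onCorner_corner hρ] at h
  have h1 := cornerEdge_hdir s a t
  have h' := ((congrArg (ρ.onEdge g) h1).symm.trans h).trans (cornerEdge_hdir _ _ _)
  rw [onEdge_eq] at h'
  exact ⟨(congrArg Prod.fst h').symm, (congrArg Prod.snd h').symm⟩

theorem vertical_side_equivariant (g : G) (s : X.S) (a t : Bool) :
    X.side (ρ.squareMap g s) (!hdir (ρ.squareMap g s)) (a ^^ hflip ρ g s) =
        ρ.edgeMap g (X.side s (!hdir s) a) ∧
      ((t ^^ vflip ρ g s) ^^
        X.reversed (ρ.squareMap g s) (!hdir (ρ.squareMap g s)) (a ^^ hflip ρ g s)) =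
        endMap ρ g (X.side s (!hdir s) a) (t ^^ X.reversed s (!hdir s) a) := by
  have h := (cornerEdge_equivariant hρ g (corner s a t)).2.1
  rw [onCorner_corner hρ] at h
  have h1 := cornerEdge_not_hdir s a t
  have h' := ((congrArg (ρ.onEdge g) h1).symm.trans h).trans (cornerEdge_not_hdir _ _ _)
  rw [onEdge_eq] at h'
  exact ⟨(congrArg Prod.fst h').symm, (congrArg Prod.snd h').symm⟩

/-- The flips form a cocycle, as the image of a single corner shows. -/
theorem square_mul (g h : G) (s : X.S) :
    ρ.squareMap (g * h) s = ρ.squareMap g (ρ.squareMap h s) ∧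
      hflip ρ (g * h) s = (hflip ρ h s ^^ hflip ρ g (ρ.squareMap h s)) ∧
      vflip ρ (g * h) s = (vflip ρ h s ^^ vflip ρ g (ρ.squareMap h s)) := by
  have : ρ.onCorner (g * h) (corner s false false) =
      ρ.onCorner g (ρ.onCorner h (corner s false false)) := by
    rw [map_mul]; rfl
  rw [onCorner_corner hρ, onCorner_corner hρ h, onCorner_corner hρ] at this
  simpa only [Bool.false_xor] using corner_injective this

theorem square_one (s : X.S) :
    ρ.squareMap 1 s = s ∧ hflip ρ 1 s = false ∧ vflip ρ 1 s = false := by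
  have : ρ.onCorner 1 (corner s false false) = corner s false false := by
    rw [map_one]; rfl
  rw [onCorner_corner hρ] at this
  simpa only [Bool.false_xor] using corner_injective this

/-! ### The action on the simplexification -/

theorem mem_vertical {g : G} {e : X.E} (he : e ∈ X.vertical) : ρ.edgeMap g e ∈ X.vertical :=
  (hρ g e).2 he

theorem not_mem_vertical {g : G} {e : X.E} (he : e ∉ X.vertical) : ρ.edgeMap g e ∉ X.vertical :=
  fun h => he ((hρ g e).1 h)

/-- The action on the corners of stars. -/
noncomputable def starCornerMap (g : G) {e : X.E} (he : e ∈ X.vertical) :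
    X.StarCorner e ↪ X.StarCorner (ρ.edgeMap g e) where
  toFun
    | .apex b => .apex (endMap ρ g e b)
    | .center => .center
    | .square s i t h => .square (ρ.squareMap g s) (!hdir (ρ.squareMap g s)) (t ^^ hflip ρ g s) (by
        -- A vertical side is named by its horizontal coordinate `t`; the vertical coordinate
        -- `false` is arbitrary.
        rw [(vertical_side_equivariant hρ g s t false).1]
        obtain rfl := eq_not_hdir (h ▸ he)
        rw [h])
  inj' := by
    intro x y hxy
    cases x with
    | apex b =>
      cases y with
      | apex b' => exact congrArg _ (endMap_injective ρ g e (by simpa using hxy))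
      | center => simp at hxy
      | square s i t h => simp at hxy
    | center =>
      cases y with
      | apex b' => simp at hxy
      | center => rfl
      | square s i t h => simp at hxy
    | square s i t h =>
      cases y with
      | apex b' => simp at hxy
      | center => simp at hxy
      | square s' i' t' h' =>
        simp only [StarCorner.square.injEq] at hxy
        obtain rfl : s = s' := by
          have h1 := (square_mul hρ g⁻¹ g s).1
          have h2 := (square_mul hρ g⁻¹ g s').1
          rw [hxy.1, ← h2, inv_mul_cancel, (square_one hρ s).1, (square_one hρ s').1] at h1
          exact h1
        obtain rfl : i = i' := (eq_not_hdir (h ▸ he)).trans (eq_not_hdir (h' ▸ he)).symm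
        obtain rfl : t = t' := by simpa using hxy.2.2
        rfl

theorem starCornerMap_code (g : G) {e : X.E} (he : e ∈ X.vertical) (s i t h) :
    (starCornerMap hρ g he (.square s i t h)).code =
      .square (ρ.squareMap g s) (!hdir (ρ.squareMap g s)) (t ^^ hflip ρ g s) := rfl

/-- The endpoints of `e` are mapped bijectively, so both occur in the image only if both occurred
before. -/
theorem spans_map (g : G) {e : X.E} (he : e ∈ X.vertical) {n : ℕ}
    {f : Fin (n + 1) ↪ X.StarCorner e} (hf : Spans f) :
    Spans (f.trans (starCornerMap hρ g he)) := by
  have key : ∀ j b, starCornerMap hρ g he (f j) = .apex b → ∃ b', f j = .apex b' ∧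
      endMap ρ g e b' = b := by
    intro j b hj
    cases h : f j with
    | apex b' =>
      rw [h] at hj
      have hj' : (StarCorner.apex (endMap ρ g e b') : X.StarCorner (ρ.edgeMap g e)) = .apex b := hj
      exact ⟨b', rfl, StarCorner.apex.inj hj'⟩
    | center => rw [h] at hj; simp [starCornerMap] at hj
    | square s i t h' => rw [h] at hj; simp [starCornerMap] at hj
  intro j k hj hk
  obtain ⟨b, hb, hb'⟩ := key j _ hj
  obtain ⟨c, hc, hc'⟩ := key k _ hk
  cases b <;> cases c
  · rw [hb'] at hc'; simp at hc'
  · exact hf _ _ hb hc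
  · exact hf _ _ hc hb
  · rw [hb'] at hc'; simp at hc'

omit hρ in
/-- The action on the corners of triangles. -/
noncomputable def triCornerMap (ρ : X.toSquareComplex.Action G) (g : G) (s : X.S) :
    Option Bool ↪ Option Bool where
  toFun := Option.map fun a => a ^^ hflip ρ g s
  inj' := Option.map_injective fun a b h => by simpa using h

/-- The action on the simplices of the simplexification. -/
noncomputable def simplexMap (g : G) : ∀ {n : ℕ}, X.OrderedSimplex n → X.OrderedSimplex n
  | _, .vert v => .vert (ρ.onVertex g v)
  | _, .edge e he => .edge (ρ.edgeMap g e) (mem_vertical hρ he)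
  | _, .square s => .square (ρ.squareMap g s)
  | _, .hor e he b => .hor (ρ.edgeMap g e) (not_mem_vertical hρ he) (endMap ρ g e b)
  | _, .tri s _ t _ f => .tri (ρ.squareMap g s) (hdir (ρ.squareMap g s)) (t ^^ vflip ρ g s)
      (hdir_spec _ _) (f.trans (triCornerMap ρ g s))
  | _, .star e he f hf => .star (ρ.edgeMap g e) (mem_vertical hρ he)
      (f.trans (starCornerMap hρ g he)) (spans_map hρ g he hf)

omit hρ in
theorem tri_congr {s s' : X.S} {i i' t t' : Bool} {h : X.side s i t ∉ X.vertical}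
    {h' : X.side s' i' t' ∉ X.vertical} {f f' : Fin 3 ↪ Option Bool} (hs : s = s') (hi : i = i')
    (ht : t = t') (hf : ∀ j, f j = f' j) :
    OrderedSimplex.tri s i t h f = .tri s' i' t' h' f' := by
  subst hs hi ht
  obtain rfl : f = f' := by
    ext1 j
    exact hf j
  rfl

theorem simplexMap_one {n : ℕ} (x : X.OrderedSimplex n) : simplexMap hρ 1 x = x := by
  cases x with
  | vert v => simp [simplexMap]
  | edge e he => simp only [simplexMap, edgeMap_one]
  | square s => simp only [simplexMap, (square_one hρ s).1]
  | hor e he b => simp only [simplexMap, edgeMap_one, endMap_one]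
  | tri s i t h f =>
    obtain ⟨h1, h2, h3⟩ := square_one hρ s
    refine tri_congr h1 (by rw [h1, eq_hdir h]) (by rw [h3, Bool.xor_false]) fun j => ?_
    change Option.map _ (f j) = f j
    simp [h2]
  | star e he f hf =>
    refine star_eq_iff.2 ⟨edgeMap_one ρ e, fun j => ?_⟩
    change (starCornerMap hρ 1 he (f j)).code = _
    cases f j with
    | apex b => exact congrArg _ (endMap_one ρ e b)
    | center => rfl
    | square s i t h =>
      obtain ⟨h1, h2, h3⟩ := square_one hρ s
      rw [starCornerMap_code, h1, h2, Bool.xor_false, ← eq_not_hdir (h ▸ he)]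
      rfl

theorem simplexMap_mul (g h : G) {n : ℕ} (x : X.OrderedSimplex n) :
    simplexMap hρ (g * h) x = simplexMap hρ g (simplexMap hρ h x) := by
  cases x with
  | vert v => simp [simplexMap]
  | edge e he => simp only [simplexMap, edgeMap_mul]
  | square s => simp only [simplexMap, (square_mul hρ g h s).1]
  | hor e he b => simp only [simplexMap, edgeMap_mul, endMap_mul]
  | tri s i t hs f =>
    obtain ⟨h1, h2, h3⟩ := square_mul hρ g h s
    refine tri_congr h1 (by rw [h1]) (by rw [h3, Bool.xor_assoc]) fun j => ?_
    change Option.map _ (f j) = Option.map _ (Option.map _ (f j))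
    rw [Option.map_map]
    congr 1
    funext a
    simp [h2]
  | star e he f hf =>
    refine star_eq_iff.2 ⟨edgeMap_mul ρ g h e, fun j => ?_⟩
    change (starCornerMap hρ (g * h) he (f j)).code =
      (starCornerMap hρ g (mem_vertical hρ he) (starCornerMap hρ h he (f j))).code
    cases f j with
    | apex b => exact congrArg _ (endMap_mul ρ g h e b)
    | center => rfl
    | square s i t hs =>
      obtain ⟨h1, h2, h3⟩ := square_mul hρ g h s
      rw [starCornerMap_code, h1, h2, ← Bool.xor_assoc]
      rfl

theorem simplexMap_inv_mul (g : G) {n : ℕ} (x : X.OrderedSimplex n) :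
    simplexMap hρ g⁻¹ (simplexMap hρ g x) = x := by
  rw [← simplexMap_mul, inv_mul_cancel, simplexMap_one]

theorem simplexMap_mul_inv (g : G) {n : ℕ} (x : X.OrderedSimplex n) :
    simplexMap hρ g (simplexMap hρ g⁻¹ x) = x := by
  rw [← simplexMap_mul, mul_inv_cancel, simplexMap_one]

theorem simplexMap_ofStar (g : G) {e : X.E} (he : e ∈ X.vertical) {m : ℕ}
    (f : Fin (m + 1) ↪ X.StarCorner e) (hf : Spans f) : simplexMap hρ g (ofStar he f hf) =
      ofStar (mem_vertical hρ he) (f.trans (starCornerMap hρ g he)) (spans_map hρ g he hf) := by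
  cases m with
  | succ m => rfl
  | zero =>
    change simplexMap hρ g (starVertex he (f 0)) =
      starVertex (mem_vertical hρ he) (starCornerMap hρ g he (f 0))
    cases f 0 with
    | apex b => exact congrArg OrderedSimplex.vert (onVertex_ends ρ g e b)
    | center => rfl
    | square s i t h => rfl

theorem simplexMap_ofHor (g : G) (e : X.E) (he : e ∉ X.vertical) {m : ℕ}
    (f : Fin (m + 1) ↪ Bool) : simplexMap hρ g (ofHor e he f) =
      ofHor (ρ.edgeMap g e) (not_mem_vertical hρ he)
        (f.trans ⟨endMap ρ g e, endMap_injective ρ g e⟩) := by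
  match m, f with
  | 0, f => exact congrArg OrderedSimplex.vert (onVertex_ends ρ g e (f 0))
  | 1, f => rfl
  | m + 2, f => exact absurd (Fintype.card_le_of_embedding f) (by simp)

theorem simplexMap_triEdge (g : G) (s : X.S) (t : Bool) (x y : Option Bool) (hxy : x ≠ y) :
    simplexMap hρ g (triEdge s (hdir s) t (hdir_spec s t) x y) =
      triEdge (ρ.squareMap g s) (hdir (ρ.squareMap g s)) (t ^^ vflip ρ g s) (hdir_spec _ _)
        (triCornerMap ρ g s x) (triCornerMap ρ g s y) := by
  apply label_injective
  rcases x with _ | a <;> rcases y with _ | b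
  · exact absurd rfl hxy
  · obtain ⟨h1, h2⟩ := vertical_side_equivariant hρ g s b t
    refine Eq.trans ?_ ((label_triEdge _ _ _ _).1 _).symm
    simp only [outLabel, h1, h2]
    rfl
  · obtain ⟨h1, h2⟩ := vertical_side_equivariant hρ g s a t
    refine Eq.trans ?_ ((label_triEdge _ _ _ _).2.1 _).symm
    simp only [inLabel, h1, h2]
    rfl
  · obtain ⟨h1, h2⟩ := horizontal_side_equivariant hρ g s a t
    refine Eq.trans ?_ ((label_triEdge _ _ _ _).2.2 _ (b ^^ hflip ρ g s)).symm
    simp only [horLabel, h1, h2]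
    rfl

theorem simplexMap_ofTri (g : G) (s : X.S) (t : Bool) {m : ℕ} (f : Fin (m + 1) ↪ Option Bool) :
    simplexMap hρ g (ofTri s (hdir s) t (hdir_spec s t) f) =
      ofTri (ρ.squareMap g s) (hdir (ρ.squareMap g s)) (t ^^ vflip ρ g s) (hdir_spec _ _)
        (f.trans (triCornerMap ρ g s)) := by
  match m, f with
  | 0, f =>
    change simplexMap hρ g (triVertex s _ t (f 0)) =
      triVertex _ _ _ (triCornerMap ρ g s (f 0))
    cases f 0 with
    | none => rfl
    | some a =>
      obtain ⟨h1, h2⟩ := horizontal_side_equivariant hρ g s a t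
      refine congrArg OrderedSimplex.vert ((onVertex_ends ρ g _ _).trans ?_)
      rw [← h1, ← h2]
  | 1, f => exact simplexMap_triEdge hρ g s t _ _ (emb_ne f)
  | 2, f => rfl
  | m + 3, f => exact absurd (Fintype.card_le_of_embedding f) (by simp)

theorem simplexMap_face (g : G) {m n : ℕ} (θ : Fin (m + 1) ↪ Fin (n + 1)) (x : X.OrderedSimplex n) :
    simplexMap hρ g (simplexFace θ x) = simplexFace θ (simplexMap hρ g x) := by
  cases x with
  | vert v => obtain rfl := emb_fin_one θ; rfl
  | edge e he => obtain rfl := emb_fin_one θ; rfl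
  | square s => obtain rfl := emb_fin_one θ; rfl
  | hor e he b =>
    refine (simplexMap_ofHor hρ g e he _).trans ?_
    refine congrArg (ofHor (ρ.edgeMap g e) (not_mem_vertical hρ he)) ?_
    ext1 j
    change endMap ρ g e (pairEmb b (!b) (by simp) (θ j)) =
      pairEmb (endMap ρ g e b) (!endMap ρ g e b) (by simp) (θ j)
    have hj : θ j = 0 ∨ θ j = 1 := by
      generalize θ j = k
      revert k
      decide
    rcases hj with h | h <;> rw [h]
    · rfl
    · exact endMap_not ρ g e b
  | tri s i t h f =>
    obtain rfl := eq_hdir h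
    exact simplexMap_ofTri hρ g s t _
  | star e he f hf => exact simplexMap_ofStar hρ g he _ _

/-- The induced action on the simplexification. -/
noncomputable def simplexificationAction : X.simplexification.Action G where
  act _ :=
    { toFun := fun g => ⟨simplexMap hρ g, simplexMap hρ g⁻¹,
        simplexMap_inv_mul hρ g, simplexMap_mul_inv hρ g⟩
      map_one' := Equiv.ext fun x => simplexMap_one hρ x
      map_mul' := fun g h => Equiv.ext fun x => simplexMap_mul hρ g h x }
  act_face g _ _ θ x := simplexMap_face hρ g θ x

end action

/-! ### Geometric actions -/

/-- The cell of the square complex to which a simplex belongs. -/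
def carrier : ∀ {n : ℕ}, X.OrderedSimplex n → X.V ⊕ X.E ⊕ X.S
  | _, .vert v => .inl v
  | _, .edge e _ => .inr (.inl e)
  | _, .square s => .inr (.inr s)
  | _, .hor e _ _ => .inr (.inl e)
  | _, .tri s _ _ _ _ => .inr (.inr s)
  | _, .star e _ _ _ => .inr (.inl e)

theorem carrier_face {n : ℕ} (θ : Fin (n + 1) ↪ Fin (n + 1)) (x : X.OrderedSimplex n) :
    carrier (simplexFace θ x) = carrier x := by
  cases x <;> rfl

/-- The simplices of positive dimension carried by a vertical edge are injective sequences of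
corners of its star, so finiteness of the corners bounds both their length and their number. -/
theorem finite_carrier_eq (c : X.V ⊕ X.E ⊕ X.S)
    (hfin : ∀ e ∈ X.vertical, Finite (X.StarCorner e)) :
    {y : Σ n, X.OrderedSimplex n | carrier y.2 = c}.Finite := by
  rcases c with v | e | s
  · refine (finite_singleton (⟨0, .vert v⟩ : Σ n, X.OrderedSimplex n)).subset ?_
    rintro ⟨n, y⟩ hy
    cases y <;> simp [carrier] at hy
    subst hy
    rfl
  · by_cases he : e ∈ X.vertical
    · have := hfin e he
      have := Fintype.ofFinite (X.StarCorner e)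
      let F : Option (Σ n : Fin (Fintype.card (X.StarCorner e)),
          {f : Fin (n.1 + 2) ↪ X.StarCorner e // Spans f}) → Σ n, X.OrderedSimplex n :=
        fun o => o.elim ⟨0, .edge e he⟩ fun p => ⟨p.1.1 + 1, .star e he p.2.1 p.2.2⟩
      refine (finite_range F).subset ?_
      rintro ⟨n, y⟩ hy
      cases y with
      | vert v => simp [carrier] at hy
      | edge e' he' =>
        simp only [carrier, mem_ofPred_eq, Sum.inr.injEq, Sum.inl.injEq] at hy
        subst hy
        exact ⟨none, rfl⟩
      | square s => simp [carrier] at hy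
      | hor e' he' b =>
        simp only [carrier, mem_ofPred_eq, Sum.inr.injEq, Sum.inl.injEq] at hy
        subst hy
        exact absurd he he'
      | tri s i t h f => simp [carrier] at hy
      | @star n e' he' f hf =>
        simp only [carrier, mem_ofPred_eq, Sum.inr.injEq, Sum.inl.injEq] at hy
        subst hy
        have hn : n < Fintype.card (X.StarCorner e') := by
          have := Fintype.card_le_of_embedding f
          rw [Fintype.card_fin] at this
          omega
        exact ⟨some ⟨⟨n, hn⟩, f, hf⟩, rfl⟩
    · refine (finite_range fun b => (⟨1, .hor e he b⟩ : Σ n, X.OrderedSimplex n)).subset ?_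
      rintro ⟨n, y⟩ hy
      cases y with
      | vert v => simp [carrier] at hy
      | edge e' he' =>
        simp only [carrier, mem_ofPred_eq, Sum.inr.injEq, Sum.inl.injEq] at hy
        subst hy
        exact absurd he' he
      | square s => simp [carrier] at hy
      | hor e' he' b =>
        simp only [carrier, mem_ofPred_eq, Sum.inr.injEq, Sum.inl.injEq] at hy
        subst hy
        exact ⟨b, rfl⟩
      | tri s i t h f => simp [carrier] at hy
      | star e' he' f hf =>
        simp only [carrier, mem_ofPred_eq, Sum.inr.injEq, Sum.inl.injEq] at hy
        subst hy
        exact absurd he' he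
  · let F : Option (Bool × (Fin 3 ↪ Option Bool)) → Σ n, X.OrderedSimplex n :=
      fun o => o.elim ⟨0, .square s⟩ fun p => ⟨2, .tri s (hdir s) p.1 (hdir_spec s p.1) p.2⟩
    refine (finite_range F).subset ?_
    rintro ⟨n, y⟩ hy
    cases y with
    | vert v => simp [carrier] at hy
    | edge e' he' => simp [carrier] at hy
    | square s' =>
      simp only [carrier, mem_ofPred_eq, Sum.inr.injEq] at hy
      subst hy
      exact ⟨none, rfl⟩
    | hor e' he' b => simp [carrier] at hy
    | tri s' i t h f =>
      simp only [carrier, mem_ofPred_eq, Sum.inr.injEq] at hy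
      subst hy
      obtain rfl := eq_hdir h
      exact ⟨some (t, f), rfl⟩
    | star e' he' f hf => simp [carrier] at hy

section geometric

variable {G : Type*} [Group G] {ρ : X.toSquareComplex.Action G} (hρ : PreservesVH ρ)
  (hgeom : ρ.IsGeometric)

include hρ hgeom

/-- A square at `e` is the image under some `g` of one of finitely many representatives `r`, and `g`
maps one of the two vertical sides of `r` to `e`. For each such side these `g` form a coset of the
stabiliser of `e`, or the empty set, so there are finitely many by properness. -/
theorem finite_starCorner (e : X.E) (he : e ∈ X.vertical) : Finite (X.StarCorner e) := by
  obtain ⟨⟨-, hstab, -⟩, -, -, R, hR, hcover⟩ := hgeom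
  have hcoset : ∀ e', {g : G | ρ.edgeMap g e' = e}.Finite := by
    intro e'
    rcases Set.eq_empty_or_nonempty {g : G | ρ.edgeMap g e' = e} with h | ⟨g₀, hg₀⟩
    · rw [h]; exact finite_empty
    · refine ((hstab e).image fun k => k * g₀).subset fun g hg => ⟨g * g₀⁻¹, ?_, by simp⟩
      have h1 : ρ.edgeMap g₀⁻¹ e = e' := by
        have h0 : ρ.edgeMap g₀ e' = e := hg₀
        rw [← h0, ← edgeMap_mul, inv_mul_cancel, edgeMap_one]
      have h2 : ρ.edgeMap g e' = e := hg
      change ρ.edgeMap (g * g₀⁻¹) e = e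
      rw [edgeMap_mul, h1, h2]
  have hG : (⋃ r ∈ R, ⋃ a, {g : G | ρ.edgeMap g (X.side r (!hdir r) a) = e}).Finite :=
    hR.biUnion fun r _ => finite_iUnion fun a => hcoset _
  have hS : {s : X.S | ∃ a, X.side s (!hdir s) a = e}.Finite := by
    refine ((hG.prod hR).image fun p => ρ.squareMap p.1 p.2).subset ?_
    rintro s ⟨a, ha⟩
    obtain ⟨g, r, hr, rfl⟩ := hcover s
    refine ⟨(g, r), ⟨?_, hr⟩, rfl⟩
    -- The side of the image square at coordinate `a` comes from the side of `r` at the coordinate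
    -- `a` corrected by the flip of `g`.
    refine mem_biUnion hr (mem_iUnion.2 ⟨a ^^ hflip ρ g r, ?_⟩)
    change ρ.edgeMap g _ = e
    rw [← (vertical_side_equivariant hρ g r _ false).1, Bool.xor_assoc, Bool.xor_self,
      Bool.xor_false, ha]
  have : Finite {s : X.S | ∃ a, X.side s (!hdir s) a = e} := hS
  let F : X.StarCorner e → Bool ⊕ Unit ⊕ ({s : X.S | ∃ a, X.side s (!hdir s) a = e} × Bool)
    | .apex b => .inl b
    | .center => .inr (.inl ())
    | .square s i t h => .inr (.inr (⟨s, t, by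
        obtain rfl := eq_not_hdir (h ▸ he)
        exact h⟩, t))
  refine Finite.of_injective F fun x y hxy => ?_
  cases x <;> cases y <;> simp only [F, reduceCtorEq, Sum.inl.injEq, Sum.inr.injEq, Prod.mk.injEq,
    Subtype.mk.injEq] at hxy
  · rw [hxy]
  · rfl
  · rename_i s i t h s' i' t' h'
    obtain ⟨rfl, rfl⟩ := hxy
    obtain rfl : i = i' := (eq_not_hdir (h ▸ he)).trans (eq_not_hdir (h' ▸ he)).symm
    rfl

/-- An element that preserves a simplex preserves its carrier, so properness is inherited. Every
simplex can be moved so that its carrier is one of finitely many cells, each of which carries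
finitely many simplices. -/
theorem isGeometric_simplexificationAction : (simplexificationAction hρ).IsGeometric := by
  have hfin := finite_starCorner hρ hgeom
  obtain ⟨⟨hv, he, hs⟩, ⟨A, hA, hA'⟩, ⟨B, hB, hB'⟩, ⟨C, hC, hC'⟩⟩ := hgeom
  constructor
  · intro n x
    have key : ∀ g, X.simplexification.SameSimplex x ((simplexificationAction hρ).act n g x) →
        carrier (simplexMap hρ g x) = carrier x := by
      rintro g ⟨θ, hθ⟩
      rw [← carrier_face θ x]
      exact congrArg carrier hθ.symm
    cases x with
    | vert v => exact (hv v).subset fun g hg => by simpa [carrier, simplexMap] using key g hg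
    | edge e _ => exact (he e).subset fun g hg => by simpa [carrier, simplexMap] using key g hg
    | square s => exact (hs s).subset fun g hg => by simpa [carrier, simplexMap] using key g hg
    | hor e _ _ => exact (he e).subset fun g hg => by simpa [carrier, simplexMap] using key g hg
    | tri s _ _ _ _ => exact (hs s).subset fun g hg => by simpa [carrier, simplexMap] using key g hg
    | star e _ _ _ => exact (he e).subset fun g hg => by simpa [carrier, simplexMap] using key g hg
  · let D : Set (X.V ⊕ X.E ⊕ X.S) := Sum.inl '' A ∪ (Sum.inr ∘ Sum.inl) '' B ∪
      (Sum.inr ∘ Sum.inr) '' C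
    have hD : D.Finite := ((hA.image _).union (hB.image _)).union (hC.image _)
    have hvD : ∀ v, ∃ g, (.inl (ρ.onVertex g⁻¹ v) : X.V ⊕ X.E ⊕ X.S) ∈ D := by
      intro v
      obtain ⟨g, w, hw, rfl⟩ := hA' v
      refine ⟨g, .inl (.inl ⟨w, hw, ?_⟩)⟩
      rw [← Equiv.Perm.mul_apply, ← map_mul, inv_mul_cancel, map_one, Equiv.Perm.one_apply]
    have heD : ∀ e, ∃ g, (.inr (.inl (ρ.edgeMap g⁻¹ e)) : X.V ⊕ X.E ⊕ X.S) ∈ D := by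
      intro e
      obtain ⟨g, f, hf, rfl⟩ := hB' e
      refine ⟨g, .inl (.inr ⟨f, hf, ?_⟩)⟩
      rw [← edgeMap_mul, inv_mul_cancel, edgeMap_one]
      rfl
    have hsD : ∀ s, ∃ g, (.inr (.inr (ρ.squareMap g⁻¹ s)) : X.V ⊕ X.E ⊕ X.S) ∈ D := by
      intro s
      obtain ⟨g, r, hr, rfl⟩ := hC' s
      refine ⟨g, .inr ⟨r, hr, ?_⟩⟩
      rw [← (square_mul hρ _ _ _).1, inv_mul_cancel, (square_one hρ r).1]
      rfl
    refine ⟨⋃ c ∈ D, {y : Σ n, X.OrderedSimplex n | carrier y.2 = c},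
      hD.biUnion fun c _ => finite_carrier_eq c hfin, fun n x => ?_⟩
    obtain ⟨g, hg⟩ : ∃ g, carrier (simplexMap hρ g⁻¹ x) ∈ D := by
      cases x with
      | vert v => exact hvD v
      | edge e _ => exact heD e
      | square s => exact hsD s
      | hor e _ _ => exact heD e
      | tri s _ _ _ _ => exact hsD s
      | star e _ _ _ => exact heD e
    refine ⟨g, simplexMap hρ g⁻¹ x, mem_biUnion hg rfl, ?_⟩
    exact simplexMap_mul_inv hρ g x

end geometric

end VHComplex

/-! ### Conclusion -/

theorem corollary2p2 (X : VHComplex.{u}) (hX : X.toSquareComplex.IsCAT0) :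
    X.simplexification.IsSystolic ∧
      ∀ (G : Type u) [Group G] (ρ : X.toSquareComplex.Action G),
        VHComplex.PreservesVH ρ → ρ.IsGeometric → IsSystolicGroup G := by
  have := hX.1
  have hsys : X.simplexification.IsSystolic :=
    ⟨VHComplex.simplyConnectedSpace_simplexification,
      VHComplex.isLocallySixLarge_simplexification hX.2⟩
  exact ⟨hsys, fun G _ ρ hρ hgeom => ⟨X.simplexification, hsys,
    VHComplex.simplexificationAction hρ, VHComplex.isGeometric_simplexificationAction hρ hgeom⟩⟩
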